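/- Let $N\ge 1$, $\ell_1,\dots,\ell_N\in\mathbb C$ (spins) and $\delta_1,\dots,\delta_N\in\mathbb C$ (inhomogeneities), with $2\ell_k\notin\{0,-1,-2,\dots\}$ for all $k$. The algebra $s\ell(2)$ acts on $V_k=\mathbb C[z_k]$ by $S_k=z_k\partial_k+\ell_k$, $S_k^-=-\partial_k$, $S_k^+=z_k^2\partial_k+2\ell_kz_k$, and the transfer matrix on $V_1\otimes\cdots\otimes V_N=\mathbb C[z_1,\dots,z_N]$ is $$\mathbf t(u)=\operatorname{tr}_{\mathbb C^2}L_1(u+\delta_1)\cdots L_N(u+\delta_N),\qquad L_k(u)=\begin{pmatrix}u+\ell_k+z_k\partial_k&-\partial_k\\ z_k^2\partial_k+2\ell_kz_k&u-\ell_k-z_k\partial_k\end{pmatrix}.$$ For a function $f$ on $\{0,1,2,\dots\}$ let $f(z_{ij}\partial_i)$, $z_{ij}=z_i-z_j$, be the operator which multiplies $z_{ij}^n\,g$ by $f(n)$ whenever the polynomial $g$ does not contain $z_i$. Let $P_{ij}$ interchange $z_i$ and $z_j$, and put $$\mathcal R^+_{ij}(u_+|v_+,v_-)=\frac{\Gamma(v_+-v_-)}{\Gamma(u_+-v_-)}\frac{\Gamma(z_{ji}\partial_j+u_+-v_-)}{\Gamma(z_{ji}\partial_j+v_+-v_-)},\qquad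 \mathcal R^-_{ij}(u_+,u_-|v_-)=\frac{\Gamma(u_+-u_-)}{\Gamma(u_+-v_-)}\frac{\Gamma(z_{ij}\partial_i+u_+-v_-)}{\Gamma(z_{ij}\partial_i+u_+-u_-)},$$ where the quotients $\frac{\Gamma(b)\Gamma(n+a)}{\Gamma(a)\Gamma(n+b)}$ are read as $(a)_n/(b)_n$, with $(a)_n=a(a+1)\cdots(a+n-1)$, and $$\mathbb R_{ij}(u_+,u_-|v_+,v_-)=P_{ij}\,\mathcal R^+_{ij}(u_+|v_+,u_-)\,\mathcal R^-_{ij}(u_+,u_-|v_-).$$ With an auxiliary space $V_0=\mathbb C[z_0]$ of spin $\ell_0$ let $\mathbb R_{k0}(u)=\mathbb R_{k0}(u+\ell_k,u-\ell_k|\ell_0,-\ell_0)$ and $$\mathbf Q(u_1|u_2)=\operatorname{tr}_{V_0}\mathbb R_{10}(u+\delta_1)\mathbb R_{20}(u+\delta_2)\cdots\mathbb R_{N0}(u+\delta_N),\qquad u_1=1+u-\ell_0,\quad u_2=u+\ell_0,$$ where the trace is $(\operatorname{tr}_{V_0}A)\Psi=\sum_{m\ge0}\frac1{m!}\partial_0^mA\,z_0^m\Psi\big|_{z_0=0}$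 for $\Psi\in\mathbb C[z_1,\dots,z_N]$, and the series is said to converge if all its coefficients (as polynomials in $z_1,\dots,z_N$) converge absolutely and the sum is a polynomial. Call $u_1\in\mathbb C$ admissible if $\ell_k+1-u_1-\delta_k\notin\{0,-1,-2,\dots\}$ for all $k$ and, in addition, either $\operatorname{Re}\sum_k2\ell_k>1$ or $u_1+\delta_k+\ell_k-1\in\{0,1,2,\dots\}$ for some $k$. Put $\Delta_\pm(u)=\prod_{k=1}^N(u+\delta_k\pm\ell_k)$. **(A)** If $u_1$ and $v_1$ are admissible, then for all $u_2,v_2,v\in\mathbb C$: the series which defines $\mathbf Q(u_1|u_2)$ converges on every $\Psi$; $\mathbf Q(u_1|u_2)$ commutes with the total generators $\sum_kS_k$, $\sum_kS_k^+$, $\sum_kS_k^-$; and $$[\mathbf Q(u_1|u_2),\mathbf Q(v_1|v_2)]=0,\qquad[\mathbf Q(u_1|u_2),\mathbf t(v)]=0.$$ Moreover, for all $u\in\mathbb C$, $\mathbf Q(u_1|u)\mathbf t(u)=\Delta_+(u)\mathbf Q(u_1|u+1)+\Delta_-(u)\mathbf Q(u_1|u-1)$, and if $u-1,u,u+1$ are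 admissible, $$\mathbf t(u)\mathbf Q(u|u_2)=\frac{\Delta_+(u-1)\Delta_-(u)}{\Delta_-(u-1)}\mathbf Q(u-1|u_2)+\Delta_-(u)\mathbf Q(u+1|u_2).$$ **(B)** Homogeneous chain: let $\ell_k=\ell$ and $\delta_k=0$ for all $k$ and, with $u_\pm=u\pm\ell$, $$\mathbf Q_-(u)=\operatorname{tr}_{V_0}\prod_{k=1}^{N}P_{k0}\mathcal R^-_{k0}(u_+,u_-|0),\qquad \mathbf Q_+(u)=\operatorname{tr}_{V_0}\prod_{k=1}^{N}P_{k0}\mathcal R^+_{k0}(u_+|1,u_-)$$ (products in the order $k=1,\dots,N$). The series for $\mathbf Q_-(u)$ converges for all $u\in\mathbb C$ and that for $\mathbf Q_+(u)$ for all admissible $u$, and $\mathbf Q_-(u)=\mathbf Q(1-\ell|u)$, $\mathbf Q_+(u)=\mathbf Q(u|\ell)$. For all $u,v\in\mathbb C$ (admissible where they are arguments of $\mathbf Q_+$), $\mathbf Q_\pm(u)$ commute with the total $s\ell(2)$ generators, $$[\mathbf Q_\pm(u),\mathbf Q_\pm(v)]=0,\quad[\mathbf Q_+(u),\mathbf Q_-(v)]=0,\quad[\mathbf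 Q_\pm(u),\mathbf t(v)]=0,$$ $$\mathbf Q_-(u)\mathbf t(u)=\Delta_+(u)\mathbf Q_-(u+1)+\Delta_-(u)\mathbf Q_-(u-1),\qquad\Delta_\pm(u)=(u\pm\ell)^N,$$ and, if $u-1,u,u+1$ are admissible, $$\mathbf t(u)\mathbf Q_+(u)=\frac{\Delta_+(u-1)\Delta_-(u)}{\Delta_-(u-1)}\mathbf Q_+(u-1)+\Delta_-(u)\mathbf Q_+(u+1).$$ -/

import Mathlib

open MvPolynomial

noncomputable section

namespace XXX

/-- The quotient `Γ(b) Γ(n + a) / (Γ(a) Γ(n + b)) = (a)_n / (b)_n` of Pochhammer symbols; the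
value in terms of the Gamma function is proved in `gammaRatio_eq`. -/
def gammaRatio (a b : ℂ) (n : ℕ) : ℂ :=
  (ascPochhammer ℂ n).eval a / (ascPochhammer ℂ n).eval b

theorem gamma_nat_add (a : ℂ) (ha : ∀ n : ℕ, a ≠ -(n : ℂ)) (n : ℕ) :
    Complex.Gamma (n + a) = (ascPochhammer ℂ n).eval a * Complex.Gamma a := by
  induction n with
  | zero => simp
  | succ k ih =>
    have h : (k : ℂ) + a ≠ 0 := fun h => ha k (by linear_combination h)
    have e : ((k + 1 : ℕ) : ℂ) + a = ((k : ℂ) + a) + 1 := by push_cast; ring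
    rw [e, Complex.Gamma_add_one _ h, ih, ascPochhammer_succ_eval]
    ring

theorem gammaRatio_eq (a b : ℂ) (ha : ∀ n : ℕ, a ≠ -(n : ℂ)) (hb : ∀ n : ℕ, b ≠ -(n : ℂ))
    (n : ℕ) :
    gammaRatio a b n = Complex.Gamma b / Complex.Gamma a *
      (Complex.Gamma (n + a) / Complex.Gamma (n + b)) := by
  have h1 := Complex.Gamma_ne_zero ha
  have h2 := Complex.Gamma_ne_zero hb
  rw [gamma_nat_add a ha, gamma_nat_add b hb, gammaRatio]
  field_simp

section Local

variable {σ : Type} [DecidableEq σ]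

/-- The substitution `z_i ↦ z_i + c z_j` on polynomials. -/
def shift (i j : σ) (c : ℂ) : Module.End ℂ (MvPolynomial σ ℂ) :=
  (aeval fun k => if k = i then X i + C c * X j else X k :
    MvPolynomial σ ℂ →ₐ[ℂ] MvPolynomial σ ℂ).toLinearMap

/-- The operator `f(z_i ∂_i)`, which multiplies a monomial of degree `n` in `z_i` by `f n`. -/
def eulerFun (i : σ) (f : ℕ → ℂ) : Module.End ℂ (MvPolynomial σ ℂ) :=
  (basisMonomials σ ℂ).constr ℂ fun s => monomial s (f (s i))

/-- The operator `f(z_{ij} ∂_i)`, where `z_{ij} = z_i - z_j` (and `i ≠ j`): it multiplies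
`(z_i - z_j)^n` times any polynomial that does not contain `z_i` by `f n`. -/
def diffFun (i j : σ) (f : ℕ → ℂ) : Module.End ℂ (MvPolynomial σ ℂ) :=
  shift i j (-1) * eulerFun i f * shift i j 1

/-- The permutation operator `P_{ij}`, which interchanges the variables `z_i` and `z_j`. -/
def perm (i j : σ) : Module.End ℂ (MvPolynomial σ ℂ) :=
  (rename (Equiv.swap i j) : MvPolynomial σ ℂ →ₐ[ℂ] MvPolynomial σ ℂ).toLinearMap

/-- `𝓡⁺_{ij}(u₊|v₊,v₋) = Γ(v₊-v₋)/Γ(u₊-v₋) · Γ(z_{ji}∂_j+u₊-v₋)/Γ(z_{ji}∂_j+v₊-v₋)`. -/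
def Rplus (i j : σ) (up vp vm : ℂ) : Module.End ℂ (MvPolynomial σ ℂ) :=
  diffFun j i (gammaRatio (up - vm) (vp - vm))

/-- `𝓡⁻_{ij}(u₊,u₋|v₋) = Γ(u₊-u₋)/Γ(u₊-v₋) · Γ(z_{ij}∂_i+u₊-v₋)/Γ(z_{ij}∂_i+u₊-u₋)`. -/
def Rminus (i j : σ) (up um vm : ℂ) : Module.End ℂ (MvPolynomial σ ℂ) :=
  diffFun i j (gammaRatio (up - vm) (up - um))

/-- The general R-matrix
`R_{ij}(u₊,u₋|v₊,v₋) = P_{ij} 𝓡⁺_{ij}(u₊|v₊,u₋) 𝓡⁻_{ij}(u₊,u₋|v₋)`. -/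
def Rmatrix (i j : σ) (up um vp vm : ℂ) : Module.End ℂ (MvPolynomial σ ℂ) :=
  perm i j * Rplus i j up vp um * Rminus i j up um vm

/-- Multiplication by the variable `z_i`. -/
def mulZ (i : σ) : Module.End ℂ (MvPolynomial σ ℂ) :=
  LinearMap.mulLeft ℂ (X i)

/-- The derivative `∂_i`. -/
def del (i : σ) : Module.End ℂ (MvPolynomial σ ℂ) :=
  (pderiv i : Derivation ℂ (MvPolynomial σ ℂ) (MvPolynomial σ ℂ)).toLinearMap

/-- The Lax operator `L_i(u₊,u₋)`. -/
def lax (i : σ) (up um : ℂ) : Matrix (Fin 2) (Fin 2) (Module.End ℂ (MvPolynomial σ ℂ)) :=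
  !![up • (1 : Module.End ℂ (MvPolynomial σ ℂ)) + mulZ i * del i, -del i;
     mulZ i ^ 2 * del i + (up - um) • mulZ i,
     um • (1 : Module.End ℂ (MvPolynomial σ ℂ)) - mulZ i * del i]

end Local

section Chain

variable {N : ℕ}

/-- The quantum space `V_1 ⊗ ⋯ ⊗ V_N = ℂ[z_1, …, z_N]`. -/
abbrev Quantum (N : ℕ) : Type := MvPolynomial (Fin N) ℂ

/-- The space `V_0 ⊗ V_1 ⊗ ⋯ ⊗ V_N`; the variable with index `0` is that of the auxiliary space,
and `z_k` is the variable with index `k.succ`. -/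
abbrev Extended (N : ℕ) : Type := MvPolynomial (Fin (N + 1)) ℂ

/-- The total generator `S_1 + ⋯ + S_N`, with `S_k = z_k ∂_k + ℓ_k`. -/
def totalS (ℓ : Fin N → ℂ) : Module.End ℂ (Quantum N) :=
  ∑ k, (mulZ k * del k + ℓ k • (1 : Module.End ℂ (Quantum N)))

/-- The total lowering generator, a sum of `-∂_k`. -/
def totalSminus (N : ℕ) : Module.End ℂ (Quantum N) :=
  ∑ k, -del k

/-- The total raising generator, a sum of `z_k² ∂_k + 2 ℓ_k z_k`. -/
def totalSplus (ℓ : Fin N → ℂ) : Module.End ℂ (Quantum N) :=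
  ∑ k, (mulZ k ^ 2 * del k + (2 * ℓ k) • mulZ k)

/-- The transfer matrix `t(u) = tr L_1(u+δ_1) ⋯ L_N(u+δ_N)`, with the trace over `ℂ²`. -/
def transfer (ℓ δ : Fin N → ℂ) (u : ℂ) : Module.End ℂ (Quantum N) :=
  ((List.ofFn fun k => lax k (u + δ k + ℓ k) (u + δ k - ℓ k)).prod).trace

/-- `T` is the trace of `A` over the auxiliary space `V_0 = ℂ[z_0]`:
`T Ψ = ∑_m (1/m!) ∂_0^m A z_0^m Ψ |_{z_0 = 0}`, that is, for every `Ψ` the coefficients of `z_0^m`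
in `A z_0^m Ψ` form a series (over `m`) that converges, coefficient by coefficient, to `T Ψ`. -/
def IsAuxTrace (A : Module.End ℂ (Extended N)) (T : Module.End ℂ (Quantum N)) : Prop :=
  ∀ (Ψ : Quantum N) (s : Fin N →₀ ℕ),
    HasSum (fun m : ℕ => coeff (Finsupp.cons m s) (A (X 0 ^ m * rename Fin.succ Ψ)))
      (coeff s (T Ψ))

open Classical in
/-- The trace over the auxiliary space (with the value `0` if the series diverges). -/
def auxTrace (A : Module.End ℂ (Extended N)) : Module.End ℂ (Quantum N) :=
  if h : ∃ T, IsAuxTrace A T then h.choose else 0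

/-- The product `R_{10}(u+δ_1) R_{20}(u+δ_2) ⋯ R_{N0}(u+δ_N)` with spin `ℓ₀` in the auxiliary
space: the first space of each factor has spin `ℓ_k` and spectral parameter `u+δ_k`, the second
one has spin `ℓ₀` and spectral parameter `0`. -/
def monodromy (ℓ δ : Fin N → ℂ) (u ℓ₀ : ℂ) : Module.End ℂ (Extended N) :=
  (List.ofFn fun k : Fin N =>
    Rmatrix k.succ 0 (u + δ k + ℓ k) (u + δ k - ℓ k) ℓ₀ (-ℓ₀)).prod

/-- The product of R-matrices in the parameters `u₁ = 1 + u - ℓ₀` and `u₂ = u + ℓ₀`. -/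
def monodromy₂ (ℓ δ : Fin N → ℂ) (u₁ u₂ : ℂ) : Module.End ℂ (Extended N) :=
  monodromy ℓ δ ((u₁ + u₂ - 1) / 2) ((u₂ - u₁ + 1) / 2)

/-- The operator `Q(u₁|u₂)`. -/
def Q (ℓ δ : Fin N → ℂ) (u₁ u₂ : ℂ) : Module.End ℂ (Quantum N) :=
  auxTrace (monodromy₂ ℓ δ u₁ u₂)

/-- `Δ₊(u) = (u+δ_1+ℓ_1) ⋯ (u+δ_N+ℓ_N)`. -/
def DeltaPlus (ℓ δ : Fin N → ℂ) (u : ℂ) : ℂ := ∏ k, (u + δ k + ℓ k)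

/-- `Δ₋(u) = (u+δ_1-ℓ_1) ⋯ (u+δ_N-ℓ_N)`. -/
def DeltaMinus (ℓ δ : Fin N → ℂ) (u : ℂ) : ℂ := ∏ k, (u + δ k - ℓ k)

/-- The spins are generic: no `ℓ_k` is one of `0, -1/2, -1, -3/2, …`. -/
def GenericSpins (ℓ : Fin N → ℂ) : Prop := ∀ (k : Fin N) (n : ℕ), 2 * ℓ k ≠ -(n : ℂ)

/-- The values of `u₁` for which the R-matrices have no pole and the trace that defines
`Q(u₁|u₂)` converges: either the spins are large enough, or the series is finite. -/
def Admissible (ℓ δ : Fin N → ℂ) (u₁ : ℂ) : Prop :=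
  (∀ (k : Fin N) (n : ℕ), ℓ k + 1 - u₁ - δ k ≠ -(n : ℂ)) ∧
    (1 < (∑ k, 2 * ℓ k).re ∨ ∃ (k : Fin N) (n : ℕ), u₁ + δ k + ℓ k - 1 = (n : ℂ))

/-- The product `P_{10} 𝓡⁻_{10}(u₊,u₋|0) ⋯ P_{N0} 𝓡⁻_{N0}(u₊,u₋|0)`, where `u_± = u ± ℓ`. -/
def monodromyMinus (N : ℕ) (ℓ u : ℂ) : Module.End ℂ (Extended N) :=
  (List.ofFn fun k : Fin N => perm k.succ 0 * Rminus k.succ 0 (u + ℓ) (u - ℓ) 0).prod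

/-- The product `P_{10} 𝓡⁺_{10}(u₊|1,u₋) ⋯ P_{N0} 𝓡⁺_{N0}(u₊|1,u₋)`, where `u_± = u ± ℓ`. -/
def monodromyPlus (N : ℕ) (ℓ u : ℂ) : Module.End ℂ (Extended N) :=
  (List.ofFn fun k : Fin N => perm k.succ 0 * Rplus k.succ 0 (u + ℓ) 1 (u - ℓ)).prod

/-- The operator `Q₋(u)` of the homogeneous chain with `N` sites of spin `ℓ`. -/
def Qminus (N : ℕ) (ℓ u : ℂ) : Module.End ℂ (Quantum N) := auxTrace (monodromyMinus N ℓ u)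

/-- The operator `Q₊(u)` of the homogeneous chain with `N` sites of spin `ℓ`. -/
def Qplus (N : ℕ) (ℓ u : ℂ) : Module.End ℂ (Quantum N) := auxTrace (monodromyPlus N ℓ u)

/-- The operator `A` commutes with the three total generators of `sl(2)`. -/
def IsSl2Invariant (ℓ : Fin N → ℂ) (A : Module.End ℂ (Quantum N)) : Prop :=
  Commute A (totalS ℓ) ∧ Commute A (totalSplus ℓ) ∧ Commute A (totalSminus N)

end Chain

end XXX

end

noncomputable section

namespace XXX

/-! ### Operator calculus of functions of `z_{ij} ∂_i` -/

section Calculus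

set_option linter.unusedSectionVars false

variable {σ : Type} [DecidableEq σ]

/-! The trace over `V_0` is first replaced by a formal object. Let Q_τ(u₁|u₂) be the power series in
τ whose coefficients are the diagonal blocks of the product of R-matrices with respect to powers of
`z_0` (`qSeries`), and let t_τ(x) = D(x) + τ A(x) be the transfer matrix with a twist (`tSeries`),
where A and D are the diagonal entries of the product of Lax operators. The relations are proved
between power series, where nothing has to converge, and then evaluated at τ = 1.

Two facts about the R-matrix of one site carry the algebra. First, conjugation with the matrix (1,
0; z_0, 1) makes "R-matrix times Lax operator" upper triangular, with u₂ shifted by ±1 on the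
diagonal (`gauge_siteOp_mul_lax`). Multiplied over the sites and read in blocks, this is the Baxter
equation Q_τ(u₁|x) t_τ(x) = Δ₋(x) Q_τ(u₁|x-1) + τ Δ₊(x) Q_τ(u₁|x+1) (`isBaxter_qSeries`). Second, on
the line u₂ = u₁ - 1 the derivative `∂_0` passes through the R-matrix at the cost of a scalar and of
shifts of the parameters (`del_mul_siteOp`). This gives the normalisation Q_τ(u|u-1) = 1 + c τ
Q_τ(u-1|u) with a scalar c (`qSeries_wronskian`).

For u₁ without poles these two relations are rigid. The lowest order in τ of a solution of the
Baxter equation obeys a first-order recursion in x. If it vanishes at a point x₀ such that Δ₋ has no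
zero at any x₀ - j, then it vanishes at all x₀ - j, hence everywhere, because it is polynomial in x
(`coeff_eq_zero_of_isBaxter`). Applied to the commutator of Q_τ(u|x) with any series C that commutes
with all t_τ, this gives commutativity order by order (`commute_qSeries`): first for C = t_τ(v),
where the Yangian relations provide the hypothesis, then for C another Q_τ. Applied to the
difference of its two sides, it gives the Baxter equation in u₁ (`tSeries_mul_qSeries`).

For the evaluation at τ = 1, the action of the R-matrix on monomials is expanded explicitly. Its
coefficients at site k are bounded by a multiple of m^(-2 Re ℓ_k), where m is the degree in `z_0`,
or by any power of m if the series terminates there. Conservation of the total degree leaves one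
intermediate monomial between consecutive sites, so the exponents add up (`Decays.mul`), and
admissibility makes their sum smaller than -1. Products of series may be evaluated factor by factor,
again because the degree is conserved (`EvalsTo.mul`). For `S^±` the same exponent kills the
boundary terms of a telescoping sum (`commute_of_telescope`), while `S` acts by scalars on each
degree. Part (B) consists of the special values of u₁ and u₂ at which one factor of the R-matrix is
the identity. -/

theorem linearMap_eq_of_pderiv_eq_zero {M : Type*} [AddCommGroup M] [Module ℂ M] {i : σ}
    (A B : MvPolynomial σ ℂ →ₗ[ℂ] M)
    (h : ∀ t : σ →₀ ℕ, t i = 0 → A (monomial t 1) = B (monomial t 1))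
    {g : MvPolynomial σ ℂ} (hg : pderiv i g = 0) : A g = B g := by
  have key : ∀ t ∈ g.support, t i = 0 := by
    intro t ht
    by_contra hne
    have h1 := coeff_pderiv (i := i) g (t - Finsupp.single i 1)
    have h2 : t - Finsupp.single i 1 + Finsupp.single i 1 = t := by
      apply tsub_add_cancel_of_le
      simpa using Nat.one_le_iff_ne_zero.2 hne
    rw [hg, h2, coeff_zero] at h1
    have h3 : (((t - Finsupp.single i 1 : σ →₀ ℕ) i : ℕ) : ℂ) + 1 ≠ 0 := Nat.cast_add_one_ne_zero _
    exact (mem_support_iff.1 ht) ((mul_eq_zero.1 h1.symm).resolve_right h3)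
  rw [← support_sum_monomial_coeff g, map_sum, map_sum]
  refine Finset.sum_congr rfl fun t ht => ?_
  have : monomial t (coeff t g) = coeff t g • monomial t (1 : ℂ) := by
    rw [smul_monomial, smul_eq_mul, mul_one]
  rw [this, map_smul, map_smul, h t (key t ht)]

/-- The substitution `shift` as an algebra homomorphism. -/
def shiftHom (i j : σ) (c : ℂ) : MvPolynomial σ ℂ →ₐ[ℂ] MvPolynomial σ ℂ :=
  aeval fun k => if k = i then X i + C c * X j else X k

theorem shift_apply (i j : σ) (c : ℂ) (p : MvPolynomial σ ℂ) :
    shift i j c p = shiftHom i j c p := rfl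

theorem shiftHom_X_self (i j : σ) (c : ℂ) : shiftHom i j c (X i) = X i + C c * X j := by
  simp [shiftHom]

theorem shiftHom_X_of_ne {i j k : σ} (h : k ≠ i) (c : ℂ) : shiftHom i j c (X k) = X k := by
  simp [shiftHom, h]

theorem shiftHom_shiftHom {i j : σ} (hij : i ≠ j) (c d : ℂ) (h : c + d = 0)
    (p : MvPolynomial σ ℂ) : shiftHom i j c (shiftHom i j d p) = p := by
  have : (shiftHom i j c).comp (shiftHom i j d) = AlgHom.id ℂ (MvPolynomial σ ℂ) := by
    ext k : 1
    by_cases hk : k = i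
    · subst hk
      simp only [AlgHom.comp_apply, shiftHom_X_self, map_add, map_mul, shiftHom_X_of_ne hij.symm,
        AlgHom.id_apply]
      rw [← algebraMap_eq, AlgHom.commutes, algebraMap_eq, add_assoc, ← add_mul, ← C_add, h]
      simp
    · simp [shiftHom_X_of_ne hk]
  exact DFunLike.congr_fun this p

theorem monomial_eq_X_pow_mul (i : σ) (t : σ →₀ ℕ) :
    monomial t (1 : ℂ) = X i ^ t i * monomial (t.erase i) 1 := by
  rw [X_pow_eq_monomial, monomial_mul, one_mul, Finsupp.single_add_erase]

theorem pderiv_monomial_eq_zero {i : σ} {t : σ →₀ ℕ} (h : t i = 0) :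
    pderiv i (monomial t (1 : ℂ)) = 0 := by
  simp [pderiv_monomial, h]

theorem shiftHom_eq_self {i j : σ} (c : ℂ) {g : MvPolynomial σ ℂ} (hg : pderiv i g = 0) :
    shiftHom i j c g = g := by
  refine linearMap_eq_of_pderiv_eq_zero (shiftHom i j c).toLinearMap LinearMap.id ?_ hg
  intro t ht
  simp only [AlgHom.toLinearMap_apply, LinearMap.id_apply, shiftHom, aeval_monomial, map_one,
    one_mul]
  rw [monomial_eq, C_1, one_mul]
  refine Finset.prod_congr rfl fun k hk => ?_
  have : k ≠ i := by rintro rfl; exact (Finsupp.mem_support_iff.1 hk) ht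
  simp [this]

theorem eulerFun_monomial (i : σ) (f : ℕ → ℂ) (t : σ →₀ ℕ) :
    eulerFun i f (monomial t 1) = f (t i) • monomial t 1 := by
  have : (monomial t (1 : ℂ)) = basisMonomials σ ℂ t := by simp
  rw [eulerFun, this, Module.Basis.constr_basis]
  simp [smul_monomial]

theorem eulerFun_X_pow_mul (i : σ) (f : ℕ → ℂ) (n : ℕ) {g : MvPolynomial σ ℂ}
    (hg : pderiv i g = 0) : eulerFun i f (X i ^ n * g) = f n • (X i ^ n * g) := by
  refine linearMap_eq_of_pderiv_eq_zero
    (eulerFun i f ∘ₗ LinearMap.mulLeft ℂ (X i ^ n)) (f n • LinearMap.mulLeft ℂ (X i ^ n)) ?_ hg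
  intro t ht
  simp only [LinearMap.comp_apply, LinearMap.mulLeft_apply, LinearMap.smul_apply]
  rw [X_pow_eq_monomial, monomial_mul, one_mul, eulerFun_monomial]
  simp [ht]

theorem diffFun_apply {i j : σ} (hij : i ≠ j) (f : ℕ → ℂ) (n : ℕ) {g : MvPolynomial σ ℂ}
    (hg : pderiv i g = 0) :
    diffFun i j f ((X i - X j) ^ n * g) = f n • ((X i - X j) ^ n * g) := by
  have h1 : shiftHom i j 1 ((X i - X j) ^ n * g) = X i ^ n * g := by
    rw [map_mul, map_pow, map_sub, shiftHom_X_self, shiftHom_X_of_ne hij.symm,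
      shiftHom_eq_self 1 hg]
    simp
  have h2 : shiftHom i j (-1) (X i ^ n * g) = (X i - X j) ^ n * g := by
    rw [← h1, shiftHom_shiftHom hij _ _ (by norm_num)]
  simp only [diffFun, Module.End.mul_apply, shift_apply, h1]
  rw [eulerFun_X_pow_mul i f n hg, map_smul, h2]

/-- The invertible substitution `z_i ↦ z_i - z_j` turns monomials into products of this form. Since
`diffFun` acts on them by a scalar, identities between such operators become identities between
functions of `n`. -/
theorem linearMap_ext_diff {M : Type*} [AddCommGroup M] [Module ℂ M] {i j : σ} (hij : i ≠ j)
    {A B : MvPolynomial σ ℂ →ₗ[ℂ] M}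
    (h : ∀ (n : ℕ) (g : MvPolynomial σ ℂ), pderiv i g = 0 →
      A ((X i - X j) ^ n * g) = B ((X i - X j) ^ n * g)) : A = B := by
  have key : A ∘ₗ (shiftHom i j (-1)).toLinearMap = B ∘ₗ (shiftHom i j (-1)).toLinearMap := by
    refine (basisMonomials σ ℂ).ext fun t => ?_
    have ht : pderiv i (monomial (t.erase i) (1 : ℂ)) = 0 :=
      pderiv_monomial_eq_zero (by simp)
    simp only [coe_basisMonomials, LinearMap.comp_apply, AlgHom.toLinearMap_apply]
    rw [monomial_eq_X_pow_mul i t, map_mul, map_pow, shiftHom_X_self, shiftHom_eq_self _ ht]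
    simpa [sub_eq_add_neg] using h (t i) _ ht
  refine LinearMap.ext fun p => ?_
  have := DFunLike.congr_fun key (shiftHom i j 1 p)
  simpa [shiftHom_shiftHom hij (-1) 1 (by norm_num)] using this

theorem pderiv_sub_pow_mul {i j : σ} (hij : i ≠ j) (n : ℕ) {g : MvPolynomial σ ℂ}
    (hg : pderiv i g = 0) :
    pderiv i ((X i - X j) ^ (n + 1) * g) = ((n : ℂ) + 1) • ((X i - X j) ^ n * g) := by
  rw [pderiv_mul, hg, pderiv_pow, map_sub, pderiv_X_self, pderiv_X_of_ne hij.symm]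
  simp only [smul_eq_C_mul, map_add, map_natCast, map_one]
  push_cast
  simp
  ring

theorem pderiv_comm (i j : σ) (p : MvPolynomial σ ℂ) :
    pderiv i (pderiv j p) = pderiv j (pderiv i p) := by
  have : ⁅pderiv (R := ℂ) i, pderiv j⁆ = (0 : Derivation ℂ (MvPolynomial σ ℂ) _) := by
    apply derivation_ext
    intro k
    rw [Derivation.commutator_apply]
    by_cases hj : k = j <;> by_cases hi : k = i <;> simp [pderiv_X, Pi.single_apply, hi, hj] <;>
      split_ifs <;> simp
  have h := DFunLike.congr_fun this p
  rw [Derivation.commutator_apply] at h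
  exact sub_eq_zero.1 h

theorem diffFun_one {i j : σ} (hij : i ≠ j) : diffFun i j 1 = 1 :=
  linearMap_ext_diff hij fun n g hg => by simp [diffFun_apply hij _ n hg]

theorem diffFun_mul {i j : σ} (hij : i ≠ j) (f g : ℕ → ℂ) :
    diffFun i j f * diffFun i j g = diffFun i j (f * g) :=
  linearMap_ext_diff hij fun n p hp => by
    simp [diffFun_apply hij _ n hp, smul_smul, mul_comm (f n)]

theorem diffFun_add {i j : σ} (hij : i ≠ j) (f g : ℕ → ℂ) :
    diffFun i j (f + g) = diffFun i j f + diffFun i j g :=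
  linearMap_ext_diff hij fun n p hp => by
    simp [diffFun_apply hij _ n hp, add_smul]

theorem diffFun_smul {i j : σ} (hij : i ≠ j) (c : ℂ) (f : ℕ → ℂ) :
    diffFun i j (c • f) = c • diffFun i j f :=
  linearMap_ext_diff hij fun n p hp => by
    simp [diffFun_apply hij _ n hp, mul_smul]

theorem del_mul_diffFun {i j : σ} (hij : i ≠ j) (f : ℕ → ℂ) :
    del i * diffFun i j f = diffFun i j (fun n => f (n + 1)) * del i :=
  linearMap_ext_diff hij fun n g hg => by
    simp only [Module.End.mul_apply, diffFun_apply hij _ n hg, del, Derivation.coeFn_coe,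
      map_smul]
    cases n with
    | zero => simp [hg]
    | succ n => rw [pderiv_sub_pow_mul hij n hg, map_smul, diffFun_apply hij _ n hg, smul_comm]

theorem mulZ_sub_mul_diffFun {i j : σ} (hij : i ≠ j) (f : ℕ → ℂ) :
    (mulZ i - mulZ j) * diffFun i j (fun n => f (n + 1)) = diffFun i j f * (mulZ i - mulZ j) :=
  linearMap_ext_diff hij fun n g hg => by
    simp only [Module.End.mul_apply, diffFun_apply hij _ n hg, mulZ, LinearMap.sub_apply,
      LinearMap.mulLeft_apply, ← sub_mul]
    rw [← mul_assoc, ← pow_succ', diffFun_apply hij _ _ hg, mul_smul_comm, ← mul_assoc, pow_succ']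

theorem mulZ_sub_mul_del {i j : σ} (hij : i ≠ j) :
    (mulZ i - mulZ j) * del i = diffFun i j (fun n => (n : ℂ)) :=
  linearMap_ext_diff hij fun n g hg => by
    simp only [Module.End.mul_apply, diffFun_apply hij _ n hg, mulZ, LinearMap.sub_apply,
      LinearMap.mulLeft_apply, ← sub_mul, del, Derivation.coeFn_coe]
    cases n with
    | zero => simp [hg]
    | succ n =>
      rw [pderiv_sub_pow_mul hij n hg, mul_smul_comm, ← mul_assoc, ← pow_succ']
      push_cast; rfl

theorem commute_mulZ_diffFun {i j k : σ} (hij : i ≠ j) (hk : k ≠ i) (f : ℕ → ℂ) :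
    Commute (mulZ k) (diffFun i j f) :=
  linearMap_ext_diff hij fun n g hg => by
    have h : pderiv i (X k * g) = 0 := by simp [hg, pderiv_X_of_ne hk]
    simp only [Module.End.mul_apply, diffFun_apply hij _ n hg, mulZ, LinearMap.mulLeft_apply]
    rw [mul_left_comm, diffFun_apply hij _ n h, mul_smul_comm, mul_left_comm]

/-- Translation invariance: `∂_i + ∂_j` kills `z_i - z_j`. -/
theorem commute_del_add_diffFun {i j : σ} (hij : i ≠ j) (f : ℕ → ℂ) :
    Commute (del i + del j) (diffFun i j f) :=
  linearMap_ext_diff hij fun n g hg => by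
    have h : pderiv i (pderiv j g) = 0 := by rw [pderiv_comm, hg, map_zero]
    have h2 : pderiv i ((X i - X j) ^ n * g) + pderiv j ((X i - X j) ^ n * g)
        = (X i - X j) ^ n * pderiv j g := by
      rw [pderiv_mul, pderiv_mul, hg, pderiv_pow, pderiv_pow, map_sub, map_sub, pderiv_X_self,
        pderiv_X_self, pderiv_X_of_ne hij.symm, pderiv_X_of_ne hij]
      ring
    simp only [Module.End.mul_apply, diffFun_apply hij _ n hg, del, LinearMap.add_apply,
      Derivation.coeFn_coe, map_smul, h2, diffFun_apply hij _ n h]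

theorem commute_del_diffFun {i j k : σ} (hij : i ≠ j) (hi : k ≠ i) (hj : k ≠ j) (f : ℕ → ℂ) :
    Commute (del k) (diffFun i j f) :=
  linearMap_ext_diff hij fun n g hg => by
    have h : pderiv i (pderiv k g) = 0 := by rw [pderiv_comm, hg, map_zero]
    have h2 : pderiv k ((X i - X j) ^ n * g) = (X i - X j) ^ n * pderiv k g := by
      rw [pderiv_mul, pderiv_pow, map_sub, pderiv_X_of_ne hi.symm, pderiv_X_of_ne hj.symm]
      ring
    simp only [Module.End.mul_apply, diffFun_apply hij _ n hg, del, Derivation.coeFn_coe, map_smul,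
      h2, diffFun_apply hij _ n h]

theorem diffFun_mul_of_pderiv_eq_zero {i j : σ} (hij : i ≠ j) (f : ℕ → ℂ)
    {g : MvPolynomial σ ℂ} (hg : pderiv i g = 0) (p : MvPolynomial σ ℂ) :
    diffFun i j f (g * p) = g * diffFun i j f p := by
  have : diffFun i j f ∘ₗ LinearMap.mulLeft ℂ g = LinearMap.mulLeft ℂ g ∘ₗ diffFun i j f :=
    linearMap_ext_diff hij fun n q hq => by
      have h : pderiv i (g * q) = 0 := by simp [hg, hq]
      simp only [LinearMap.comp_apply, diffFun_apply hij _ n hq, LinearMap.mulLeft_apply]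
      rw [mul_left_comm, diffFun_apply hij _ n h, mul_smul_comm, mul_left_comm]
  exact DFunLike.congr_fun this p

/-- Conservation of the total degree is used for convergence, for the finiteness of the range of the
blocks, and for commutation with the total `S`. -/
theorem diffFun_isHomogeneous (i j : σ) (f : ℕ → ℂ) {n : ℕ} {p : MvPolynomial σ ℂ}
    (hp : p.IsHomogeneous n) : (diffFun i j f p).IsHomogeneous n := by
  have hs : ∀ (c : ℂ) {q : MvPolynomial σ ℂ}, q.IsHomogeneous n →
      (shift i j c q).IsHomogeneous n := by
    intro c q hq
    rw [shift_apply, shiftHom]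
    have := hq.aeval (n := 1) (fun k => if k = i then X i + C c * X j else X k) ?_
    · simpa using this
    intro k
    split_ifs
    · refine (isHomogeneous_X ℂ i).add ?_
      simpa using (isHomogeneous_C σ c).mul (isHomogeneous_X ℂ j)
    · exact isHomogeneous_X ℂ k
  have he : ∀ {q : MvPolynomial σ ℂ}, q.IsHomogeneous n → (eulerFun i f q).IsHomogeneous n := by
    intro q hq
    rw [← support_sum_monomial_coeff q, map_sum]
    refine IsHomogeneous.sum _ _ _ fun t ht => ?_
    have : monomial t (coeff t q) = coeff t q • monomial t (1 : ℂ) := by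
      rw [smul_monomial, smul_eq_mul, mul_one]
    rw [this, map_smul, eulerFun_monomial, smul_smul, smul_monomial]
    apply isHomogeneous_monomial
    by_contra hne
    exact mem_support_iff.1 ht (hq.coeff_eq_zero hne)
  rw [diffFun, Module.End.mul_apply, Module.End.mul_apply]
  exact hs _ (he (hs _ hp))

end Calculus

/-! ### The R-matrix of one site: triangularity, derivative in the auxiliary variable, invariance -/

section Site

set_option linter.unusedSectionVars false

variable {σ : Type} [DecidableEq σ]

theorem gammaRatio_zero (a b : ℂ) : gammaRatio a b 0 = 1 := by simp [gammaRatio]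

theorem gammaRatio_succ (a b : ℂ) (n : ℕ) :
    gammaRatio a b (n + 1) = gammaRatio a b n * ((a + n) / (b + n)) := by
  rw [gammaRatio, ascPochhammer_succ_eval, ascPochhammer_succ_eval, mul_div_mul_comm, gammaRatio]

theorem ascPochhammer_eval_add_one (a : ℂ) (n : ℕ) :
    (a + n) * (ascPochhammer ℂ n).eval a = a * (ascPochhammer ℂ n).eval (a + 1) := by
  have h := congrArg (Polynomial.eval a) (ascPochhammer_succ_left ℂ n)
  rw [ascPochhammer_succ_eval] at h
  simp only [Polynomial.eval_mul, Polynomial.eval_X, Polynomial.eval_comp, Polynomial.eval_add,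
    Polynomial.eval_one] at h
  rw [← h, mul_comm]

theorem ascPochhammer_eval_ne_zero {b : ℂ} (hb : ∀ n : ℕ, b ≠ -(n : ℂ)) (n : ℕ) :
    (ascPochhammer ℂ n).eval b ≠ 0 := by
  induction n with
  | zero => simp
  | succ n ih =>
    rw [ascPochhammer_succ_eval]
    exact mul_ne_zero ih fun h => hb n (by linear_combination h)

theorem add_natCast_ne_zero {b : ℂ} (hb : ∀ n : ℕ, b ≠ -(n : ℂ)) (n : ℕ) : b + n ≠ 0 :=
  fun h => hb n (by linear_combination h)

theorem gammaRatio_add_one_left (a b : ℂ) (n : ℕ) :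
    (a + n) * gammaRatio a b n = a * gammaRatio (a + 1) b n := by
  rw [gammaRatio, gammaRatio, ← mul_div_assoc, ← mul_div_assoc, ascPochhammer_eval_add_one]

theorem gammaRatio_add_one_right (a : ℂ) {b : ℂ} (hb : ∀ n : ℕ, b ≠ -(n : ℂ)) (n : ℕ) :
    (b + n) * gammaRatio a (b + 1) n = b * gammaRatio a b n := by
  have h1 := ascPochhammer_eval_add_one b n
  have h2 := ascPochhammer_eval_ne_zero hb n
  have h3 := add_natCast_ne_zero hb n
  have h4 : b ≠ 0 := by simpa using hb 0
  have h5 : (ascPochhammer ℂ n).eval (b + 1) ≠ 0 := by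
    intro h; rw [h, mul_zero] at h1; exact mul_ne_zero h3 h2 h1
  rw [gammaRatio, gammaRatio]
  field_simp
  linear_combination (ascPochhammer ℂ n).eval a * h1

theorem commute_mulZ_mulZ (i j : σ) : Commute (mulZ i) (mulZ j) := by
  refine LinearMap.ext fun p => ?_
  simp [mulZ, mul_left_comm]

theorem commute_del_del (i j : σ) : Commute (del i) (del j) := by
  refine LinearMap.ext fun p => ?_
  simp [del, pderiv_comm i j]

theorem commute_del_mulZ {i j : σ} (h : i ≠ j) : Commute (del i) (mulZ j) := by
  refine LinearMap.ext fun p => ?_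
  simp [del, mulZ, pderiv_X_of_ne h.symm]

theorem del_mul_mulZ (i : σ) : del i * mulZ i = mulZ i * del i + 1 := by
  refine LinearMap.ext fun p => ?_
  simp [del, mulZ, add_comm]

theorem perm_mul_mulZ (i j k : σ) :
    perm i j * mulZ k = mulZ (Equiv.swap i j k) * perm i j := by
  refine LinearMap.ext fun p => ?_
  simp [perm, mulZ]

theorem perm_mul_del (i j k : σ) :
    perm i j * del k = del (Equiv.swap i j k) * perm i j := by
  refine LinearMap.ext fun p => ?_
  simp [perm, del, pderiv_rename (Equiv.swap i j).injective]

/-- The matrix `(1, 0; z_j, 1)`. -/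
def lowerMat (j : σ) : Matrix (Fin 2) (Fin 2) (Module.End ℂ (MvPolynomial σ ℂ)) :=
  !![1, 0; mulZ j, 1]

/-- The inverse of `lowerMat`. -/
def lowerMatInv (j : σ) : Matrix (Fin 2) (Fin 2) (Module.End ℂ (MvPolynomial σ ℂ)) :=
  !![1, 0; -mulZ j, 1]

theorem lowerMat_mul_inv (j : σ) : lowerMat j * lowerMatInv j = 1 := by
  rw [lowerMat, lowerMatInv, Matrix.mul_fin_two, Matrix.one_fin_two]; simp

theorem lowerMatInv_mul (j : σ) : lowerMatInv j * lowerMat j = 1 := by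
  rw [lowerMat, lowerMatInv, Matrix.mul_fin_two, Matrix.one_fin_two]; simp

/-- The operator `P_{ij} f(z_{ji} ∂_j) g(z_{ij} ∂_i)`. -/
def siteOp (i j : σ) (f g : ℕ → ℂ) : Module.End ℂ (MvPolynomial σ ℂ) :=
  perm i j * diffFun j i f * diffFun i j g

theorem diffFun_sub {i j : σ} (hij : i ≠ j) (f g : ℕ → ℂ) :
    diffFun i j (f - g) = diffFun i j f - diffFun i j g := by
  rw [eq_sub_iff_add_eq, ← diffFun_add hij, sub_add_cancel]

/-- The identity function on the degrees, so that `diffFun i j degFun` is `z_{ij} ∂_i`. -/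
def degFun : ℕ → ℂ := fun n => n

theorem degFun_apply (n : ℕ) : degFun n = n := rfl

variable {i j : σ}

theorem mulZ_sub_mul_del' (hij : i ≠ j) :
    (mulZ i - mulZ j) * del i = diffFun i j degFun := mulZ_sub_mul_del hij

theorem diffFun_add_degFun (hij : i ≠ j) (c : ℂ) :
    diffFun i j (c • 1 + degFun) =
      c • (1 : Module.End ℂ (MvPolynomial σ ℂ)) + diffFun i j degFun := by
  rw [diffFun_add hij, diffFun_smul hij, diffFun_one hij]

theorem upper_row_aux {R : Type*} [Ring R] [Algebra ℂ R] (zi zj d : R) (up : ℂ)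
    (h : d * zj = zj * d) : (up • 1 + zi * d) + -d * zj = up • (1 : R) + (zi - zj) * d := by
  rw [neg_mul, h, sub_mul]
  abel

theorem neg_sub_mul_aux {R : Type*} [Ring R] (zi zj d : R) :
    (zi - zj) * d = -((zj - zi) * d) := by
  rw [← neg_mul, neg_sub]

/-- The first row of the Lax operator applied to the column `(1, z_j)` is `u₊ + z_{ij} ∂_i`, a
function of the same operator; the factor `u₊ + n` raises the upper Pochhammer parameter by one. -/
theorem diffFun_mul_lax_first (hij : i ≠ j) (up um : ℂ) :
    diffFun i j (gammaRatio up (up - um)) * (lax i up um 0 0 + lax i up um 0 1 * mulZ j) =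
      up • diffFun i j (gammaRatio (up + 1) (up - um)) := by
  have h : lax i up um 0 0 + lax i up um 0 1 * mulZ j = diffFun i j (up • 1 + degFun) := by
    rw [diffFun_add_degFun hij, ← mulZ_sub_mul_del' hij]
    exact upper_row_aux _ _ _ _ (commute_del_mulZ hij).eq
  rw [h, diffFun_mul hij, ← diffFun_smul hij]
  congr 1
  ext n
  simp only [Pi.mul_apply, Pi.add_apply, Pi.smul_apply, Pi.one_apply, smul_eq_mul, degFun_apply]
  rw [← gammaRatio_add_one_left]
  ring

theorem lower_row_aux {R : Type*} [Ring R] [Algebra ℂ R] (zi zj d : R) (up um : ℂ)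
    (h1 : d * zj = zj * d) (h2 : zi * zj = zj * zi) :
    (zi ^ 2 * d + (up - um) • zi) + (um • 1 - zi * d) * zj =
      (zi - zj) * ((up - um) • 1 + (zi - zj) * d) + zj * (up • 1 + (zi - zj) * d) := by
  have h3 : zi * zj * d = zj * zi * d := by rw [h2]
  simp only [sub_mul, mul_sub, mul_add, smul_mul_assoc, mul_smul_comm, mul_one, one_mul,
    sub_smul, smul_sub, sq, mul_assoc, h1] at h3 ⊢
  rw [h3]
  abel

/-- Together with the first row: the Lax operator, dressed by the Gamma ratio, sends the column `(1,
z_j)` to the column `(1, z_i)` times an operator. Once `P_{ij}` turns `z_i` into `z_j`, this becomes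
the zero in the triangular form. -/
theorem diffFun_mul_lax_second (hij : i ≠ j) {up um : ℂ} (hb : ∀ n : ℕ, up - um ≠ -(n : ℂ)) :
    diffFun i j (gammaRatio up (up - um)) * (lax i up um 1 0 + lax i up um 1 1 * mulZ j) =
      mulZ i * (diffFun i j (gammaRatio up (up - um)) *
        (lax i up um 0 0 + lax i up um 0 1 * mulZ j)) := by
  rw [diffFun_mul_lax_first hij]
  have h : lax i up um 1 0 + lax i up um 1 1 * mulZ j
      = (mulZ i - mulZ j) * diffFun i j ((up - um) • 1 + degFun) +
        mulZ j * diffFun i j (up • 1 + degFun) := by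
    rw [diffFun_add_degFun hij, diffFun_add_degFun hij, ← mulZ_sub_mul_del' hij]
    exact lower_row_aux _ _ _ _ _ (commute_del_mulZ hij).eq (commute_mulZ_mulZ i j).eq
  have hg : ∀ n : ℕ, gammaRatio up (up - um) (n + 1) * ((up - um) + n) =
      up * gammaRatio (up + 1) (up - um) n := by
    intro n
    have := add_natCast_ne_zero hb n
    rw [gammaRatio_succ, ← gammaRatio_add_one_left]
    field_simp
  rw [h, mul_add, ← mul_assoc, ← mulZ_sub_mul_diffFun hij, ← mul_assoc,
    ← (commute_mulZ_diffFun hij hij.symm _).eq, mul_assoc, mul_assoc, diffFun_mul hij,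
    diffFun_mul hij, ← diffFun_smul hij]
  have e1 : ((fun n => gammaRatio up (up - um) (n + 1)) * ((up - um) • 1 + degFun)) =
      up • gammaRatio (up + 1) (up - um) := by
    ext n
    simp only [Pi.mul_apply, Pi.add_apply, Pi.smul_apply, Pi.one_apply, smul_eq_mul, mul_one,
      degFun_apply]
    exact hg n
  have e2 : (gammaRatio up (up - um) * (up • 1 + degFun))
      = up • gammaRatio (up + 1) (up - um) := by
    ext n
    simp only [Pi.mul_apply, Pi.add_apply, Pi.smul_apply, Pi.one_apply, smul_eq_mul, mul_one,
      degFun_apply]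
    rw [← gammaRatio_add_one_left, mul_comm]
  -- The two terms carry the same operator, and `(z_i - z_j) + z_j = z_i`.
  rw [e1, e2, ← add_mul, sub_add_cancel]

theorem lower_diag_aux {R : Type*} [Ring R] [Algebra ℂ R] (zi zj d G : R) (um : ℂ)
    (h1 : zj * G = G * zj) :
    G * (um • 1 - zi * d) - zi * (G * -d) =
      um • G - G * ((zi - zj) * d) + (zi - zj) * G * d := by
  rw [sub_mul zi zj G, h1]
  simp only [sub_mul, mul_sub, mul_smul_comm, mul_one, mul_neg, mul_assoc]
  abel

theorem diffFun_mul_lax_third (hij : i ≠ j) {up um : ℂ} (hb : ∀ n : ℕ, up - um ≠ -(n : ℂ)) :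
    diffFun i j (gammaRatio up (up - um)) * lax i up um 1 1 -
      mulZ i * (diffFun i j (gammaRatio up (up - um)) * lax i up um 0 1) =
      um • diffFun i j (gammaRatio (up - 1) (up - um)) := by
  -- `h` is the Gamma ratio delayed by one step. Its value at `0`, produced by truncated
  -- subtraction, is irrelevant because `h` occurs only multiplied by the degree.
  obtain ⟨h, h0⟩ : ∃ h : ℕ → ℂ, (fun n => h (n + 1)) = gammaRatio up (up - um) :=
    ⟨fun n => gammaRatio up (up - um) (n - 1), rfl⟩
  have e1 : (mulZ i - mulZ j) * diffFun i j (gammaRatio up (up - um)) * del i =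
      diffFun i j (h * degFun) := by
    rw [← h0, mulZ_sub_mul_diffFun hij, mul_assoc, mulZ_sub_mul_del' hij, diffFun_mul hij]
  refine (lower_diag_aux _ _ _ _ um (commute_mulZ_diffFun hij hij.symm _).eq).trans ?_
  rw [e1, mulZ_sub_mul_del' hij, diffFun_mul hij, ← diffFun_smul hij, ← diffFun_smul hij,
    sub_eq_add_neg, ← neg_one_smul ℂ, ← diffFun_smul hij, ← diffFun_add hij, ← diffFun_add hij]
  congr 1
  ext n
  cases n with
  | zero => simp [gammaRatio_zero, degFun]
  | succ n =>
    have hn := add_natCast_ne_zero hb n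
    have e3 := gammaRatio_add_one_left (up - 1) (up - um) n
    have e5 : h (n + 1) = gammaRatio up (up - um) n := congrFun h0 n
    rw [sub_add_cancel] at e3
    simp only [Pi.mul_apply, Pi.add_apply, Pi.smul_apply, smul_eq_mul, degFun_apply]
    rw [gammaRatio_succ, gammaRatio_succ, e5]
    have e4 : gammaRatio (up - 1) (up - um) n * ((up - 1 + n) / (up - um + n)) =
      (up - 1) * gammaRatio up (up - um) n / (up - um + n) := by
      rw [← e3]; ring
    rw [e4]
    field_simp
    push_cast
    ring

theorem mulZ_mul_siteOp (hij : i ≠ j) (f g : ℕ → ℂ) :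
    mulZ j * siteOp i j f g = perm i j * diffFun j i f * (mulZ i * diffFun i j g) := by
  have h := perm_mul_mulZ i j i
  rw [Equiv.swap_apply_left] at h
  rw [siteOp, ← mul_assoc, ← mul_assoc, ← h, mul_assoc (perm i j),
    (commute_mulZ_diffFun hij.symm hij f).eq]
  simp only [mul_assoc]

theorem gauge_aux {R : Type*} [Ring R] (z S a b c d : R) :
    !![1, 0; -z, 1] * (Matrix.scalar (Fin 2) S * !![a, b; c, d]) * !![1, 0; z, 1] =
      !![S * (a + b * z), S * b;
        S * (c + d * z) - z * S * (a + b * z), S * d - z * S * b] := by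
  have hsc : Matrix.scalar (Fin 2) S = !![S, 0; 0, S] := by
    ext a b; fin_cases a <;> fin_cases b <;> simp
  rw [hsc, Matrix.mul_fin_two, Matrix.mul_fin_two, Matrix.mul_fin_two]
  congr 1
  congr 1
  · simp [mul_add, mul_assoc]
  · simp [mul_add, add_mul, mul_assoc, sub_eq_add_neg]
    constructor <;> abel

/-- Local form of the Baxter equation. The conjugating matrices contain only the variable `z_j`;
with `z_j` auxiliary they are the same at every site, so the triangular form survives the product
over the chain. -/
theorem gauge_siteOp_mul_lax (hij : i ≠ j) {up um : ℂ} (hb : ∀ n : ℕ, up - um ≠ -(n : ℂ))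
    (f : ℕ → ℂ) :
    ∃ U : Module.End ℂ (MvPolynomial σ ℂ),
      lowerMatInv j * (Matrix.scalar (Fin 2) (siteOp i j f (gammaRatio up (up - um))) *
        lax i up um) * lowerMat j =
      !![up • siteOp i j f (gammaRatio (up + 1) (up - um)), U;
        0, um • siteOp i j f (gammaRatio (up - 1) (up - um))] := by
  refine ⟨siteOp i j f (gammaRatio up (up - um)) * lax i up um 0 1, ?_⟩
  rw [Matrix.eta_fin_two (lax i up um), lowerMatInv, lowerMat, gauge_aux, mulZ_mul_siteOp hij]
  have m1 : up • siteOp i j f (gammaRatio (up + 1) (up - um)) =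
      perm i j * diffFun j i f * (up • diffFun i j (gammaRatio (up + 1) (up - um))) := by
    rw [siteOp, mul_smul_comm]
  have m2 : um • siteOp i j f (gammaRatio (up - 1) (up - um)) =
      perm i j * diffFun j i f * (um • diffFun i j (gammaRatio (up - 1) (up - um))) := by
    rw [siteOp, mul_smul_comm]
  rw [m1, m2, ← diffFun_mul_lax_first hij, ← diffFun_mul_lax_third hij hb]
  rw [siteOp, mul_assoc _ _ (lax i up um 1 0 + _), diffFun_mul_lax_second hij hb]
  simp only [mul_assoc, mul_sub, sub_self]
  rfl

theorem bracket_aux {R : Type*} [Ring R] [Algebra ℂ R] (a b : ℂ) (z di dj : R) :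
    (b • 1 - z * dj) * (dj + di) - (a • 1 - z * dj) * dj =
      b • di + (b - a) • dj - z * dj * di := by
  simp only [sub_mul, mul_add, smul_mul_assoc, one_mul, sub_smul]
  abel

/-- Write `∂_i = (∂_i + ∂_j) - ∂_j`: the sum commutes with functions of `z_{ji} ∂_j`, and `∂_j`
shifts their argument by one. Both resulting functions are the ratio with `b + 1` times a factor
linear in `z_{ji} ∂_j`. -/
theorem del_mul_diffFun_swap (hij : i ≠ j) (a : ℂ) {b : ℂ} (hb : ∀ n : ℕ, b ≠ -(n : ℂ)) :
    del i * diffFun j i (gammaRatio a b) = b⁻¹ • (diffFun j i (gammaRatio a (b + 1)) *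
      (b • del i + (b - a) • del j - (mulZ i - mulZ j) * del j * del i)) := by
  have hb0 : b ≠ 0 := by simpa using hb 0
  have hD : (mulZ i - mulZ j) * del j = -diffFun j i degFun := by
    rw [← mulZ_sub_mul_del' hij.symm]
    exact neg_sub_mul_aux _ _ _
  have h1 : b • diffFun j i (gammaRatio a b) =
      diffFun j i (gammaRatio a (b + 1)) * (b • 1 - (mulZ i - mulZ j) * del j) := by
    rw [hD, sub_neg_eq_add, ← diffFun_add_degFun hij.symm, diffFun_mul hij.symm,
      ← diffFun_smul hij.symm]
    congr 1
    ext n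
    simp only [Pi.mul_apply, Pi.add_apply, Pi.smul_apply, Pi.one_apply, smul_eq_mul, mul_one,
      degFun_apply]
    rw [← gammaRatio_add_one_right a hb, mul_comm]
  have h2 : b • diffFun j i (fun n => gammaRatio a b (n + 1)) =
      diffFun j i (gammaRatio a (b + 1)) * (a • 1 - (mulZ i - mulZ j) * del j) := by
    rw [hD, sub_neg_eq_add, ← diffFun_add_degFun hij.symm, diffFun_mul hij.symm,
      ← diffFun_smul hij.symm]
    congr 1
    ext n
    have hn := add_natCast_ne_zero hb n
    simp only [Pi.mul_apply, Pi.add_apply, Pi.smul_apply, Pi.one_apply, smul_eq_mul, mul_one,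
      degFun_apply]
    rw [gammaRatio_succ, ← mul_assoc, ← gammaRatio_add_one_right a hb]
    field_simp
  have h3 : del i * diffFun j i (gammaRatio a b) =
      diffFun j i (gammaRatio a b) * (del j + del i) -
        diffFun j i (fun n => gammaRatio a b (n + 1)) * del j := by
    rw [← (commute_del_add_diffFun hij.symm _).eq, ← del_mul_diffFun hij.symm, add_mul,
      add_sub_cancel_left]
  rw [eq_inv_smul_iff₀ hb0, h3, smul_sub, ← smul_mul_assoc, ← smul_mul_assoc, h1, h2, mul_assoc,
    mul_assoc, ← mul_sub, bracket_aux]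

theorem bracket_expand_aux {R : Type*} [Ring R] [Algebra ℂ R] (a b : ℂ)
    {di dj m G G1 K K1 : R} (d1 : di * G = G1 * di) (d2 : dj * G = G * (di + dj) - G1 * di)
    (d3 : m * G = K * (di + dj) - K1 * di) :
    (b • di + (b - a) • dj - m) * G =
      ((b - a) • G - K) * (di + dj) + (b • G1 - (b - a) • G1 + K1) * di := by
  rw [sub_mul, add_mul, smul_mul_assoc, smul_mul_assoc, d1, d2, d3]
  simp only [sub_mul, add_mul, smul_mul_assoc, smul_sub]
  abel

theorem bracket_collect_aux {R : Type*} [Ring R] [Algebra ℂ R] (a b : ℂ) (di dj G : R) :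
    ((b - a) • G) * (di + dj) + ((a - b) • G) * di = (b - a) • (G * dj) := by
  rw [← neg_sub b a]
  simp only [neg_smul, smul_mul_assoc, mul_add, neg_mul]
  abel

theorem bracket_cross_aux {R : Type*} [Ring R] {z di dj G G1 K K1 : R}
    (d1 : di * G = G1 * di) (c1 : (di + dj) * G1 = G1 * (di + dj)) (c2 : di * dj = dj * di)
    (e : z * (di * G) = K) (e1 : z * (di * G1) = K1) :
    z * dj * di * G = K * (di + dj) - K1 * di := by
  have h : dj * G1 = G1 * (di + dj) - di * G1 := by rw [← c1, add_mul, add_sub_cancel_left]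
  rw [← e, ← e1, d1, mul_assoc, mul_assoc, d1, ← mul_assoc dj, h]
  simp only [mul_assoc, mul_sub, sub_mul, mul_add, add_mul, c2]

theorem commute_aux {R : Type*} [Ring R] {z z' G r : R} (h : z * G = G * z') (hr : Commute r G) :
    (z + r) * G = G * (z' + r) := by
  rw [add_mul, mul_add, h, hr.eq]

/-- Moving all derivatives to the right leaves one coefficient for `∂_i + ∂_j` and one for `∂_i`.
The choice `a - b` of the upper parameter makes them opposite, so only `∂_j` survives. -/
theorem bracket_mul_diffFun (hij : i ≠ j) {a : ℂ} (b : ℂ) (ha : ∀ n : ℕ, a ≠ -(n : ℂ)) :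
    (b • del i + (b - a) • del j - (mulZ i - mulZ j) * del j * del i) *
      diffFun i j (gammaRatio (a - b) a) =
      (b - a) • (diffFun i j (gammaRatio (a - b + 1) a) * del j) := by
  obtain ⟨g, hg⟩ : ∃ g, g = gammaRatio (a - b) a := ⟨_, rfl⟩
  obtain ⟨g', hg'⟩ : ∃ g', g' = gammaRatio (a - b + 1) a := ⟨_, rfl⟩
  rw [← hg, ← hg']
  have d1 : del i * diffFun i j g = diffFun i j (fun n => g (n + 1)) * del i :=
    del_mul_diffFun hij g
  have d2 : del j * diffFun i j g = diffFun i j g * (del i + del j) -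
      diffFun i j (fun n => g (n + 1)) * del i := by
    rw [← (commute_del_add_diffFun hij g).eq, ← d1, add_mul, add_sub_cancel_left]
  have d3 : (mulZ i - mulZ j) * del j * del i * diffFun i j g =
      diffFun i j (g * degFun) * (del i + del j) -
        diffFun i j ((fun n => g (n + 1)) * degFun) * del i := by
    have e : ∀ h : ℕ → ℂ, (mulZ i - mulZ j) * (del i * diffFun i j h) =
        diffFun i j (h * degFun) := by
      intro h
      rw [← mul_assoc, mulZ_sub_mul_del' hij, diffFun_mul hij, mul_comm]
    exact bracket_cross_aux d1 (commute_del_add_diffFun hij fun n => g (n + 1)).eq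
      (commute_del_del i j).eq (e _) (e _)
  have f1 : ∀ n : ℕ, (b - a) * g n - g n * n = (b - a) * g' n := by
    intro n
    have := gammaRatio_add_one_left (a - b) a n
    rw [hg, hg']
    linear_combination -this
  have f2 : ∀ n : ℕ, b * g (n + 1) - (b - a) * g (n + 1) + g (n + 1) * n = (a - b) * g' n := by
    intro n
    have := gammaRatio_add_one_left (a - b) a n
    have hn := add_natCast_ne_zero ha n
    rw [hg, hg', gammaRatio_succ, ← this]
    field_simp
    ring
  have g1 : (b - a) • diffFun i j g - diffFun i j (g * degFun) = (b - a) • diffFun i j g' := by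
    rw [← diffFun_smul hij, ← diffFun_smul hij, sub_eq_iff_eq_add, ← diffFun_add hij]
    congr 1; ext n
    simp only [Pi.mul_apply, Pi.add_apply, Pi.smul_apply, smul_eq_mul, degFun_apply]
    linear_combination f1 n
  have g2 : b • diffFun i j (fun n => g (n + 1)) - (b - a) • diffFun i j (fun n => g (n + 1)) +
      diffFun i j ((fun n => g (n + 1)) * degFun) = (a - b) • diffFun i j g' := by
    rw [← diffFun_smul hij, ← diffFun_smul hij, ← diffFun_smul hij, ← diffFun_sub hij,
      ← diffFun_add hij]
    congr 1; ext n
    simp only [Pi.mul_apply, Pi.add_apply, Pi.smul_apply, smul_eq_mul, degFun_apply, Pi.sub_apply]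
    linear_combination f2 n
  rw [bracket_expand_aux a b d1 d2 d3, g1, g2]
  exact bracket_collect_aux a b (del i) (del j) (diffFun i j g')

/-- For the R-matrix of a site, the condition that the upper parameter of the second ratio be `a -
b` reads `u₂ = u₁ - 1`. The result is the R-matrix with `u₁` and `u₂` interchanged. -/
theorem del_mul_siteOp (hij : i ≠ j) {a b : ℂ} (ha : ∀ n : ℕ, a ≠ -(n : ℂ))
    (hb : ∀ n : ℕ, b ≠ -(n : ℂ)) :
    del j * siteOp i j (gammaRatio a b) (gammaRatio (a - b) a) =
      ((b - a) / b) •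
        (siteOp i j (gammaRatio a (b + 1)) (gammaRatio (a - b + 1) a) * del j) := by
  have h := perm_mul_del i j i
  rw [Equiv.swap_apply_left] at h
  rw [siteOp, ← mul_assoc, ← mul_assoc, ← h, mul_assoc (perm i j), del_mul_diffFun_swap hij a hb,
    mul_assoc, smul_mul_assoc, mul_assoc (diffFun j i _), bracket_mul_diffFun hij b ha, siteOp]
  simp only [mul_smul_comm, smul_smul, mul_assoc]
  rw [div_eq_inv_mul]

/-- The raising generator of two sites, with independent coefficients of its linear terms. -/
def raise (i j : σ) (p q : ℂ) : Module.End ℂ (MvPolynomial σ ℂ) :=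
  (mulZ i ^ 2 * del i + p • mulZ i) + (mulZ j ^ 2 * del j + q • mulZ j)

theorem raise_aux {R : Type*} [Ring R] [Algebra ℂ R] (zi zj di dj : R) (p q : ℂ)
    (h2 : zi * zj = zj * zi) :
    (zi ^ 2 * di + p • zi) + (zj ^ 2 * dj + q • zj) =
      (zi - zj) * (p • 1 + (zi - zj) * di) + (2 * zj * ((zi - zj) * di) + zj ^ 2 * (di + dj) +
        (p + q) • zj) := by
  have h3 : zi * zj * di = zj * zi * di := by rw [h2]
  simp only [sub_mul, mul_sub, mul_add, mul_smul_comm, mul_one, two_mul, add_mul,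
    add_smul, smul_sub, sq, mul_assoc] at h3 ⊢
  rw [h3]
  abel

/-- The raising operator is `z_{ij} (p + z_{ij} ∂_i)` plus terms that commute with functions of
`z_{ij} ∂_i` and see only the sum `p + q`. The Gamma ratio is what intertwines `p + n` with `p' +
n`. -/
theorem raise_mul_diffFun (hij : i ≠ j) {p q p' q' : ℂ} (h : p + q = p' + q')
    (hp : ∀ n : ℕ, p ≠ -(n : ℂ)) :
    raise i j p' q' * diffFun i j (gammaRatio p' p) =
      diffFun i j (gammaRatio p' p) * raise i j p q := by
  obtain ⟨g, hg⟩ : ∃ g, g = gammaRatio p' p := ⟨_, rfl⟩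
  have e : ∀ p q : ℂ, raise i j p q = (mulZ i - mulZ j) * diffFun i j (p • 1 + degFun) +
      (2 * mulZ j * diffFun i j degFun + mulZ j ^ 2 * (del i + del j) + (p + q) • mulZ j) := by
    intro p q
    rw [diffFun_add_degFun hij, ← mulZ_sub_mul_del' hij]
    exact raise_aux _ _ _ _ p q (commute_mulZ_mulZ i j).eq
  have c1 : Commute (mulZ j) (diffFun i j g) := commute_mulZ_diffFun hij hij.symm g
  have c2 : Commute (diffFun i j degFun) (diffFun i j g) := by
    rw [Commute, SemiconjBy, diffFun_mul hij, diffFun_mul hij, mul_comm]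
  have c3 : Commute (del i + del j) (diffFun i j g) := commute_del_add_diffFun hij g
  have c : Commute (2 * mulZ j * diffFun i j degFun + mulZ j ^ 2 * (del i + del j) +
      (p' + q') • mulZ j) (diffFun i j g) :=
    (((((Commute.ofNat_left 2 _).mul_left c1).mul_left c2).add_left
      ((c1.pow_left 2).mul_left c3)).add_left (c1.smul_left _))
  rw [← hg, e, e, h]
  refine commute_aux ?_ c
  rw [mul_assoc, diffFun_mul hij, ← mul_assoc, ← mulZ_sub_mul_diffFun hij, mul_assoc,
    diffFun_mul hij]
  congr 2
  ext n
  simp only [Pi.mul_apply, Pi.add_apply, Pi.smul_apply, Pi.one_apply, smul_eq_mul, mul_one,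
      degFun_apply]
  have hn := add_natCast_ne_zero hp n
  rw [hg, gammaRatio_succ]
  field_simp

theorem raise_comm (i j : σ) (p q : ℂ) : raise i j p q = raise j i q p := add_comm _ _

theorem perm_mul_raise (i j : σ) (p q : ℂ) :
    perm i j * raise i j p q = raise j i p q * perm i j := by
  have h1 := perm_mul_mulZ i j i
  have h2 := perm_mul_mulZ i j j
  have h3 := perm_mul_del i j i
  have h4 := perm_mul_del i j j
  rw [Equiv.swap_apply_left] at h1 h3
  rw [Equiv.swap_apply_right] at h2 h4
  have key : ∀ {z d z' d' : Module.End ℂ (MvPolynomial σ ℂ)} (r : ℂ),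
      SemiconjBy (perm i j) z z' → SemiconjBy (perm i j) d d' →
      SemiconjBy (perm i j) (z ^ 2 * d + r • z) (z' ^ 2 * d' + r • z') := by
    intro z d z' d' r hz hd
    refine ((hz.pow_right 2).mul_right hd).add_right ?_
    rw [SemiconjBy, mul_smul_comm, smul_mul_assoc, hz.eq]
  exact (key p h1 h3).add_right (key q h2 h4)

/-- The three factors move the pair of coefficients along a cycle, from `(a, q)` to `(c, b)`, then
to `(q, a)`, and by the permutation back to `(a, q)`; the sum is kept throughout. -/
theorem commute_raise_siteOp (hij : i ≠ j) {a b c q : ℂ} (ha : ∀ n : ℕ, a ≠ -(n : ℂ))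
    (hb : ∀ n : ℕ, b ≠ -(n : ℂ)) (h : a + q = b + c) :
    Commute (raise i j a q) (siteOp i j (gammaRatio a b) (gammaRatio c a)) := by
  have h1 : raise i j a q * perm i j = perm i j * raise i j q a := by
    rw [perm_mul_raise, raise_comm]
  have h2 : raise i j q a * diffFun j i (gammaRatio a b) =
      diffFun j i (gammaRatio a b) * raise i j c b := by
    rw [raise_comm i j q a, raise_comm i j c b]
    exact raise_mul_diffFun hij.symm (by linear_combination -h) hb
  have h3 : raise i j c b * diffFun i j (gammaRatio c a) =
      diffFun i j (gammaRatio c a) * raise i j a q :=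
    raise_mul_diffFun hij (by linear_combination h) ha
  rw [Commute, SemiconjBy, siteOp, ← mul_assoc, ← mul_assoc, h1, mul_assoc (perm i j), h2,
    mul_assoc, mul_assoc, h3]
  simp only [mul_assoc]

theorem commute_del_add_siteOp (hij : i ≠ j) (f g : ℕ → ℂ) :
    Commute (del i + del j) (siteOp i j f g) := by
  have h3 := perm_mul_del i j i
  have h4 := perm_mul_del i j j
  rw [Equiv.swap_apply_left] at h3
  rw [Equiv.swap_apply_right] at h4
  have h1 : Commute (del i + del j) (perm i j) := by
    rw [Commute, SemiconjBy, mul_add, h3, h4, add_mul, add_comm]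
  refine (h1.mul_right ?_).mul_right (commute_del_add_diffFun hij g)
  rw [add_comm]
  exact commute_del_add_diffFun hij.symm f

theorem commute_mulZ_siteOp (hij : i ≠ j) {k : σ} (hi : k ≠ i) (hj : k ≠ j) (f g : ℕ → ℂ) :
    Commute (mulZ k) (siteOp i j f g) := by
  have h1 := perm_mul_mulZ i j k
  rw [Equiv.swap_apply_of_ne_of_ne hi hj] at h1
  exact (Commute.mul_right (Eq.symm h1) (commute_mulZ_diffFun hij.symm hj f)).mul_right
    (commute_mulZ_diffFun hij hi g)

theorem commute_del_siteOp (hij : i ≠ j) {k : σ} (hi : k ≠ i) (hj : k ≠ j) (f g : ℕ → ℂ) :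
    Commute (del k) (siteOp i j f g) := by
  have h1 := perm_mul_del i j k
  rw [Equiv.swap_apply_of_ne_of_ne hi hj] at h1
  exact (Commute.mul_right (Eq.symm h1) (commute_del_diffFun hij.symm hj hi f)).mul_right
    (commute_del_diffFun hij hi hj g)

theorem siteOp_isHomogeneous (i j : σ) (f g : ℕ → ℂ) {n : ℕ} {p : MvPolynomial σ ℂ}
    (hp : p.IsHomogeneous n) : (siteOp i j f g p).IsHomogeneous n := by
  have := (diffFun_isHomogeneous j i f (diffFun_isHomogeneous i j g hp)).rename_isHomogeneous
    (f := Equiv.swap i j)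
  exact this

/-- The substitution `z_i ↦ z_j`. -/
def specialize (i j : σ) : MvPolynomial σ ℂ →ₐ[ℂ] MvPolynomial σ ℂ :=
  aeval fun k => if k = i then X j else X k

/-- On the diagonal `z_i = z_j` only the term `n = 0` is left, and there the eigenvalue is `f 0 =
1`. -/
theorem specialize_diffFun (hij : i ≠ j) {f : ℕ → ℂ} (hf : f 0 = 1) (π : MvPolynomial σ ℂ →ₐ[ℂ]
    MvPolynomial σ ℂ) (hπ : π (X i) = π (X j)) (p : MvPolynomial σ ℂ) :
    π (diffFun i j f p) = π p := by
  have : π.toLinearMap ∘ₗ diffFun i j f = π.toLinearMap :=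
    linearMap_ext_diff hij fun n g hg => by
      simp only [LinearMap.comp_apply, AlgHom.toLinearMap_apply, diffFun_apply hij _ n hg, map_smul]
      cases n with
      | zero => simp [hf]
      | succ n => simp [hπ]
  exact DFunLike.congr_fun this p

theorem specialize_eq_self {p : MvPolynomial σ ℂ} (hp : pderiv i p = 0) :
    specialize i j p = p := by
  refine linearMap_eq_of_pderiv_eq_zero (specialize i j).toLinearMap LinearMap.id ?_ hp
  intro t ht
  simp only [AlgHom.toLinearMap_apply, LinearMap.id_apply, specialize, aeval_monomial, map_one,
    one_mul]
  rw [monomial_eq, C_1, one_mul]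
  refine Finset.prod_congr rfl fun k hk => ?_
  have : k ≠ i := by rintro rfl; exact (Finsupp.mem_support_iff.1 hk) ht
  simp [this]

/-- By `del_mul_siteOp` the image does not contain `z_j` either. It can therefore be read off after
setting `z_j = z_i`, where every factor acts trivially. -/
theorem siteOp_eq_self (hij : i ≠ j) {a b : ℂ} (ha : ∀ n : ℕ, a ≠ -(n : ℂ))
    (hb : ∀ n : ℕ, b ≠ -(n : ℂ)) {p : MvPolynomial σ ℂ} (hp : pderiv j p = 0) :
    siteOp i j (gammaRatio a b) (gammaRatio (a - b) a) p = p := by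
  have h := DFunLike.congr_fun (del_mul_siteOp hij ha hb) p
  have hp' : del j p = 0 := hp
  simp only [Module.End.mul_apply, LinearMap.smul_apply, hp', map_zero, smul_zero] at h
  rw [← specialize_eq_self (j := i) h, siteOp, Module.End.mul_apply, Module.End.mul_apply]
  have e : ∀ q, specialize j i (perm i j q) = specialize j i q := by
    intro q
    have : (specialize j i).comp (rename (Equiv.swap i j)) = specialize j i := by
      ext k : 1
      simp only [AlgHom.comp_apply, rename_X, specialize, aeval_X]
      by_cases hi : k = i
      · subst hi; simp [hij]
      · by_cases hj : k = j
        · subst hj; simp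
        · rw [Equiv.swap_apply_of_ne_of_ne hi hj]
    exact DFunLike.congr_fun this q
  have hπ : specialize j i (X i) = specialize j i (X j) := by simp [specialize]
  rw [e, specialize_diffFun hij.symm (gammaRatio_zero _ _) _ hπ.symm,
    specialize_diffFun hij (gammaRatio_zero _ _) _ hπ, specialize_eq_self hp]

end Site

/-! ### Blocks of operators with respect to powers of the auxiliary variable -/

section Blocks

variable {N : ℕ}

theorem monomial_cons (m : ℕ) (s : Fin N →₀ ℕ) :
    monomial (Finsupp.cons m s) (1 : ℂ) = X 0 ^ m * rename Fin.succ (monomial s 1) := by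
  have h : Finsupp.cons m s = Finsupp.single 0 m + Finsupp.mapDomain Fin.succ s := by
    ext k
    refine Fin.cases ?_ (fun k => ?_) k
    · have : (0 : Fin (N + 1)) ∉ Set.range (Fin.succ : Fin N → Fin (N + 1)) := by
        rintro ⟨k, hk⟩; exact Fin.succ_ne_zero k hk
      simp [Finsupp.mapDomain_of_notMem_range _ _ this]
    · rw [Finsupp.cons_succ, Finsupp.add_apply, Finsupp.mapDomain_apply (Fin.succ_injective N)]
      simp
  rw [rename_monomial, X_pow_eq_monomial, monomial_mul, one_mul, h]

theorem extended_ext {M : Type*} [AddCommGroup M] [Module ℂ M] {A B : Extended N →ₗ[ℂ] M}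
    (h : ∀ (m : ℕ) (Ψ : Quantum N), A (X 0 ^ m * rename Fin.succ Ψ) =
      B (X 0 ^ m * rename Fin.succ Ψ)) : A = B := by
  refine (basisMonomials (Fin (N + 1)) ℂ).ext fun t => ?_
  rw [coe_basisMonomials]
  beta_reduce
  rw [← Finsupp.cons_tail t, monomial_cons]
  exact h _ _

/-- The coefficient of `z_0^m`, as a polynomial in the variables of the quantum space. -/
def slice (m : ℕ) : Extended N →ₗ[ℂ] Quantum N :=
  ((Polynomial.lcoeff (Quantum N) m).restrictScalars ℂ) ∘ₗ (finSuccEquiv ℂ N).toLinearMap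

theorem slice_apply (m : ℕ) (p : Extended N) : slice m p = (finSuccEquiv ℂ N p).coeff m := rfl

theorem coeff_slice (m : ℕ) (p : Extended N) (s : Fin N →₀ ℕ) :
    coeff s (slice m p) = coeff (Finsupp.cons m s) p := finSuccEquiv_coeff_coeff _ _ _

theorem finSuccEquiv_rename_succ (Ψ : Quantum N) :
    finSuccEquiv ℂ N (rename Fin.succ Ψ) = Polynomial.C Ψ := by
  have : ((finSuccEquiv ℂ N).toAlgHom.comp (rename Fin.succ)) =
      (Polynomial.CAlgHom : Quantum N →ₐ[Quantum N] Polynomial (Quantum N)).restrictScalars ℂ := by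
    ext k : 1
    simp [finSuccEquiv_X_succ]
  exact DFunLike.congr_fun this Ψ

theorem slice_X_pow_mul (m' m : ℕ) (Ψ : Quantum N) :
    slice m' (X 0 ^ m * rename Fin.succ Ψ) = if m' = m then Ψ else 0 := by
  rw [slice_apply, map_mul, map_pow, finSuccEquiv_X_zero, finSuccEquiv_rename_succ,
    Polynomial.coeff_mul_C, Polynomial.coeff_X_pow]
  split_ifs <;> simp

theorem slice_succ_mulZ (m : ℕ) (p : Extended N) : slice (m + 1) (mulZ 0 p) = slice m p := by
  simp [slice_apply, mulZ, finSuccEquiv_X_zero]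

theorem slice_zero_mulZ (p : Extended N) : slice 0 (mulZ 0 p) = 0 := by
  simp [slice_apply, mulZ, finSuccEquiv_X_zero]

theorem slice_del (m : ℕ) (p : Extended N) :
    slice m (del 0 p) = ((m : ℂ) + 1) • slice (m + 1) p := by
  ext s
  rw [coeff_slice, coeff_smul, coeff_slice, del, Derivation.coeFn_coe, coeff_pderiv,
    Finsupp.cons_zero, smul_eq_mul, mul_comm]
  congr 2
  ext k
  refine Fin.cases ?_ (fun k => ?_) k <;> simp

/-- The block of `A` that maps the coefficient of `z_0^m` to that of `z_0^{m'}`. -/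
def block (A : Module.End ℂ (Extended N)) (m' m : ℕ) : Module.End ℂ (Quantum N) :=
  slice m' ∘ₗ A ∘ₗ LinearMap.mulLeft ℂ (X 0 ^ m) ∘ₗ (rename Fin.succ).toLinearMap

theorem block_apply (A : Module.End ℂ (Extended N)) (m' m : ℕ) (Ψ : Quantum N) :
    block A m' m Ψ = slice m' (A (X 0 ^ m * rename Fin.succ Ψ)) := rfl

theorem coeff_block (A : Module.End ℂ (Extended N)) (m' m : ℕ) (Ψ : Quantum N)
    (s : Fin N →₀ ℕ) : coeff s (block A m' m Ψ) =
      coeff (Finsupp.cons m' s) (A (X 0 ^ m * rename Fin.succ Ψ)) := coeff_slice _ _ _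

theorem isAuxTrace_iff (A : Module.End ℂ (Extended N)) (T : Module.End ℂ (Quantum N)) :
    IsAuxTrace A T ↔
      ∀ Ψ s, HasSum (fun m => coeff s (block A m m Ψ)) (coeff s (T Ψ)) := by
  simp only [IsAuxTrace, coeff_block]

theorem block_add (A B : Module.End ℂ (Extended N)) (m' m : ℕ) :
    block (A + B) m' m = block A m' m + block B m' m := by
  refine LinearMap.ext fun Ψ => ?_
  simp only [block_apply, LinearMap.add_apply, map_add]

theorem block_sub (A B : Module.End ℂ (Extended N)) (m' m : ℕ) :
    block (A - B) m' m = block A m' m - block B m' m := by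
  refine LinearMap.ext fun Ψ => ?_
  simp only [block_apply, LinearMap.sub_apply, map_sub]

theorem block_smul (c : ℂ) (A : Module.End ℂ (Extended N)) (m' m : ℕ) :
    block (c • A) m' m = c • block A m' m := by
  refine LinearMap.ext fun Ψ => ?_
  simp only [block_apply, LinearMap.smul_apply, map_smul]

theorem block_mul_mulZ (A : Module.End ℂ (Extended N)) (m' m : ℕ) :
    block (A * mulZ 0) m' m = block A m' (m + 1) := by
  refine LinearMap.ext fun Ψ => ?_
  simp only [block_apply, Module.End.mul_apply, mulZ, LinearMap.mulLeft_apply]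
  rw [← mul_assoc, pow_succ']

theorem block_mulZ_mul_succ (A : Module.End ℂ (Extended N)) (m' m : ℕ) :
    block (mulZ 0 * A) (m' + 1) m = block A m' m := by
  refine LinearMap.ext fun Ψ => ?_
  simp only [block_apply, Module.End.mul_apply, slice_succ_mulZ]

theorem block_mulZ_mul_zero (A : Module.End ℂ (Extended N)) (m : ℕ) :
    block (mulZ 0 * A) 0 m = 0 := by
  refine LinearMap.ext fun Ψ => ?_
  simp only [block_apply, Module.End.mul_apply, slice_zero_mulZ, LinearMap.zero_apply]

theorem block_del_mul (A : Module.End ℂ (Extended N)) (m' m : ℕ) :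
    block (del 0 * A) m' m = ((m' : ℂ) + 1) • block A (m' + 1) m := by
  refine LinearMap.ext fun Ψ => ?_
  simp only [block_apply, Module.End.mul_apply, slice_del, LinearMap.smul_apply]

theorem pderiv_zero_rename (Ψ : Quantum N) : pderiv 0 (rename Fin.succ Ψ) = 0 := by
  classical
  refine pderiv_eq_zero_of_notMem_vars fun h => ?_
  have := vars_rename Fin.succ Ψ h
  simp only [Finset.mem_image] at this
  obtain ⟨k, -, hk⟩ := this
  exact Fin.succ_ne_zero k hk

theorem del_zero_apply (m : ℕ) (Ψ : Quantum N) :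
    del 0 (X 0 ^ m * rename Fin.succ Ψ) = (m : ℂ) • (X 0 ^ (m - 1) * rename Fin.succ Ψ) := by
  rw [del, Derivation.coeFn_coe, pderiv_mul, pderiv_zero_rename, pderiv_pow, pderiv_X_self,
    smul_eq_C_mul, map_natCast]
  ring

theorem block_mul_del (A : Module.End ℂ (Extended N)) (m' m : ℕ) :
    block (A * del 0) m' m = (m : ℂ) • block A m' (m - 1) := by
  refine LinearMap.ext fun Ψ => ?_
  simp only [block_apply, Module.End.mul_apply, del_zero_apply, LinearMap.smul_apply, map_smul]

/-- `B` acts on the extended space as `b` does on the quantum space. -/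
def Lifts (B : Module.End ℂ (Extended N)) (b : Module.End ℂ (Quantum N)) : Prop :=
  ∀ m Ψ, B (X 0 ^ m * rename Fin.succ Ψ) = X 0 ^ m * rename Fin.succ (b Ψ)

namespace Lifts

variable {B B' : Module.End ℂ (Extended N)} {b b' : Module.End ℂ (Quantum N)}

theorem add (h : Lifts B b) (h' : Lifts B' b') : Lifts (B + B') (b + b') := fun m Ψ => by
  simp only [LinearMap.add_apply, h m Ψ, h' m Ψ, map_add, mul_add]

theorem neg (h : Lifts B b) : Lifts (-B) (-b) := fun m Ψ => by
  simp only [LinearMap.neg_apply, h m Ψ, map_neg, mul_neg]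

theorem sub (h : Lifts B b) (h' : Lifts B' b') : Lifts (B - B') (b - b') := by
  rw [sub_eq_add_neg, sub_eq_add_neg]; exact h.add h'.neg

theorem smul (h : Lifts B b) (c : ℂ) : Lifts (c • B) (c • b) := fun m Ψ => by
  simp only [LinearMap.smul_apply, h m Ψ, map_smul, mul_smul_comm]

theorem mul (h : Lifts B b) (h' : Lifts B' b') : Lifts (B * B') (b * b') := fun m Ψ => by
  simp only [Module.End.mul_apply, h m _, h' m Ψ]

theorem zero : Lifts (0 : Module.End ℂ (Extended N)) 0 := fun m Ψ => by simp

theorem one : Lifts (1 : Module.End ℂ (Extended N)) 1 := fun m Ψ => by simp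

theorem sum {ι : Type*} (t : Finset ι) {F : ι → Module.End ℂ (Extended N)}
    {f : ι → Module.End ℂ (Quantum N)} (h : ∀ i, Lifts (F i) (f i)) :
    Lifts (∑ i ∈ t, F i) (∑ i ∈ t, f i) := by
  classical
  induction t using Finset.induction_on with
  | empty => simpa using zero
  | insert i t hi ih => rw [Finset.sum_insert hi, Finset.sum_insert hi]; exact (h i).add ih

theorem mulZ (k : Fin N) : Lifts (mulZ k.succ) (XXX.mulZ k) := fun m Ψ => by
  simp only [XXX.mulZ, LinearMap.mulLeft_apply, map_mul, rename_X]
  ring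

theorem del (k : Fin N) : Lifts (del k.succ) (XXX.del k) := fun m Ψ => by
  simp only [XXX.del, Derivation.coeFn_coe]
  rw [pderiv_mul, pderiv_rename (Fin.succ_injective N), pderiv_pow,
    pderiv_X_of_ne (Fin.succ_ne_zero k).symm]
  simp

theorem block_mul (h : Lifts B b) (A : Module.End ℂ (Extended N)) (m' m : ℕ) :
    block (A * B) m' m = block A m' m * b := by
  refine LinearMap.ext fun Ψ => ?_
  simp only [block_apply, Module.End.mul_apply, h m Ψ]

theorem slice (h : Lifts B b) (m : ℕ) (p : Extended N) :
    slice m (B p) = b (XXX.slice m p) := by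
  have : XXX.slice m ∘ₗ B = b ∘ₗ XXX.slice m := extended_ext fun m' Ψ => by
    simp only [LinearMap.comp_apply, h m' Ψ, slice_X_pow_mul]
    split_ifs <;> simp
  exact DFunLike.congr_fun this p

theorem mul_block (h : Lifts B b) (A : Module.End ℂ (Extended N)) (m' m : ℕ) :
    block (B * A) m' m = b * block A m' m := by
  refine LinearMap.ext fun Ψ => ?_
  simp only [block_apply, Module.End.mul_apply, h.slice]

end Lifts

theorem lax_lifts (k : Fin N) (up um : ℂ) (a b : Fin 2) :
    Lifts (lax k.succ up um a b) (lax k up um a b) := by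
  have h0 : Lifts (mulZ k.succ * del k.succ) (mulZ k * del k) :=
    (Lifts.mulZ k).mul (Lifts.del k)
  have h2 : Lifts (mulZ k.succ ^ 2 * del k.succ + (up - um) • mulZ k.succ)
      (mulZ k ^ 2 * del k + (up - um) • mulZ k) := by
    rw [sq, sq]
    exact (((Lifts.mulZ k).mul (Lifts.mulZ k)).mul (Lifts.del k)).add ((Lifts.mulZ k).smul _)
  fin_cases a <;> fin_cases b
  · exact (Lifts.one.smul up).add h0
  · exact (Lifts.del k).neg
  · exact h2
  · exact (Lifts.one.smul um).sub h0

theorem matrix_list_lifts {ι : Type*} (l : List ι)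
    {F : ι → Matrix (Fin 2) (Fin 2) (Module.End ℂ (Extended N))}
    {f : ι → Matrix (Fin 2) (Fin 2) (Module.End ℂ (Quantum N))}
    (h : ∀ i a b, Lifts (F i a b) (f i a b)) (a b : Fin 2) :
    Lifts ((l.map F).prod a b) ((l.map f).prod a b) := by
  induction l generalizing a b with
  | nil =>
    simp only [List.map_nil, List.prod_nil, Matrix.one_apply]
    split_ifs
    exacts [Lifts.one, Lifts.zero]
  | cons i l ih =>
    simp only [List.map_cons, List.prod_cons, Matrix.mul_apply]
    exact Lifts.sum _ fun c => (h i a c).mul (ih c b)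

end Blocks

/-! ### The monodromy: Baxter equation and normalisation in blocks -/

section Chain

variable {N : ℕ}

/-- The general R-matrix of a site, in the parameters `u₁` and `u₂`. -/
def site (ℓ δ : Fin N → ℂ) (u₁ u₂ : ℂ) (k : Fin N) : Module.End ℂ (Extended N) :=
  siteOp k.succ 0 (gammaRatio (2 * ℓ k) (ℓ k + 1 - u₁ - δ k))
    (gammaRatio (u₂ + δ k + ℓ k) (2 * ℓ k))

theorem monodromy₂_eq (ℓ δ : Fin N → ℂ) (u₁ u₂ : ℂ) :
    monodromy₂ ℓ δ u₁ u₂ = ((List.finRange N).map (site ℓ δ u₁ u₂)).prod := by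
  rw [monodromy₂, monodromy, List.ofFn_eq_map]
  refine congrArg (fun f => (List.map f (List.finRange N)).prod) (funext fun k => ?_)
  have e1 : (u₁ + u₂ - 1) / 2 + δ k + ℓ k - ((u₁ + u₂ - 1) / 2 + δ k - ℓ k) = 2 * ℓ k := by ring
  have e2 : (u₂ - u₁ + 1) / 2 - ((u₁ + u₂ - 1) / 2 + δ k - ℓ k) = ℓ k + 1 - u₁ - δ k := by ring
  have e3 : (u₁ + u₂ - 1) / 2 + δ k + ℓ k - -((u₂ - u₁ + 1) / 2) = u₂ + δ k + ℓ k := by ring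
  rw [site, siteOp, Rmatrix, Rplus, Rminus, e1, e2, e3]

theorem list_prod_mul_list_prod {M ι : Type*} [Monoid M] {f g : ι → M} (l : List ι) (hl : l.Nodup)
    (h : ∀ i j, i ≠ j → Commute (f i) (g j)) :
    (l.map f).prod * (l.map g).prod = (l.map fun i => f i * g i).prod := by
  induction l with
  | nil => simp
  | cons i l ih =>
    rw [List.nodup_cons] at hl
    simp only [List.map_cons, List.prod_cons]
    rw [← ih hl.2]
    have : Commute (l.map f).prod (g i) := by
      refine Commute.list_prod_left _ _ fun x hx => ?_
      obtain ⟨j, hj, rfl⟩ := List.mem_map.1 hx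
      exact h j i (by rintro rfl; exact hl.1 hj)
    rw [mul_assoc, ← mul_assoc _ (g i), this.eq]
    simp only [mul_assoc]

theorem commute_site {ℓ δ : Fin N → ℂ} {u₁ u₂ : ℂ} {j k : Fin N} (h : j ≠ k) (up um : ℂ)
    (a b : Fin 2) : Commute (site ℓ δ u₁ u₂ j) (lax k.succ up um a b) := by
  have hj : k.succ ≠ j.succ := fun e => h (Fin.succ_injective N e).symm
  have h1 : Commute (site ℓ δ u₁ u₂ j) (mulZ k.succ) :=
    (commute_mulZ_siteOp (Fin.succ_ne_zero j) hj (Fin.succ_ne_zero k) _ _).symm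
  have h2 : Commute (site ℓ δ u₁ u₂ j) (del k.succ) :=
    (commute_del_siteOp (Fin.succ_ne_zero j) hj (Fin.succ_ne_zero k) _ _).symm
  have h3 := h1.mul_right h2
  have h4 : Commute (site ℓ δ u₁ u₂ j) (mulZ k.succ ^ 2 * del k.succ + (up - um) • mulZ k.succ) :=
    ((h1.pow_right 2).mul_right h2).add_right (h1.smul_right _)
  generalize site ℓ δ u₁ u₂ j = S at h1 h2 h3 h4 ⊢
  fin_cases a <;> fin_cases b
  · change Commute S (up • 1 + mulZ k.succ * del k.succ)
    exact ((Commute.one_right _).smul_right up).add_right h3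
  · change Commute S (-del k.succ)
    exact h2.neg_right
  · exact h4
  · change Commute S (um • 1 - mulZ k.succ * del k.succ)
    exact ((Commute.one_right _).smul_right um).sub_right h3

/-- The monodromy matrix over `ℂ²`, on the extended space. -/
def laxExtended (ℓ δ : Fin N → ℂ) (x : ℂ) :
    Matrix (Fin 2) (Fin 2) (Module.End ℂ (Extended N)) :=
  ((List.finRange N).map fun k => lax k.succ (x + δ k + ℓ k) (x + δ k - ℓ k)).prod

/-- The monodromy matrix over `ℂ²`, on the quantum space. -/
def laxQuantum (ℓ δ : Fin N → ℂ) (x : ℂ) :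
    Matrix (Fin 2) (Fin 2) (Module.End ℂ (Quantum N)) :=
  ((List.finRange N).map fun k => lax k (x + δ k + ℓ k) (x + δ k - ℓ k)).prod

theorem transfer_eq (ℓ δ : Fin N → ℂ) (x : ℂ) :
    transfer ℓ δ x = laxQuantum ℓ δ x 1 1 + laxQuantum ℓ δ x 0 0 := by
  rw [transfer, Matrix.trace_fin_two, List.ofFn_eq_map, add_comm]
  rfl

theorem laxExtended_lifts (ℓ δ : Fin N → ℂ) (x : ℂ) (a b : Fin 2) :
    Lifts (laxExtended ℓ δ x a b) (laxQuantum ℓ δ x a b) :=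
  matrix_list_lifts _ (fun k a b => lax_lifts k _ _ a b) a b

theorem upper_list_prod {ι : Type*} (l : List ι)
    {F : ι → Matrix (Fin 2) (Fin 2) (Module.End ℂ (Extended N))} {a d : ι → ℂ}
    {A D : ι → Module.End ℂ (Extended N)}
    (h : ∀ i, ∃ U, F i = !![a i • A i, U; 0, d i • D i]) :
    ∃ U, (l.map F).prod = !![(l.map a).prod • (l.map A).prod, U; 0,
      (l.map d).prod • (l.map D).prod] := by
  induction l with
  | nil => exact ⟨0, by simp [Matrix.one_fin_two]⟩
  | cons i l ih =>
    obtain ⟨U, hU⟩ := h i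
    obtain ⟨V, hV⟩ := ih
    simp only [List.map_cons, List.prod_cons, hU, hV, Matrix.mul_fin_two]
    exact ⟨_, by simp only [mul_zero, zero_mul, add_zero, zero_add, smul_mul_smul_comm]; rfl⟩

theorem conj_list_prod {M ι : Type*} [Monoid M] {P P' : M} (h : P' * P = 1) (h' : P * P' = 1)
    (l : List ι) (F : ι → M) :
    P' * (l.map F).prod * P = (l.map fun i => P' * F i * P).prod := by
  induction l with
  | nil => simp [h]
  | cons i l ih =>
    simp only [List.map_cons, List.prod_cons]
    rw [← ih]
    simp only [mul_assoc]
    rw [← mul_assoc P P', h', one_mul]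

theorem map_finRange_prod (f : Fin N → ℂ) : ((List.finRange N).map f).prod = ∏ k, f k := by
  rw [← List.ofFn_eq_map, List.prod_ofFn]

/-- Operators of different sites commute although they share the auxiliary variable only through the
R-matrices, so the two ordered products merge site by site and the inner gauge matrices cancel. -/
theorem gauge_monodromy {ℓ : Fin N → ℂ} (hℓ : GenericSpins ℓ) (δ : Fin N → ℂ) (u₁ x : ℂ) :
    ∃ U, Matrix.scalar (Fin 2) (monodromy₂ ℓ δ u₁ x) * laxExtended ℓ δ x =
      lowerMat 0 * !![DeltaPlus ℓ δ x • monodromy₂ ℓ δ u₁ (x + 1), U; 0,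
        DeltaMinus ℓ δ x • monodromy₂ ℓ δ u₁ (x - 1)] * lowerMatInv 0 := by
  have h1 : Matrix.scalar (Fin 2) (monodromy₂ ℓ δ u₁ x) * laxExtended ℓ δ x =
      ((List.finRange N).map fun k => Matrix.scalar (Fin 2) (site ℓ δ u₁ x k) *
        lax k.succ (x + δ k + ℓ k) (x + δ k - ℓ k)).prod := by
    rw [monodromy₂_eq, laxExtended, map_list_prod, List.map_map]
    refine list_prod_mul_list_prod _ (List.nodup_finRange N) fun j k hjk => ?_
    rw [Commute, SemiconjBy]
    ext1 a b
    simp only [Function.comp_apply, Matrix.scalar_apply, Matrix.diagonal_mul, Matrix.mul_diagonal]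
    exact (commute_site hjk _ _ a b).eq
  have h2 : ∀ k, ∃ U, lowerMatInv 0 * (Matrix.scalar (Fin 2) (site ℓ δ u₁ x k) *
        lax k.succ (x + δ k + ℓ k) (x + δ k - ℓ k)) * lowerMat 0 =
      !![(x + δ k + ℓ k) • site ℓ δ u₁ (x + 1) k, U; 0,
        (x + δ k - ℓ k) • site ℓ δ u₁ (x - 1) k] := by
    intro k
    have e : x + δ k + ℓ k - (x + δ k - ℓ k) = 2 * ℓ k := by ring
    have := gauge_siteOp_mul_lax (Fin.succ_ne_zero k) (up := x + δ k + ℓ k)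
      (um := x + δ k - ℓ k) (by rw [e]; exact hℓ k) (gammaRatio (2 * ℓ k) (ℓ k + 1 - u₁ - δ k))
    rw [e] at this
    have e1 : x + δ k + ℓ k + 1 = (x + 1) + δ k + ℓ k := by ring
    have e2 : x + δ k + ℓ k - 1 = (x - 1) + δ k + ℓ k := by ring
    rw [e1, e2] at this
    exact this
  obtain ⟨U, hU⟩ := upper_list_prod (List.finRange N) (a := fun k => x + δ k + ℓ k)
    (d := fun k => x + δ k - ℓ k) (A := site ℓ δ u₁ (x + 1)) (D := site ℓ δ u₁ (x - 1)) h2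
  refine ⟨U, ?_⟩
  rw [h1]
  have h3 := conj_list_prod (lowerMatInv_mul (0 : Fin (N + 1))) (lowerMat_mul_inv 0)
    (List.finRange N) fun k => Matrix.scalar (Fin 2) (site ℓ δ u₁ x k) *
        lax k.succ (x + δ k + ℓ k) (x + δ k - ℓ k)
  rw [hU, map_finRange_prod, map_finRange_prod, ← monodromy₂_eq, ← monodromy₂_eq] at h3
  rw [DeltaPlus, DeltaMinus, ← h3]
  simp only [← mul_assoc, lowerMat_mul_inv, one_mul]
  rw [mul_assoc, lowerMat_mul_inv, mul_one]

theorem conj_upper_aux {R : Type*} [Ring R] (z a b d : R) :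
    !![1, 0; z, 1] * !![a, b; 0, d] * !![1, 0; -z, 1] =
      !![a - b * z, b; z * (a - b * z) - d * z, z * b + d] := by
  rw [Matrix.mul_fin_two, Matrix.mul_fin_two]
  congr 1
  congr 1
  · simp [sub_eq_add_neg]
  · simp only [mul_neg, add_mul, one_mul, mul_one, mul_zero, zero_add, add_zero,
      mul_assoc, sub_eq_add_neg, mul_add, neg_add, add_assoc]

/-- The unknown corner `U` enters the entry `(1, 1)` as `z_0 U` and the entry `(0, 0)` as `-U z_0`.
The block `(m+1, m+1)` of the one and the block `(m, m)` of the other contain the same block of `U`,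
which cancels. This offset is the reason for the twist in `tSeries`. -/
theorem block_baxter {ℓ : Fin N → ℂ} (hℓ : GenericSpins ℓ) (δ : Fin N → ℂ) (u₁ x : ℂ) :
    block (monodromy₂ ℓ δ u₁ x) 0 0 * laxQuantum ℓ δ x 1 1 =
      DeltaMinus ℓ δ x • block (monodromy₂ ℓ δ u₁ (x - 1)) 0 0 ∧
    ∀ m, block (monodromy₂ ℓ δ u₁ x) (m + 1) (m + 1) * laxQuantum ℓ δ x 1 1 +
        block (monodromy₂ ℓ δ u₁ x) m m * laxQuantum ℓ δ x 0 0 =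
      DeltaMinus ℓ δ x • block (monodromy₂ ℓ δ u₁ (x - 1)) (m + 1) (m + 1) +
      DeltaPlus ℓ δ x • block (monodromy₂ ℓ δ u₁ (x + 1)) m m := by
  obtain ⟨U, hU⟩ := gauge_monodromy hℓ δ u₁ x
  rw [lowerMat, lowerMatInv, conj_upper_aux] at hU
  have h0 : monodromy₂ ℓ δ u₁ x * laxExtended ℓ δ x 0 0 =
      DeltaPlus ℓ δ x • monodromy₂ ℓ δ u₁ (x + 1) - U * mulZ 0 := by
    have := congrFun (congrFun hU 0) 0
    rwa [Matrix.scalar_apply, Matrix.diagonal_mul] at this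
  have h1 : monodromy₂ ℓ δ u₁ x * laxExtended ℓ δ x 1 1 =
      mulZ 0 * U + DeltaMinus ℓ δ x • monodromy₂ ℓ δ u₁ (x - 1) := by
    have := congrFun (congrFun hU 1) 1
    rwa [Matrix.scalar_apply, Matrix.diagonal_mul] at this
  refine ⟨?_, fun m => ?_⟩
  · rw [← (laxExtended_lifts ℓ δ x 1 1).block_mul, h1, block_add, block_mulZ_mul_zero, block_smul,
      zero_add]
  · rw [← (laxExtended_lifts ℓ δ x 1 1).block_mul, ← (laxExtended_lifts ℓ δ x 0 0).block_mul, h1,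
      h0, block_add, block_sub, block_mulZ_mul_succ, block_mul_mulZ, block_smul, block_smul]
    abel

/-- No R-matrix with the parameter `u₁` has a pole. -/
def PoleFree (ℓ δ : Fin N → ℂ) (u₁ : ℂ) : Prop :=
  ∀ (k : Fin N) (n : ℕ), ℓ k + 1 - u₁ - δ k ≠ -(n : ℂ)

theorem PoleFree.sub_one {ℓ δ : Fin N → ℂ} {u : ℂ} (h : PoleFree ℓ δ u) :
    PoleFree ℓ δ (u - 1) := fun k n e => h k (n + 1) (by push_cast; linear_combination e)

theorem PoleFree.deltaMinus_ne_zero {ℓ δ : Fin N → ℂ} {u : ℂ} (h : PoleFree ℓ δ u) (n : ℕ) :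
    DeltaMinus ℓ δ (u - 1 - n) ≠ 0 :=
  Finset.prod_ne_zero_iff.2 fun k _ e => h k n (by linear_combination -e)

theorem del_mul_monodromy {ℓ δ : Fin N → ℂ} (hℓ : GenericSpins ℓ) {u : ℂ}
    (hu : PoleFree ℓ δ u) :
    del 0 * monodromy₂ ℓ δ u (u - 1) =
      (DeltaPlus ℓ δ (u - 1) / DeltaMinus ℓ δ (u - 1)) •
        (monodromy₂ ℓ δ (u - 1) u * del 0) := by
  have h : ∀ k, del 0 * site ℓ δ u (u - 1) k =
      ((u - 1 + δ k + ℓ k) / (u - 1 + δ k - ℓ k)) • (site ℓ δ (u - 1) u k * del 0) := by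
    intro k
    have := del_mul_siteOp (Fin.succ_ne_zero k) (hℓ k) (hu k)
    have e1 : 2 * ℓ k - (ℓ k + 1 - u - δ k) = u - 1 + δ k + ℓ k := by ring
    have e2 : u - 1 + δ k + ℓ k + 1 = u + δ k + ℓ k := by ring
    have e3 : ℓ k + 1 - u - δ k + 1 = ℓ k + 1 - (u - 1) - δ k := by ring
    have e4 : (ℓ k + 1 - u - δ k - 2 * ℓ k) / (ℓ k + 1 - u - δ k) =
        (u - 1 + δ k + ℓ k) / (u - 1 + δ k - ℓ k) := by
      rw [← neg_div_neg_eq]; congr 1 <;> ring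
    rw [e1, e2, e3, e4] at this
    exact this
  have h2 : ∀ l : List (Fin N), del 0 * (l.map (site ℓ δ u (u - 1))).prod =
      (l.map fun k => (u - 1 + δ k + ℓ k) / (u - 1 + δ k - ℓ k)).prod •
        ((l.map (site ℓ δ (u - 1) u)).prod * del 0) := by
    intro l
    induction l with
    | nil => simp
    | cons k l ih =>
      simp only [List.map_cons, List.prod_cons]
      rw [← mul_assoc, h, smul_mul_assoc, mul_assoc, ih, mul_smul_comm, smul_smul, mul_assoc]
  rw [monodromy₂_eq, monodromy₂_eq, h2, map_finRange_prod, Finset.prod_div_distrib]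
  rfl

/-- The lowest block is the identity because every site operator fixes the polynomials without
`z_0`. For the others, take the block `(m, m+1)` of `del_mul_monodromy`; `∂_0` yields the same
factor `m + 1` on both sides. -/
theorem block_wronskian {ℓ δ : Fin N → ℂ} (hℓ : GenericSpins ℓ) {u : ℂ} (hu : PoleFree ℓ δ u) :
    block (monodromy₂ ℓ δ u (u - 1)) 0 0 = 1 ∧
    ∀ m, block (monodromy₂ ℓ δ u (u - 1)) (m + 1) (m + 1) =
      (DeltaPlus ℓ δ (u - 1) / DeltaMinus ℓ δ (u - 1)) •
        block (monodromy₂ ℓ δ (u - 1) u) m m := by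
  constructor
  · refine LinearMap.ext fun Ψ => ?_
    have h : ∀ l : List (Fin N), (l.map (site ℓ δ u (u - 1))).prod (rename Fin.succ Ψ) =
        rename Fin.succ Ψ := by
      intro l
      induction l with
      | nil => simp
      | cons k l ih =>
        simp only [List.map_cons, List.prod_cons, Module.End.mul_apply, ih]
        have := siteOp_eq_self (Fin.succ_ne_zero k) (hℓ k) (hu k) (pderiv_zero_rename Ψ)
        have e1 : 2 * ℓ k - (ℓ k + 1 - u - δ k) = u - 1 + δ k + ℓ k := by ring
        rw [e1] at this
        exact this
    have h2 := slice_X_pow_mul 0 0 Ψ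
    rw [if_pos rfl] at h2
    rw [block_apply, pow_zero, one_mul, monodromy₂_eq, h, Module.End.one_apply]
    simpa using h2
  · intro m
    have h := congrArg (fun A => block A m (m + 1)) (del_mul_monodromy hℓ hu)
    simp only [block_del_mul, block_smul, block_mul_del, add_tsub_cancel_right] at h
    push_cast at h
    rw [smul_comm] at h
    exact smul_right_injective _ (Nat.cast_add_one_ne_zero m) h

end Chain

/-! ### Yangian relations and commuting twisted transfer matrices -/

section Yangian

/-- The defining relations of the Yangian of `gl(2)`. -/
def IsYangian {R : Type*} [Ring R] [Algebra ℂ R] (M : ℂ → Matrix (Fin 2) (Fin 2) R) : Prop :=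
  ∀ (u v : ℂ) (i j k l : Fin 2),
    (u - v) • (M u i j * M v k l) + M u k j * M v i l =
      (u - v) • (M v k l * M u i j) + M v k j * M u i l

theorem isYangian_one {R : Type*} [Ring R] [Algebra ℂ R] :
    IsYangian (fun _ => (1 : Matrix (Fin 2) (Fin 2) R)) := by
  intro u v i j k l
  congr 2
  simp only [Matrix.one_apply]
  split_ifs <;> simp

/-- The coproduct of the Yangian: entries of the two factors commute, so the exchange relation may
be applied to one factor and then to the other. -/
theorem IsYangian.mul {R : Type*} [Ring R] [Algebra ℂ R] {M M' : ℂ → Matrix (Fin 2) (Fin 2) R}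
    (h : IsYangian M) (h' : IsYangian M')
    (hc : ∀ u v i j k l, Commute (M u i j) (M' v k l)) : IsYangian fun u => M u * M' u := by
  have key : ∀ u v i j k l, (M u * M' u) i j * (M v * M' v) k l =
      ∑ a, ∑ b, (M u i a * M v k b) * (M' u a j * M' v b l) := by
    intro u v i j k l
    rw [Matrix.mul_apply, Matrix.mul_apply, Finset.sum_mul_sum]
    refine Finset.sum_congr rfl fun a _ => Finset.sum_congr rfl fun b _ => ?_
    rw [mul_assoc, ← mul_assoc (M' u a j), ← (hc v u k b a j).eq]
    simp only [mul_assoc]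
  intro u v i j k l
  rw [key, key, key, key]
  have e : ∀ a b, (u - v) • (M u i a * M v k b) + M u k a * M v i b =
      (u - v) • (M v k b * M u i a) + M v k a * M u i b := fun a b => h u v i a k b
  have e' : ∀ a b, (u - v) • (M' u a j * M' v b l) + M' u b j * M' v a l =
      (u - v) • (M' v b l * M' u a j) + M' v b j * M' u a l := fun a b => h' u v a j b l
  calc _ = ∑ a, ∑ b, ((u - v) • (M v k b * M u i a) + M v k a * M u i b) *
        (M' u a j * M' v b l) := by
        simp only [← e, add_mul, Finset.sum_add_distrib, smul_mul_assoc, Finset.smul_sum]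
    _ = ∑ a, ∑ b, M v k b * M u i a *
          ((u - v) • (M' u a j * M' v b l) + M' u b j * M' v a l) := by
        simp only [add_mul, mul_add, Finset.sum_add_distrib, smul_mul_assoc, mul_smul_comm]
        congr 1
        exact Finset.sum_comm
    _ = ∑ a, ∑ b, M v k b * M u i a *
          ((u - v) • (M' v b l * M' u a j) + M' v b j * M' u a l) := by simp only [e']
    _ = _ := by
        simp only [mul_add, Finset.sum_add_distrib, mul_smul_comm]
        congr 1
        · simp only [Finset.smul_sum]
          exact Finset.sum_comm
        · exact Finset.sum_comm

/-- These are the coefficients of `τ²`, `τ⁰` and `τ` in the statement that `D + τ A` at `u` and at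
`v` commute. -/
theorem IsYangian.commute_twisted {R : Type*} [Ring R] [Algebra ℂ R]
    {M : ℂ → Matrix (Fin 2) (Fin 2) R} (h : IsYangian M) (u v : ℂ) :
    Commute (M u 0 0) (M v 0 0) ∧ Commute (M u 1 1) (M v 1 1) ∧
      M u 0 0 * M v 1 1 + M u 1 1 * M v 0 0 = M v 0 0 * M u 1 1 + M v 1 1 * M u 0 0 := by
  have diag : ∀ i, Commute (M u i i) (M v i i) := by
    intro i
    have h1 := h u v i i i i
    have h2 := h v u i i i i
    have e1 : (u - v + 1) • (M u i i * M v i i) = (u - v + 1) • (M v i i * M u i i) := by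
      rw [add_smul, one_smul, h1, add_smul, one_smul]
    have e2 : (v - u + 1) • (M v i i * M u i i) = (v - u + 1) • (M u i i * M v i i) := by
      rw [add_smul, one_smul, h2, add_smul, one_smul]
    -- The factors `u - v + 1` and `v - u + 1` have sum `2`, so one of them can be cancelled.
    by_cases hc : u - v + 1 = 0
    · have : v - u + 1 ≠ 0 := by
        intro h0
        have : (2 : ℂ) = 0 := by linear_combination hc + h0
        norm_num at this
      exact (smul_right_injective R this e2).symm
    · exact smul_right_injective R hc e1
  refine ⟨diag 0, diag 1, ?_⟩
  by_cases huv : u - v = 0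
  · obtain rfl : u = v := sub_eq_zero.1 huv
    rfl
  have h1 := h u v 0 0 1 1
  have h2 := h v u 0 0 1 1
  apply smul_right_injective R huv
  have e : (v - u) = -(u - v) := by ring
  rw [e, neg_smul, neg_smul] at h2
  simp only [smul_add]
  -- Exchanging `u` and `v` exchanges the off-diagonal products on the two sides, so they drop out
  -- of the sum.
  have h3 := congrArg₂ (· + ·) h1 h2
  rw [← sub_eq_zero] at h3 ⊢
  rw [← h3]
  abel

/-- Evaluation representation: for a matrix linear in `u` with scalar leading term, the exchange
relation reduces to the `gl(2)` commutators of the constant term. -/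
theorem isYangian_of_commutators {R : Type*} [Ring R] [Algebra ℂ R]
    (E : Matrix (Fin 2) (Fin 2) R)
    (h : ∀ i j k l, E i j * E k l - E k l * E i j =
      (1 : Matrix (Fin 2) (Fin 2) ℂ) i l • E k j - (1 : Matrix (Fin 2) (Fin 2) ℂ) k j • E i l)
    (M : ℂ → Matrix (Fin 2) (Fin 2) R)
    (hM : ∀ u i j, M u i j = (u * (1 : Matrix (Fin 2) (Fin 2) ℂ) i j) • (1 : R) + E i j) :
    IsYangian M := by
  intro u v i j k l
  rw [← sub_eq_zero]
  have h1 := h i j k l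
  simp only [hM]
  generalize (1 : Matrix (Fin 2) (Fin 2) ℂ) i l = x at *
  generalize (1 : Matrix (Fin 2) (Fin 2) ℂ) k j = y at *
  generalize (1 : Matrix (Fin 2) (Fin 2) ℂ) k l = z at *
  generalize (1 : Matrix (Fin 2) (Fin 2) ℂ) i j = w at *
  have h2 : (u - v) • (E i j * E k l) - (u - v) • (E k l * E i j) =
      (u - v) • (x • E k j - y • E i l) := by rw [← smul_sub, h1]
  rw [← sub_eq_zero] at h2
  rw [← h2]
  simp only [mul_add, add_mul, smul_mul_assoc, mul_smul_comm, one_mul, mul_one]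
  module

theorem isYangian_aux {R : Type*} [Ring R] [Algebra ℂ R] {A B d : R} (c ℓ : ℂ)
    (c1 : d * A = A * d + d) (c3 : A * B = B * A + B)
    (c4 : d * B = B * d + (2 : ℂ) • A + (2 * ℓ) • 1) :
    IsYangian fun u => !![(u + c + ℓ) • 1 + A, -d; B, (u + c - ℓ) • 1 - A] := by
  refine isYangian_of_commutators !![(c + ℓ) • 1 + A, -d; B, (c - ℓ) • 1 - A] ?_ _ ?_
  · intro i j k l
    fin_cases i <;> fin_cases j <;> fin_cases k <;> fin_cases l <;>
      simp [mul_add, add_mul, mul_sub, sub_mul, c1, c3, c4] <;> module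
  · intro u i j
    fin_cases i <;> fin_cases j <;> simp <;> module

theorem isYangian_lax {σ : Type} [DecidableEq σ] (i : σ) (c ℓ : ℂ) :
    IsYangian fun u => lax i (u + c + ℓ) (u + c - ℓ) := by
  have h1 : ∀ {R : Type} [Ring R] [Algebra ℂ R] {z d : R}, d * z = z * d + 1 →
      IsYangian fun u => !![(u + c + ℓ) • 1 + z * d, -d; z ^ 2 * d + (2 * ℓ) • z,
        (u + c - ℓ) • 1 - z * d] := by
    intro R _ _ z d h
    have h' : ∀ x, d * (z * x) = z * (d * x) + x := fun x => by
      rw [← mul_assoc, h, add_mul, one_mul, mul_assoc]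
    refine isYangian_aux c ℓ ?_ ?_ ?_
    · simp only [h', mul_assoc]
    · simp only [sq, mul_add, add_mul, mul_smul_comm, smul_mul_assoc, mul_assoc, h', h, smul_add,
        mul_one]
      abel
    · simp only [sq, mul_add, add_mul, mul_smul_comm, smul_mul_assoc, mul_assoc, h', h, smul_add]
      module
  have h2 := h1 (del_mul_mulZ i)
  intro u v a b k l
  have e : ∀ u : ℂ, lax i (u + c + ℓ) (u + c - ℓ) =
      !![(u + c + ℓ) • 1 + mulZ i * del i, -del i; mulZ i ^ 2 * del i + (2 * ℓ) • mulZ i,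
        (u + c - ℓ) • 1 - mulZ i * del i] := by
    intro u
    have : u + c + ℓ - (u + c - ℓ) = 2 * ℓ := by ring
    rw [lax, this]
  have h3 := h2 u v a b k l
  beta_reduce at h3 ⊢
  rw [e u, e v]
  exact h3

theorem commute_lax {σ : Type} [DecidableEq σ] {i j : σ} (hij : i ≠ j) (up um up' um' : ℂ)
    (a b c d : Fin 2) : Commute (lax i up um a b) (lax j up' um' c d) := by
  have aux : ∀ (S : Module.End ℂ (MvPolynomial σ ℂ)) (k : σ) (vp vm : ℂ) (a b : Fin 2),
      Commute S (mulZ k) → Commute S (del k) → Commute S (lax k vp vm a b) := by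
    intro S k vp vm a b h1 h2
    have h3 := h1.mul_right h2
    fin_cases a <;> fin_cases b
    · change Commute S (vp • 1 + mulZ k * del k)
      exact ((Commute.one_right _).smul_right vp).add_right h3
    · change Commute S (-del k)
      exact h2.neg_right
    · change Commute S (mulZ k ^ 2 * del k + (vp - vm) • mulZ k)
      exact ((h1.pow_right 2).mul_right h2).add_right (h1.smul_right _)
    · change Commute S (vm • 1 - mulZ k * del k)
      exact ((Commute.one_right _).smul_right vm).sub_right h3
  refine aux _ _ _ _ _ _ (aux _ _ _ _ _ _ ?_ ?_).symm (aux _ _ _ _ _ _ ?_ ?_).symm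
  · exact commute_mulZ_mulZ j i
  · exact (commute_del_mulZ hij).symm
  · exact commute_del_mulZ hij.symm
  · exact commute_del_del j i

theorem commute_list_prod_matrix {R ι : Type*} [Ring R] {S : R} (l : List ι)
    {F : ι → Matrix (Fin 2) (Fin 2) R} (h : ∀ i ∈ l, ∀ a b, Commute S (F i a b)) (a b : Fin 2) :
    Commute S ((l.map F).prod a b) := by
  induction l generalizing a b with
  | nil =>
    simp only [List.map_nil, List.prod_nil, Matrix.one_apply]
    split_ifs
    exacts [Commute.one_right _, Commute.zero_right _]
  | cons i l ih =>
    simp only [List.map_cons, List.prod_cons, Matrix.mul_apply]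
    exact Commute.sum_right _ _ _ fun c _ => (h i (by simp) a c).mul_right
      (ih (fun j hj => h j (by simp [hj])) c b)

theorem isYangian_laxQuantum {N : ℕ} (ℓ δ : Fin N → ℂ) : IsYangian (laxQuantum ℓ δ) := by
  have : ∀ l : List (Fin N), l.Nodup →
      IsYangian fun x => (l.map fun k => lax k (x + δ k + ℓ k) (x + δ k - ℓ k)).prod := by
    intro l hl
    induction l with
    | nil => exact isYangian_one
    | cons k l ih =>
      rw [List.nodup_cons] at hl
      simp only [List.map_cons, List.prod_cons]
      refine (isYangian_lax k (δ k) (ℓ k)).mul (ih hl.2) fun u v a b c d => ?_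
      refine commute_list_prod_matrix _ (fun j hj a' b' => ?_) c d
      exact commute_lax (by rintro rfl; exact hl.1 hj) _ _ _ _ _ _ _ _
  exact this _ (List.nodup_finRange N)

end Yangian

/-! ### Vector-valued polynomial functions -/

section PolyCurve

variable {V : Type*} [AddCommGroup V] [Module ℂ V]

/-- The polynomial functions of a complex variable with values in `V`. -/
def polyCurve (V : Type*) [AddCommGroup V] [Module ℂ V] : Submodule ℂ (ℂ → V) :=
  Submodule.span ℂ {g | ∃ (i : ℕ) (v : V), g = fun x => x ^ i • v}

theorem polyCurve_zero : (fun _ : ℂ => (0 : V)) ∈ polyCurve V := (polyCurve V).zero_mem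

theorem polyCurve_add {f g : ℂ → V} (hf : f ∈ polyCurve V) (hg : g ∈ polyCurve V) :
    (fun x => f x + g x) ∈ polyCurve V := (polyCurve V).add_mem hf hg

theorem polyCurve_sub {f g : ℂ → V} (hf : f ∈ polyCurve V) (hg : g ∈ polyCurve V) :
    (fun x => f x - g x) ∈ polyCurve V := (polyCurve V).sub_mem hf hg

theorem polyCurve_smul (c : ℂ) {f : ℂ → V} (hf : f ∈ polyCurve V) :
    (fun x => c • f x) ∈ polyCurve V := (polyCurve V).smul_mem c hf

theorem polyCurve_sum {ι : Type*} (t : Finset ι) {f : ι → ℂ → V} (hf : ∀ i, f i ∈ polyCurve V) :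
    (fun x => ∑ i ∈ t, f i x) ∈ polyCurve V := by
  have := (polyCurve V).sum_mem (t := t) fun i _ => hf i
  convert this using 1
  ext1 x
  rw [Finset.sum_apply]

theorem polyCurve_pow_smul (i : ℕ) {f : ℂ → V} (hf : f ∈ polyCurve V) :
    (fun x => x ^ i • f x) ∈ polyCurve V := by
  induction hf using Submodule.span_induction with
  | mem g hg =>
    obtain ⟨j, v, rfl⟩ := hg
    exact Submodule.subset_span ⟨i + j, v, by funext x; rw [pow_add, smul_smul]⟩
  | zero => simpa using polyCurve_zero
  | add f g _ _ hf hg =>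
    simpa only [Pi.add_apply, smul_add] using polyCurve_add hf hg
  | smul c f _ hf =>
    simp only [Pi.smul_apply, smul_comm _ c]
    exact (polyCurve V).smul_mem c hf

theorem polyCurve_const (v : V) : (fun _ : ℂ => v) ∈ polyCurve V :=
  Submodule.subset_span ⟨0, v, by simp⟩

theorem polyCurve_eval_smul (p : Polynomial ℂ) {f : ℂ → V} (hf : f ∈ polyCurve V) :
    (fun x => p.eval x • f x) ∈ polyCurve V := by
  induction p using Polynomial.induction_on' with
  | add p q hp hq => simpa only [Polynomial.eval_add, add_smul] using polyCurve_add hp hq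
  | monomial n a =>
    simp only [Polynomial.eval_monomial, mul_smul]
    exact (polyCurve V).smul_mem a (polyCurve_pow_smul n hf)

/-- Polynomiality of `A` on each vector suffices, since a curve involves finitely many vectors. The
R-matrices need this form: their degree in `u₂` is not bounded uniformly over all vectors. -/
theorem polyCurve_apply {W : Type*} [AddCommGroup W] [Module ℂ W] {A : ℂ → V →ₗ[ℂ] W}
    (hA : ∀ v, (fun x => A x v) ∈ polyCurve W) {f : ℂ → V} (hf : f ∈ polyCurve V) :
    (fun x => A x (f x)) ∈ polyCurve W := by
  induction hf using Submodule.span_induction with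
  | mem g hg =>
    obtain ⟨j, v, rfl⟩ := hg
    simpa only [map_smul] using polyCurve_pow_smul j (hA v)
  | zero => simpa using polyCurve_zero
  | add f g _ _ hf hg =>
    simpa only [Pi.add_apply, map_add] using polyCurve_add hf hg
  | smul c f _ hf =>
    simpa only [Pi.smul_apply, map_smul] using polyCurve_smul c hf

theorem polyCurve_map {W : Type*} [AddCommGroup W] [Module ℂ W] (A : V →ₗ[ℂ] W) {f : ℂ → V}
    (hf : f ∈ polyCurve V) : (fun x => A (f x)) ∈ polyCurve W :=
  polyCurve_apply (fun v => polyCurve_const (A v)) hf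

/-- Every linear functional turns the curve into a polynomial with infinitely many zeros, and
functionals separate points. -/
theorem polyCurve_eq_zero {f : ℂ → V} (hf : f ∈ polyCurve V) (x₀ : ℂ)
    (h : ∀ n : ℕ, f (x₀ - n) = 0) (x : ℂ) : f x = 0 := by
  rw [← Module.forall_dual_apply_eq_zero_iff ℂ]
  intro φ
  have hp : ∃ p : Polynomial ℂ, ∀ x, φ (f x) = p.eval x := by
    clear h
    induction hf using Submodule.span_induction with
    | mem g hg =>
      obtain ⟨j, v, rfl⟩ := hg
      exact ⟨Polynomial.monomial j (φ v), fun x => by simp [mul_comm]⟩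
    | zero => exact ⟨0, fun x => by simp⟩
    | add f g _ _ hf hg =>
      obtain ⟨p, hp⟩ := hf
      obtain ⟨q, hq⟩ := hg
      exact ⟨p + q, fun x => by simp [hp, hq]⟩
    | smul c f _ hf =>
      obtain ⟨p, hp⟩ := hf
      exact ⟨Polynomial.C c * p, fun x => by simp [hp]⟩
  obtain ⟨p, hp⟩ := hp
  have : p = 0 := by
    apply Polynomial.eq_zero_of_infinite_isRoot
    refine Set.infinite_of_injective_forall_mem (f := fun n : ℕ => x₀ - n) ?_ fun n => ?_
    · intro a b hab
      exact Nat.cast_injective (sub_right_injective hab)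
    · simp only [Set.mem_ofPred_eq, Polynomial.IsRoot, ← hp, h n, map_zero]
  rw [hp, this, Polynomial.eval_zero]

end PolyCurve

/-! ### Relations between formal power series in the twist -/

section Series

open PowerSeries (coeff)

variable {N : ℕ}

/-- The operators on the quantum space. -/
abbrev Op (N : ℕ) : Type := Module.End ℂ (Quantum N)

/-- The diagonal blocks of the monodromy, as the coefficients of a power series in a twist. -/
def qSeries (ℓ δ : Fin N → ℂ) (u₁ u₂ : ℂ) : PowerSeries (Op N) :=
  PowerSeries.mk fun m => block (monodromy₂ ℓ δ u₁ u₂) m m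

/-- The twisted transfer matrix. -/
def tSeries (ℓ δ : Fin N → ℂ) (x : ℂ) : PowerSeries (Op N) :=
  PowerSeries.C (laxQuantum ℓ δ x 1 1) + PowerSeries.X * PowerSeries.C (laxQuantum ℓ δ x 0 0)

theorem coeff_qSeries (ℓ δ : Fin N → ℂ) (u₁ u₂ : ℂ) (m : ℕ) :
    coeff m (qSeries ℓ δ u₁ u₂) = block (monodromy₂ ℓ δ u₁ u₂) m m :=
  PowerSeries.coeff_mk _ _

theorem coeff_smul_complex (c : ℂ) (F : PowerSeries (Op N)) (m : ℕ) :
    coeff m (c • F) = c • coeff m F := rfl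

theorem coeff_zero_mul_tSeries (ℓ δ : Fin N → ℂ) (x : ℂ) (F : PowerSeries (Op N)) :
    coeff 0 (F * tSeries ℓ δ x) = coeff 0 F * laxQuantum ℓ δ x 1 1 := by
  rw [tSeries, mul_add, map_add, PowerSeries.coeff_mul_C, ← mul_assoc, PowerSeries.coeff_mul_C,
    PowerSeries.coeff_zero_mul_X, zero_mul, add_zero]

theorem coeff_succ_mul_tSeries (ℓ δ : Fin N → ℂ) (x : ℂ) (F : PowerSeries (Op N)) (m : ℕ) :
    coeff (m + 1) (F * tSeries ℓ δ x) =
      coeff (m + 1) F * laxQuantum ℓ δ x 1 1 + coeff m F * laxQuantum ℓ δ x 0 0 := by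
  rw [tSeries, mul_add, map_add, PowerSeries.coeff_mul_C, ← mul_assoc, PowerSeries.coeff_mul_C,
    PowerSeries.coeff_succ_mul_X]

/-- The Baxter equation in the variable `x`. -/
def IsBaxter (ℓ δ : Fin N → ℂ) (Y : ℂ → PowerSeries (Op N)) : Prop :=
  ∀ x, Y x * tSeries ℓ δ x = DeltaMinus ℓ δ x • Y (x - 1) +
    DeltaPlus ℓ δ x • (PowerSeries.X * Y (x + 1))

theorem IsBaxter.mul_left {ℓ δ : Fin N → ℂ} {Y : ℂ → PowerSeries (Op N)} (h : IsBaxter ℓ δ Y)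
    (C : PowerSeries (Op N)) : IsBaxter ℓ δ fun x => C * Y x := fun x => by
  rw [mul_assoc, h x, mul_add, mul_smul_comm, mul_smul_comm, ← mul_assoc C PowerSeries.X,
    (PowerSeries.commute_X C).eq, mul_assoc]

theorem IsBaxter.mul_right {ℓ δ : Fin N → ℂ} {Y : ℂ → PowerSeries (Op N)} (h : IsBaxter ℓ δ Y)
    {C : PowerSeries (Op N)} (hC : ∀ x, Commute C (tSeries ℓ δ x)) :
    IsBaxter ℓ δ fun x => Y x * C := fun x => by
  rw [mul_assoc, (hC x).eq, ← mul_assoc, h x, add_mul, smul_mul_assoc, smul_mul_assoc, mul_assoc]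

theorem IsBaxter.add {ℓ δ : Fin N → ℂ} {Y Z : ℂ → PowerSeries (Op N)} (h : IsBaxter ℓ δ Y)
    (h' : IsBaxter ℓ δ Z) : IsBaxter ℓ δ fun x => Y x + Z x := fun x => by
  rw [add_mul, h x, h' x, mul_add, smul_add, smul_add, add_add_add_comm]

theorem IsBaxter.smul {ℓ δ : Fin N → ℂ} {Y : ℂ → PowerSeries (Op N)} (h : IsBaxter ℓ δ Y)
    (c : ℂ) : IsBaxter ℓ δ fun x => c • Y x := fun x => by
  rw [smul_mul_assoc, h x, mul_smul_comm, smul_add, smul_comm c, smul_comm c]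

theorem IsBaxter.sub {ℓ δ : Fin N → ℂ} {Y Z : ℂ → PowerSeries (Op N)} (h : IsBaxter ℓ δ Y)
    (h' : IsBaxter ℓ δ Z) : IsBaxter ℓ δ fun x => Y x - Z x := fun x => by
  rw [sub_mul, h x, h' x, mul_sub, smul_sub, smul_sub, add_sub_add_comm]

theorem isBaxter_qSeries {ℓ : Fin N → ℂ} (hℓ : GenericSpins ℓ) (δ : Fin N → ℂ) (u₁ : ℂ) :
    IsBaxter ℓ δ (qSeries ℓ δ u₁) := by
  intro x
  obtain ⟨h0, h1⟩ := block_baxter hℓ δ u₁ x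
  ext1 m
  cases m with
  | zero =>
    rw [coeff_zero_mul_tSeries, map_add, coeff_smul_complex, coeff_smul_complex,
      PowerSeries.coeff_zero_X_mul, smul_zero, add_zero, coeff_qSeries, coeff_qSeries, h0]
  | succ m =>
    rw [coeff_succ_mul_tSeries, map_add, coeff_smul_complex, coeff_smul_complex,
      PowerSeries.coeff_succ_X_mul, coeff_qSeries, coeff_qSeries, coeff_qSeries, coeff_qSeries,
      h1 m]

theorem qSeries_wronskian {ℓ δ : Fin N → ℂ} (hℓ : GenericSpins ℓ) {u : ℂ}
    (hu : PoleFree ℓ δ u) :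
    qSeries ℓ δ u (u - 1) = 1 + (DeltaPlus ℓ δ (u - 1) / DeltaMinus ℓ δ (u - 1)) •
      (PowerSeries.X * qSeries ℓ δ (u - 1) u) := by
  obtain ⟨h0, h1⟩ := block_wronskian hℓ hu
  ext1 m
  cases m with
  | zero =>
    rw [map_add, coeff_smul_complex, PowerSeries.coeff_zero_X_mul, smul_zero, add_zero,
      coeff_qSeries, h0, PowerSeries.coeff_zero_one]
  | succ m =>
    rw [map_add, coeff_smul_complex, PowerSeries.coeff_succ_X_mul, coeff_qSeries, coeff_qSeries,
      h1 m, PowerSeries.coeff_one, if_neg (Nat.succ_ne_zero m), zero_add]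

theorem commute_tSeries (ℓ δ : Fin N → ℂ) (x y : ℂ) :
    Commute (tSeries ℓ δ x) (tSeries ℓ δ y) := by
  obtain ⟨hA, hD, h⟩ := (isYangian_laxQuantum ℓ δ).commute_twisted x y
  have hX : ∀ F : PowerSeries (Op N), F * PowerSeries.X = PowerSeries.X * F :=
    fun F => (PowerSeries.commute_X F).eq
  have hX' : ∀ F G : PowerSeries (Op N),
      F * (PowerSeries.X * G) = PowerSeries.X * (F * G) := fun F G => by
    rw [← mul_assoc, hX, mul_assoc]
  rw [Commute, SemiconjBy]
  simp only [tSeries, mul_add, add_mul, mul_assoc, hX', ← map_mul, hA.eq, hD.eq]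
  have h2 := congrArg (fun a => PowerSeries.X * PowerSeries.C (R := Op N) a) h
  simp only [map_add, mul_add] at h2
  rw [← sub_eq_zero] at h2 ⊢
  rw [← h2]
  abel

/-- At lowest order the terms multiplied by the twist vanish and the Baxter equation becomes `Y_n(x)
D(x) = Δ₋(x) Y_n(x-1)`. A zero at `x₀` propagates to all `x₀ - j`, and polynomiality in `x`
finishes. -/
theorem coeff_eq_zero_of_isBaxter {ℓ δ : Fin N → ℂ} {Y : ℂ → PowerSeries (Op N)}
    (hY : IsBaxter ℓ δ Y) {n : ℕ} (hlow : ∀ m < n, ∀ x, coeff m (Y x) = 0)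
    (hpoly : ∀ Ψ, (fun x => coeff n (Y x) Ψ) ∈ polyCurve (Quantum N)) {x₀ : ℂ}
    (h0 : coeff n (Y x₀) = 0) (hΔ : ∀ j : ℕ, DeltaMinus ℓ δ (x₀ - j) ≠ 0) (x : ℂ) :
    coeff n (Y x) = 0 := by
  have step : ∀ x, coeff n (Y x) * laxQuantum ℓ δ x 1 1 =
      DeltaMinus ℓ δ x • coeff n (Y (x - 1)) := by
    intro x
    have h := congrArg (coeff n) (hY x)
    rw [map_add, coeff_smul_complex, coeff_smul_complex] at h
    cases n with
    | zero =>
      rwa [coeff_zero_mul_tSeries, PowerSeries.coeff_zero_X_mul, smul_zero, add_zero] at h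
    | succ n =>
      rwa [coeff_succ_mul_tSeries, PowerSeries.coeff_succ_X_mul, hlow n (Nat.lt_succ_self n),
        hlow n (Nat.lt_succ_self n), smul_zero, add_zero, zero_mul, add_zero] at h
  have zeros : ∀ j : ℕ, coeff n (Y (x₀ - j)) = 0 := by
    intro j
    induction j with
    | zero => simpa using h0
    | succ j ih =>
      have h := step (x₀ - j)
      rw [ih, zero_mul] at h
      have := (smul_eq_zero.1 h.symm).resolve_left (hΔ j)
      rwa [sub_sub, ← Nat.cast_succ] at this
  refine LinearMap.ext fun Ψ => ?_
  exact polyCurve_eq_zero (hpoly Ψ) x₀ (fun j => by rw [zeros j]; rfl) x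

theorem polyCurve_diffFun {σ : Type} [DecidableEq σ] (i j : σ) {g : ℂ → ℕ → ℂ}
    (hg : ∀ n, ∃ p : Polynomial ℂ, ∀ x, g x n = p.eval x) (p : MvPolynomial σ ℂ) :
    (fun x => diffFun i j (g x) p) ∈ polyCurve (MvPolynomial σ ℂ) := by
  have key : ∀ q : MvPolynomial σ ℂ,
      (fun x => eulerFun i (g x) q) ∈ polyCurve (MvPolynomial σ ℂ) := by
    intro q
    induction q using MvPolynomial.induction_on' with
    | monomial t a =>
      obtain ⟨p, hp⟩ := hg (t i)
      have e : monomial t a = a • monomial t (1 : ℂ) := by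
        rw [smul_monomial, smul_eq_mul, mul_one]
      simp only [e, map_smul, eulerFun_monomial, hp]
      exact (polyCurve _).smul_mem a (polyCurve_eval_smul p (polyCurve_const _))
    | add p q hp hq => simpa only [map_add] using polyCurve_add hp hq
  simp only [diffFun, Module.End.mul_apply]
  exact polyCurve_map (shift i j (-1)) (key _)

theorem polyCurve_monodromy (ℓ δ : Fin N → ℂ) (u₁ : ℂ) (p : Extended N) :
    (fun x => monodromy₂ ℓ δ u₁ x p) ∈ polyCurve (Extended N) := by
  simp only [monodromy₂_eq]
  have hs : ∀ k p, (fun x => site ℓ δ u₁ x k p) ∈ polyCurve (Extended N) := by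
    intro k p
    simp only [site, siteOp, Module.End.mul_apply]
    refine polyCurve_map (perm k.succ 0) (polyCurve_map (diffFun 0 k.succ _)
      (polyCurve_diffFun _ _ (fun n => ?_) p))
    refine ⟨Polynomial.C ((ascPochhammer ℂ n).eval (2 * ℓ k))⁻¹ *
      (ascPochhammer ℂ n).comp (Polynomial.X + Polynomial.C (δ k + ℓ k)), fun x => ?_⟩
    simp only [gammaRatio, Polynomial.eval_mul, Polynomial.eval_C, Polynomial.eval_comp,
      Polynomial.eval_add, Polynomial.eval_X, add_assoc]
    rw [div_eq_inv_mul]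
  generalize List.finRange N = l
  induction l with
  | nil => simpa using polyCurve_const p
  | cons k l ih =>
    simp only [List.map_cons, List.prod_cons, Module.End.mul_apply]
    exact polyCurve_apply (hs k) ih

theorem polyCurve_coeff_qSeries (ℓ δ : Fin N → ℂ) (u₁ : ℂ) (m : ℕ) (Ψ : Quantum N) :
    (fun x => coeff m (qSeries ℓ δ u₁ x) Ψ) ∈ polyCurve (Quantum N) := by
  simp only [coeff_qSeries, block_apply]
  exact polyCurve_map (slice m) (polyCurve_monodromy ℓ δ u₁ _)

theorem polyCurve_coeff_mul_left (C : PowerSeries (Op N)) {Y : ℂ → PowerSeries (Op N)}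
    (h : ∀ m Ψ, (fun x => coeff m (Y x) Ψ) ∈ polyCurve (Quantum N)) (m : ℕ) (Ψ : Quantum N) :
    (fun x => coeff m (C * Y x) Ψ) ∈ polyCurve (Quantum N) := by
  simp only [PowerSeries.coeff_mul, LinearMap.sum_apply, Module.End.mul_apply]
  exact polyCurve_sum _ fun p => polyCurve_map (coeff p.1 C) (h p.2 Ψ)

theorem polyCurve_coeff_mul_right (C : PowerSeries (Op N)) {Y : ℂ → PowerSeries (Op N)}
    (h : ∀ m Ψ, (fun x => coeff m (Y x) Ψ) ∈ polyCurve (Quantum N)) (m : ℕ) (Ψ : Quantum N) :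
    (fun x => coeff m (Y x * C) Ψ) ∈ polyCurve (Quantum N) := by
  simp only [PowerSeries.coeff_mul, LinearMap.sum_apply, Module.End.mul_apply]
  exact polyCurve_sum _ fun p => h p.1 (coeff p.2 C Ψ)

/-- The commutator solves the Baxter equation in `x`, so it is enough to know it at `x = u - 1`.
There the normalisation expresses order `n` through order `n - 1` with `u - 1` in place of `u`;
hence the induction runs over all pole-free `u` at once. -/
theorem commute_qSeries {ℓ δ : Fin N → ℂ} (hℓ : GenericSpins ℓ) {C : PowerSeries (Op N)}
    (hC : ∀ x, Commute C (tSeries ℓ δ x)) {u : ℂ} (hu : PoleFree ℓ δ u) (x : ℂ) :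
    Commute C (qSeries ℓ δ u x) := by
  have key : ∀ n u, PoleFree ℓ δ u → ∀ x,
      coeff n (C * qSeries ℓ δ u x - qSeries ℓ δ u x * C) = 0 := by
    intro n
    induction n using Nat.strong_induction_on with
    | _ n ih =>
    intro u hu x
    refine coeff_eq_zero_of_isBaxter (ℓ := ℓ) (δ := δ)
      (Y := fun x => C * qSeries ℓ δ u x - qSeries ℓ δ u x * C) (x₀ := u - 1) ?_
      (fun m hm y => ih m hm u hu y) ?_ ?_ hu.deltaMinus_ne_zero x
    · exact ((isBaxter_qSeries hℓ δ u).mul_left C).sub ((isBaxter_qSeries hℓ δ u).mul_right hC)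
    · intro Ψ
      simp only [map_sub, LinearMap.sub_apply]
      exact polyCurve_sub
        (polyCurve_coeff_mul_left C (polyCurve_coeff_qSeries ℓ δ u) n Ψ)
        (polyCurve_coeff_mul_right C (polyCurve_coeff_qSeries ℓ δ u) n Ψ)
    · rw [qSeries_wronskian hℓ hu]
      have e : C * (1 + (DeltaPlus ℓ δ (u - 1) / DeltaMinus ℓ δ (u - 1)) •
            (PowerSeries.X * qSeries ℓ δ (u - 1) u)) -
          (1 + (DeltaPlus ℓ δ (u - 1) / DeltaMinus ℓ δ (u - 1)) •
            (PowerSeries.X * qSeries ℓ δ (u - 1) u)) * C =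
          (DeltaPlus ℓ δ (u - 1) / DeltaMinus ℓ δ (u - 1)) •
            (PowerSeries.X * (C * qSeries ℓ δ (u - 1) u - qSeries ℓ δ (u - 1) u * C)) := by
        simp only [mul_add, add_mul, mul_one, one_mul, mul_smul_comm, smul_mul_assoc, mul_sub,
          smul_sub, ← mul_assoc, (PowerSeries.commute_X C).eq]
        abel
      rw [e, coeff_smul_complex]
      cases n with
      | zero => rw [PowerSeries.coeff_zero_X_mul, smul_zero]
      | succ n =>
        rw [PowerSeries.coeff_succ_X_mul, ih n (Nat.lt_succ_self n) (u - 1) hu.sub_one, smul_zero]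
  rw [Commute, SemiconjBy, ← sub_eq_zero]
  ext1 n
  rw [key n u hu x, map_zero]

theorem commute_tSeries_qSeries {ℓ δ : Fin N → ℂ} (hℓ : GenericSpins ℓ) {u : ℂ}
    (hu : PoleFree ℓ δ u) (v x : ℂ) : Commute (tSeries ℓ δ v) (qSeries ℓ δ u x) :=
  commute_qSeries hℓ (commute_tSeries ℓ δ v) hu x

theorem commute_qSeries_qSeries {ℓ δ : Fin N → ℂ} (hℓ : GenericSpins ℓ) {u v : ℂ}
    (hu : PoleFree ℓ δ u) (hv : PoleFree ℓ δ v) (x y : ℂ) :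
    Commute (qSeries ℓ δ u x) (qSeries ℓ δ v y) :=
  commute_qSeries hℓ (fun z => (commute_tSeries_qSeries hℓ hu z x).symm) hv y

/-- Both sides solve the Baxter equation in `x`, so comparing them at the single point `x = u` is
enough. -/
theorem tSeries_mul_qSeries {ℓ δ : Fin N → ℂ} (hℓ : GenericSpins ℓ) {u : ℂ}
    (hu : PoleFree ℓ δ (u + 1)) (x : ℂ) :
    tSeries ℓ δ u * qSeries ℓ δ u x =
      (DeltaPlus ℓ δ (u - 1) * DeltaMinus ℓ δ u / DeltaMinus ℓ δ (u - 1)) •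
        (PowerSeries.X * qSeries ℓ δ (u - 1) x) + DeltaMinus ℓ δ u • qSeries ℓ δ (u + 1) x := by
  have hu' : PoleFree ℓ δ u := by simpa using hu.sub_one
  set c := DeltaPlus ℓ δ (u - 1) / DeltaMinus ℓ δ (u - 1) with hc
  have hΔ : ∀ j : ℕ, DeltaMinus ℓ δ (u - j) ≠ 0 := by
    simpa using hu.deltaMinus_ne_zero
  have hΔ0 : DeltaMinus ℓ δ u ≠ 0 := by simpa using hΔ 0
  set Y : ℂ → PowerSeries (Op N) := fun x => tSeries ℓ δ u * qSeries ℓ δ u x -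
    ((c * DeltaMinus ℓ δ u) • (PowerSeries.X * qSeries ℓ δ (u - 1) x) +
      DeltaMinus ℓ δ u • qSeries ℓ δ (u + 1) x) with hY
  have hB : IsBaxter ℓ δ Y :=
     ((isBaxter_qSeries hℓ δ u).mul_left _).sub
      ((((isBaxter_qSeries hℓ δ (u - 1)).mul_left _).smul _).add
        ((isBaxter_qSeries hℓ δ (u + 1)).smul _))
  -- Here the known Baxter equation in `u₂` is available. The normalisation at `u` and at `u + 1`
  -- rewrites `Q(u|u-1)` and `Q(u+1|u)`, after which all terms match.
  have hYu : Y u = 0 := by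
    have h1 := isBaxter_qSeries hℓ δ u u
    have h2 := qSeries_wronskian hℓ hu'
    have h3 := qSeries_wronskian hℓ hu
    rw [add_sub_cancel_right] at h3
    simp only [hY]
    rw [(commute_tSeries_qSeries hℓ hu' u u).eq, h1, h2, h3, ← hc]
    simp only [smul_add, smul_smul]
    rw [mul_div_cancel₀ _ hΔ0, mul_comm c]
    abel
  have hpoly : ∀ n Ψ, (fun x => coeff n (Y x) Ψ) ∈ polyCurve (Quantum N) := by
    intro n Ψ
    simp only [hY, map_sub, map_add, coeff_smul_complex, LinearMap.sub_apply, LinearMap.add_apply,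
      LinearMap.smul_apply]
    exact polyCurve_sub (polyCurve_coeff_mul_left _ (polyCurve_coeff_qSeries ℓ δ u) n Ψ)
      (polyCurve_add (polyCurve_smul _
        (polyCurve_coeff_mul_left _ (polyCurve_coeff_qSeries ℓ δ (u - 1)) n Ψ))
        (polyCurve_smul _ (polyCurve_coeff_qSeries ℓ δ (u + 1) n Ψ)))
  have key : ∀ n x, coeff n (Y x) = 0 := by
    intro n
    induction n using Nat.strong_induction_on with
    | _ n ih =>
    exact coeff_eq_zero_of_isBaxter hB (fun m hm x => ih m hm x) (hpoly n) (x₀ := u)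
      (by rw [hYu, map_zero]) hΔ
  have hYx : Y x = 0 := by ext1 n; rw [key n x, map_zero]
  have e : DeltaPlus ℓ δ (u - 1) * DeltaMinus ℓ δ u / DeltaMinus ℓ δ (u - 1) =
      c * DeltaMinus ℓ δ u := by rw [hc]; ring
  rw [e]
  exact sub_eq_zero.1 hYx

end Series

/-! ### Evaluation of the series at twist one -/

section Evaluation

variable {N : ℕ}

/-- The series `F` converges, coefficient by coefficient, to `T` when the variable is `1`. -/
def EvalsTo (F : PowerSeries (Op N)) (T : Op N) : Prop :=
  ∀ Ψ s, HasSum (fun m => coeff s (PowerSeries.coeff m F Ψ)) (coeff s (T Ψ))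

/-- For every vector, finitely many monomials occur in its images under the coefficients of `F`. -/
def FiniteRange (F : PowerSeries (Op N)) : Prop :=
  ∀ Ψ, ∃ S : Finset (Fin N →₀ ℕ), ∀ m, (PowerSeries.coeff m F Ψ).support ⊆ S

theorem isAuxTrace_iff_evalsTo (ℓ δ : Fin N → ℂ) (u₁ u₂ : ℂ) (T : Op N) :
    IsAuxTrace (monodromy₂ ℓ δ u₁ u₂) T ↔ EvalsTo (qSeries ℓ δ u₁ u₂) T := by
  simp only [isAuxTrace_iff, EvalsTo, coeff_qSeries]

theorem EvalsTo.unique {F : PowerSeries (Op N)} {T T' : Op N} (h : EvalsTo F T)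
    (h' : EvalsTo F T') : T = T' := by
  refine LinearMap.ext fun Ψ => ?_
  ext s
  exact (h Ψ s).unique (h' Ψ s)

theorem EvalsTo.add {F G : PowerSeries (Op N)} {S T : Op N} (h : EvalsTo F S)
    (h' : EvalsTo G T) : EvalsTo (F + G) (S + T) := fun Ψ s => by
  simpa only [map_add, LinearMap.add_apply, coeff_add] using (h Ψ s).add (h' Ψ s)

theorem EvalsTo.smul {F : PowerSeries (Op N)} {S : Op N} (h : EvalsTo F S) (c : ℂ) :
    EvalsTo (c • F) (c • S) := fun Ψ s => by
  simpa only [coeff_smul_complex, LinearMap.smul_apply, coeff_smul, smul_eq_mul] using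
    (h Ψ s).mul_left c

theorem evalsTo_C (a : Op N) : EvalsTo (PowerSeries.C a) a := fun Ψ s => by
  have := hasSum_single (f := fun m => coeff s (PowerSeries.coeff m (PowerSeries.C a) Ψ)) 0
    fun m hm => by simp [PowerSeries.coeff_C, hm]
  simpa using this

theorem evalsTo_X : EvalsTo (PowerSeries.X : PowerSeries (Op N)) 1 := fun Ψ s => by
  have := hasSum_single
    (f := fun m => coeff s (PowerSeries.coeff m (PowerSeries.X : PowerSeries (Op N)) Ψ)) 1
    fun m hm => by simp [PowerSeries.coeff_X, hm]
  simpa using this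

theorem apply_eq_sum {S : Finset (Fin N →₀ ℕ)} {Φ : Quantum N} (h : Φ.support ⊆ S) (A : Op N) :
    A Φ = ∑ t ∈ S, coeff t Φ • A (monomial t 1) := by
  conv_lhs => rw [← support_sum_monomial_coeff Φ]
  rw [map_sum, ← Finset.sum_subset h]
  · refine Finset.sum_congr rfl fun t _ => ?_
    rw [← map_smul, smul_monomial, smul_eq_mul, mul_one]
  · intro t _ ht
    rw [notMem_support_iff.1 ht, zero_smul]

theorem hasSum_cauchy {f g : ℕ → ℂ} {a b : ℂ} (hf : HasSum f a) (hg : HasSum g b) :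
    HasSum (fun n => ∑ p ∈ Finset.HasAntidiagonal.antidiagonal n, f p.1 * g p.2) (a * b) := by
  have h1 := hf.summable.norm
  have h2 := hg.summable.norm
  have h3 := (summable_norm_sum_mul_antidiagonal_of_summable_norm h1 h2).of_norm.hasSum
  rwa [← tsum_mul_tsum_eq_tsum_sum_antidiagonal_of_summable_norm h1 h2, hf.tsum_eq,
    hg.tsum_eq] at h3

/-- The images of a vector under the coefficients of `G` lie in the span of finitely many monomials.
Each matrix element of the product is thus a finite sum of Cauchy products of absolutely convergent
series. -/
theorem EvalsTo.mul {F G : PowerSeries (Op N)} {S T : Op N} (h : EvalsTo F S)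
    (h' : EvalsTo G T) (hG : FiniteRange G) : EvalsTo (F * G) (S * T) := fun Ψ s => by
  obtain ⟨R, hR⟩ := hG Ψ
  have hT : (T Ψ).support ⊆ R := by
    intro t ht
    by_contra hn
    apply mem_support_iff.1 ht
    refine (h' Ψ t).unique ?_
    have : ∀ m, coeff t (PowerSeries.coeff m G Ψ) = 0 := fun m =>
      notMem_support_iff.1 fun hm => hn (hR m hm)
    simp only [this]
    exact hasSum_zero
  have key := hasSum_sum (s := R) fun t (_ : t ∈ R) =>
    hasSum_cauchy (h (monomial t 1) s) (h' Ψ t)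
  convert key using 1
  · funext m
    rw [PowerSeries.coeff_mul, LinearMap.sum_apply, coeff_sum, Finset.sum_comm]
    refine Finset.sum_congr rfl fun p _ => ?_
    rw [Module.End.mul_apply, apply_eq_sum (hR p.2), coeff_sum]
    refine Finset.sum_congr rfl fun t _ => ?_
    rw [coeff_smul, smul_eq_mul, mul_comm]
  · rw [Module.End.mul_apply, apply_eq_sum hT, coeff_sum]
    refine Finset.sum_congr rfl fun t _ => ?_
    rw [coeff_smul, smul_eq_mul, mul_comm]

theorem finiteRange_C (a : Op N) : FiniteRange (PowerSeries.C a) := fun Ψ =>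
  ⟨(a Ψ).support, fun m => by
    rw [PowerSeries.coeff_C]
    split_ifs <;> simp⟩

theorem FiniteRange.X_mul {F : PowerSeries (Op N)} (h : FiniteRange F) :
    FiniteRange (PowerSeries.X * F) := fun Ψ => by
  obtain ⟨S, hS⟩ := h Ψ
  refine ⟨S, fun m => ?_⟩
  cases m with
  | zero => simp
  | succ m => rw [PowerSeries.coeff_succ_X_mul]; exact hS m

theorem FiniteRange.add {F G : PowerSeries (Op N)} (h : FiniteRange F) (h' : FiniteRange G) :
    FiniteRange (F + G) := fun Ψ => by
  classical
  obtain ⟨S, hS⟩ := h Ψ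
  obtain ⟨S', hS'⟩ := h' Ψ
  refine ⟨S ∪ S', fun m => ?_⟩
  rw [map_add, LinearMap.add_apply]
  exact support_add.trans (Finset.union_subset_union (hS m) (hS' m))

theorem evalsTo_tSeries (ℓ δ : Fin N → ℂ) (x : ℂ) :
    EvalsTo (tSeries ℓ δ x) (transfer ℓ δ x) := by
  rw [transfer_eq]
  have := (evalsTo_C (laxQuantum ℓ δ x 1 1)).add
    (evalsTo_X.mul (evalsTo_C (laxQuantum ℓ δ x 0 0)) (finiteRange_C _))
  rwa [one_mul] at this

theorem finiteRange_tSeries (ℓ δ : Fin N → ℂ) (x : ℂ) : FiniteRange (tSeries ℓ δ x) :=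
  (finiteRange_C _).add (finiteRange_C _).X_mul

theorem monodromy_isHomogeneous (ℓ δ : Fin N → ℂ) (u₁ u₂ : ℂ) {n : ℕ} {p : Extended N}
    (hp : p.IsHomogeneous n) : (monodromy₂ ℓ δ u₁ u₂ p).IsHomogeneous n := by
  rw [monodromy₂_eq]
  generalize List.finRange N = l
  induction l with
  | nil => simpa using hp
  | cons k l ih =>
    simp only [List.map_cons, List.prod_cons, Module.End.mul_apply]
    exact siteOp_isHomogeneous _ _ _ _ ih

theorem degree_cons (m : ℕ) (s : Fin N →₀ ℕ) :
    (Finsupp.cons m s).degree = m + s.degree := by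
  rw [Finsupp.degree_eq_sum, Finsupp.degree_eq_sum, Fin.sum_univ_succ, Finsupp.cons_zero]
  simp only [Finsupp.cons_succ]

theorem block_coeff_degree {A : Module.End ℂ (Extended N)}
    (hA : ∀ n p, p.IsHomogeneous n → (A p).IsHomogeneous n) {m' m : ℕ} {s t : Fin N →₀ ℕ}
    (h : coeff s (block A m' m (monomial t 1)) ≠ 0) : m' + s.degree = m + t.degree := by
  rw [coeff_block, ← monomial_cons] at h
  have h1 := hA _ _ (isHomogeneous_monomial (1 : ℂ) (degree_cons m t))
  rw [← degree_cons]
  by_contra hne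
  exact h (h1.coeff_eq_zero hne)

/-- The monomials of the same degree. -/
def sameDegree (t : Fin N →₀ ℕ) : Finset (Fin N →₀ ℕ) :=
  Finset.finsuppAntidiag Finset.univ t.degree

theorem mem_sameDegree {s t : Fin N →₀ ℕ} : s ∈ sameDegree t ↔ s.degree = t.degree := by
  rw [sameDegree, Finset.mem_finsuppAntidiag, Finsupp.degree_eq_sum s]
  simp

/-- A diagonal block preserves the degree in the quantum variables, and there are finitely many
monomials of each degree. -/
theorem finiteRange_blocks {A : Module.End ℂ (Extended N)}
    (hA : ∀ n p, p.IsHomogeneous n → (A p).IsHomogeneous n) :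
    FiniteRange (PowerSeries.mk fun m => block A m m) := fun Ψ => by
  classical
  refine ⟨Ψ.support.biUnion sameDegree, fun m s hs => ?_⟩
  rw [PowerSeries.coeff_mk, mem_support_iff, apply_eq_sum subset_rfl, coeff_sum] at hs
  obtain ⟨t, ht, hne⟩ := Finset.exists_ne_zero_of_sum_ne_zero hs
  rw [coeff_smul] at hne
  have := block_coeff_degree hA (right_ne_zero_of_mul hne)
  exact Finset.mem_biUnion.2 ⟨t, ht, mem_sameDegree.2 (by omega)⟩

theorem finiteRange_qSeries (ℓ δ : Fin N → ℂ) (u₁ u₂ : ℂ) :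
    FiniteRange (qSeries ℓ δ u₁ u₂) :=
  finiteRange_blocks fun _ _ => monodromy_isHomogeneous ℓ δ u₁ u₂

/-- Degree conservation leaves finitely many nonzero coefficients in the limit on each monomial, so
the coefficientwise sum is a polynomial. -/
theorem exists_isAuxTrace {A : Module.End ℂ (Extended N)}
    (hA : ∀ n p, p.IsHomogeneous n → (A p).IsHomogeneous n)
    (hs : ∀ s t, Summable fun m => coeff s (block A m m (monomial t 1))) :
    ∃ T, IsAuxTrace A T := by
  let T : Op N := (basisMonomials (Fin N) ℂ).constr ℂ fun t =>
    ∑ s ∈ sameDegree t, monomial s (∑' m, coeff s (block A m m (monomial t 1)))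
  have hT : ∀ t, T (monomial t 1) =
      ∑ s ∈ sameDegree t, monomial s (∑' m, coeff s (block A m m (monomial t 1))) := by
    intro t
    have : (monomial t (1 : ℂ)) = basisMonomials (Fin N) ℂ t := by simp
    conv_lhs => rw [this]
    exact Module.Basis.constr_basis _ _ _ _
  have key : ∀ t s, HasSum (fun m => coeff s (block A m m (monomial t 1)))
      (coeff s (T (monomial t 1))) := by
    intro t s
    classical
    have e : coeff s (T (monomial t 1)) = ∑' m, coeff s (block A m m (monomial t 1)) := by
      rw [hT, coeff_sum]
      simp only [coeff_monomial, Finset.sum_ite_eq']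
      split_ifs with h
      · rfl
      · have : ∀ m, coeff s (block A m m (monomial t 1)) = 0 := by
          intro m
          by_contra hne
          have := block_coeff_degree hA hne
          exact h (mem_sameDegree.2 (by omega))
        simp [this]
    rw [e]
    exact (hs s t).hasSum
  clear_value T
  refine ⟨T, (isAuxTrace_iff A T).2 fun Ψ s => ?_⟩
  have e1 : (fun m => coeff s (block A m m Ψ)) = fun m => ∑ t ∈ Ψ.support,
      coeff t Ψ * coeff s (block A m m (monomial t 1)) := by
    funext m
    rw [apply_eq_sum subset_rfl (block A m m), coeff_sum]
    rfl
  have e2 : coeff s (T Ψ) = ∑ t ∈ Ψ.support, coeff t Ψ * coeff s (T (monomial t 1)) := by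
    rw [apply_eq_sum subset_rfl T, coeff_sum]
    rfl
  rw [e1, e2]
  exact hasSum_sum fun t _ => (key t s).mul_left (coeff t Ψ)

theorem isAuxTrace_auxTrace {A : Module.End ℂ (Extended N)} (h : ∃ T, IsAuxTrace A T) :
    IsAuxTrace A (auxTrace A) := by
  rw [auxTrace, dif_pos h]
  exact h.choose_spec

end Evaluation

/-! ### Asymptotics of Pochhammer ratios -/

section Growth

open Filter Asymptotics Topology

theorem rpow_le_of_comparable {u v c : ℝ} (hu : 0 < u) (hv : 0 < v) (hc : 0 < c) (h1 : u ≤ c * v)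
    (h2 : v ≤ c * u) (r : ℝ) : u ^ r ≤ c ^ |r| * v ^ r := by
  rcases le_total 0 r with hr | hr
  · rw [abs_of_nonneg hr, ← Real.mul_rpow hc.le hv.le]
    exact Real.rpow_le_rpow hu.le h1 hr
  · have h3 : v / c ≤ u := by rwa [div_le_iff₀ hc, mul_comm]
    have h4 := Real.rpow_le_rpow_of_nonpos (div_pos hv hc) h3 hr
    rwa [Real.div_rpow hv.le hc.le, div_eq_inv_mul, ← Real.rpow_neg hc.le,
      ← abs_of_nonpos hr] at h4

/-- A bounded shift of the degree costs only a constant factor, whatever the sign of the exponent.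
-/
theorem rpow_natCast_le {m n d e : ℕ} (h : m + d = n + e) (r : ℝ) :
    ((m : ℝ) + 1) ^ r ≤ ((d : ℝ) + e + 1) ^ |r| * ((n : ℝ) + 1) ^ r := by
  have h' : (m : ℝ) + d = n + e := by exact_mod_cast h
  have hd : (0 : ℝ) ≤ d := d.cast_nonneg
  have he : (0 : ℝ) ≤ e := e.cast_nonneg
  have hm : (0 : ℝ) ≤ m := m.cast_nonneg
  have hn : (0 : ℝ) ≤ n := n.cast_nonneg
  refine rpow_le_of_comparable (by positivity) (by positivity) (by positivity) ?_ ?_ r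
  · nlinarith [mul_nonneg hd hn, mul_nonneg he hn]
  · nlinarith [mul_nonneg hd hm, mul_nonneg he hm]

theorem ascPochhammer_eval_eq_prod (a : ℂ) (n : ℕ) :
    (ascPochhammer ℂ n).eval a = ∏ j ∈ Finset.range n, (a + j) := by
  induction n with
  | zero => simp
  | succ n ih => rw [ascPochhammer_succ_eval, ih, Finset.prod_range_succ]

/-- Up to the power `n^(x-y)`, the ratio at `n + 1` is a quotient of Euler's approximations, which
converges to `Γ(y) / Γ(x)`. -/
theorem isBigO_gammaRatio_of_generic {x y : ℂ} (hx : ∀ n : ℕ, x ≠ -(n : ℂ))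
    (hy : ∀ n : ℕ, y ≠ -(n : ℂ)) :
    gammaRatio x y =O[atTop] fun n : ℕ => ((n : ℝ) + 1) ^ (x - y).re := by
  have e : ∀ n : ℕ, 1 ≤ n → gammaRatio x y (n + 1) =
      (n : ℂ) ^ (x - y) * (Complex.GammaSeq y n / Complex.GammaSeq x n) := by
    intro n hn
    have hn0 : (n : ℂ) ≠ 0 := by exact_mod_cast (by omega : n ≠ 0)
    have h1 := ascPochhammer_eval_ne_zero hx (n + 1)
    have h2 := ascPochhammer_eval_ne_zero hy (n + 1)
    have h3 : (n : ℂ) ^ y ≠ 0 := by simp [Complex.cpow_eq_zero_iff, hn0]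
    have h4 : (n : ℂ) ^ x ≠ 0 := by simp [Complex.cpow_eq_zero_iff, hn0]
    have h5 : ((n.factorial : ℕ) : ℂ) ≠ 0 := by exact_mod_cast n.factorial_ne_zero
    rw [Complex.GammaSeq, Complex.GammaSeq, ← ascPochhammer_eval_eq_prod,
      ← ascPochhammer_eval_eq_prod, gammaRatio, Complex.cpow_sub _ _ hn0]
    field_simp
  have h1 : Tendsto (fun n => Complex.GammaSeq y n / Complex.GammaSeq x n) atTop
      (𝓝 (Complex.Gamma y / Complex.Gamma x)) :=
    (Complex.GammaSeq_tendsto_Gamma y).div (Complex.GammaSeq_tendsto_Gamma x)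
      (Complex.Gamma_ne_zero hx)
  have h2 : (fun n : ℕ => (n : ℂ) ^ (x - y)) =O[atTop]
      fun n : ℕ => (((n + 1 : ℕ) : ℝ) + 1) ^ (x - y).re := by
    -- The constant comes from `n + 2 ≤ 4 n` for `n ≥ 1`.
    refine IsBigO.of_bound (4 ^ |(x - y).re|) ?_
    filter_upwards [eventually_ge_atTop 1] with n hn
    have hn' : (1 : ℝ) ≤ n := by exact_mod_cast hn
    rw [Complex.norm_natCast_cpow_of_pos (by omega), Real.norm_of_nonneg (by positivity)]
    push_cast
    exact rpow_le_of_comparable (by positivity) (by positivity) (by norm_num) (by linarith)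
      (by linarith) _
  have h3 : (fun n => gammaRatio x y (n + 1)) =O[atTop]
      fun n : ℕ => (((n + 1 : ℕ) : ℝ) + 1) ^ (x - y).re := by
    have := h2.mul (h1.isBigO_one ℝ)
    simp only [mul_one] at this
    refine this.congr' ?_ EventuallyEq.rfl
    filter_upwards [eventually_ge_atTop 1] with n hn
    rw [e n hn]
  have h4 : gammaRatio x y =O[map (fun n => n + 1) atTop]
      fun n : ℕ => ((n : ℝ) + 1) ^ (x - y).re := isBigO_map.2 h3
  rwa [map_add_atTop_eq_nat] at h4

theorem gammaRatio_neg_eventually (m : ℕ) (y : ℂ) :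
    gammaRatio (-(m : ℂ)) y =ᶠ[atTop] 0 := by
  filter_upwards [eventually_gt_atTop m] with n hn
  rw [gammaRatio, ascPochhammer_eval_eq_prod, Finset.prod_eq_zero (Finset.mem_range.2 hn) (by simp),
    zero_div, Pi.zero_apply]

theorem isBigO_gammaRatio (x : ℂ) {y : ℂ} (hy : ∀ n : ℕ, y ≠ -(n : ℂ)) :
    gammaRatio x y =O[atTop] fun n : ℕ => ((n : ℝ) + 1) ^ (x - y).re := by
  by_cases hx : ∀ n : ℕ, x ≠ -(n : ℂ)
  · exact isBigO_gammaRatio_of_generic hx hy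
  · push Not at hx
    obtain ⟨m, rfl⟩ := hx
    exact (gammaRatio_neg_eventually m y).trans_isBigO (isBigO_zero _ _)

/-- The coefficient of `z_i^r z_j^n` in `(a)_D / (b)_D z_i^{r+n}`, where `D = z_{ij} ∂_i`. -/
def weight (a b : ℂ) (r n : ℕ) : ℂ :=
  (ascPochhammer ℂ r).eval a * (ascPochhammer ℂ n).eval (b - a) /
    (ascPochhammer ℂ (r + n)).eval b * ((r + n).choose r : ℂ)

theorem ascPochhammer_eval_add (b : ℂ) (r n : ℕ) :
    (ascPochhammer ℂ (r + n)).eval b =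
      (ascPochhammer ℂ r).eval b * (ascPochhammer ℂ n).eval (b + r) := by
  rw [← ascPochhammer_mul]
  simp

theorem choose_eq_gammaRatio (r n : ℕ) :
    ((r + n).choose r : ℂ) = gammaRatio ((r : ℂ) + 1) 1 n := by
  have h1 := congrArg (Nat.cast (R := ℂ)) (Nat.ascFactorial_eq_factorial_mul_choose r n)
  rw [← ascPochhammer_nat_eq_ascFactorial, ascPochhammer_eval_cast] at h1
  have h2 : (n.factorial : ℂ) ≠ 0 := by exact_mod_cast n.factorial_ne_zero
  rw [gammaRatio, ascPochhammer_eval_one, eq_div_iff h2, Nat.choose_symm_add]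
  push_cast at h1
  rw [h1, mul_comm]

theorem weight_eq (a b : ℂ) (r n : ℕ) :
    weight a b r n = gammaRatio a b r *
      (gammaRatio ((r : ℂ) + 1) 1 n * gammaRatio (b - a) (b + r) n) := by
  rw [weight, choose_eq_gammaRatio, ascPochhammer_eval_add, mul_div_mul_comm]
  rw [← gammaRatio, ← gammaRatio]
  ring

/-- The binomial coefficient grows like `n^r` and the Pochhammer ratio is bounded by a multiple of
`n^(-a-r)` in absolute value, with `a` replaced by its real part. -/
theorem isBigO_weight (a : ℂ) {b : ℂ} (hb : ∀ n : ℕ, b ≠ -(n : ℂ)) (r : ℕ) :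
    weight a b r =O[atTop] fun n : ℕ => ((n : ℝ) + 1) ^ (-a.re) := by
  have h0 : ∀ n : ℕ, (1 : ℂ) ≠ -(n : ℂ) := by
    intro n h
    have : ((n + 1 : ℕ) : ℂ) = 0 := by push_cast; linear_combination h
    exact absurd this (by exact_mod_cast n.succ_ne_zero)
  have h1 := isBigO_gammaRatio ((r : ℂ) + 1) h0
  have h2 := isBigO_gammaRatio (b - a) (y := b + r) fun n h =>
    hb (r + n) (by push_cast; linear_combination h)
  have h3 := (h1.mul h2).const_mul_left (gammaRatio a b r)
  refine (h3.congr_left fun n => (weight_eq a b r n).symm).congr_right fun n => ?_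
  rw [← Real.rpow_add (by positivity)]
  congr 1
  simp only [Complex.sub_re, Complex.add_re, Complex.natCast_re, Complex.one_re]
  ring

/-- If `b - a` is a nonpositive integer the weight vanishes for large `n`, so any exponent `q` is
allowed. This serves the second alternative in `Admissible`. -/
theorem isBigO_weight_of_terminating (a : ℂ) {b : ℂ} {m : ℕ} (h : b - a = -(m : ℂ)) (r : ℕ)
    (q : ℝ) : weight a b r =O[atTop] fun n : ℕ => ((n : ℝ) + 1) ^ q := by
  refine EventuallyEq.trans_isBigO (f₂ := 0) ?_ (isBigO_zero _ _)
  filter_upwards [gammaRatio_neg_eventually m (b + r)] with n hn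
  rw [weight_eq, h, hn]
  simp

theorem exists_bound_of_isBigO {f : ℕ → ℂ} {q : ℝ}
    (h : f =O[atTop] fun n : ℕ => ((n : ℝ) + 1) ^ q) :
    ∃ C, 0 ≤ C ∧ ∀ n : ℕ, ‖f n‖ ≤ C * ((n : ℝ) + 1) ^ q := by
  obtain ⟨C, hC, hb⟩ := bound_of_isBigO_nat_atTop h
  refine ⟨C, hC.le, fun n => ?_⟩
  have h1 : (0 : ℝ) < ((n : ℝ) + 1) ^ q := by positivity
  have := hb (x := n) h1.ne'
  rwa [Real.norm_of_nonneg h1.le] at this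

theorem summable_of_bound {f : ℕ → ℂ} {q C : ℝ} (hq : q < -1)
    (h : ∀ n : ℕ, ‖f n‖ ≤ C * ((n : ℝ) + 1) ^ q) : Summable f := by
  have h1 := (summable_nat_add_iff 1).2 (Real.summable_nat_rpow.2 hq)
  refine Summable.of_norm_bounded (h1.mul_left C) fun n => ?_
  push_cast
  exact h n

end Growth

/-! ### Expansion of a Gamma ratio of `z_{ij} ∂_i` on powers -/

section Expansion

set_option linter.unusedSectionVars false

variable {σ : Type} [DecidableEq σ]

theorem diffFun_X_pow_succ {i j : σ} (hij : i ≠ j) (f : ℕ → ℂ) (M : ℕ) :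
    diffFun i j f (X i ^ (M + 1)) =
      X i * diffFun i j (fun n => f (n + 1)) (X i ^ M) +
        X j * diffFun i j (fun n => f n - f (n + 1)) (X i ^ M) := by
  have h1 := DFunLike.congr_fun (mulZ_sub_mul_diffFun hij f) (X i ^ M)
  have h2 : diffFun i j (fun n => f n - f (n + 1)) =
      diffFun i j f - diffFun i j fun n => f (n + 1) := diffFun_sub hij f fun n => f (n + 1)
  have h3 := DFunLike.congr_fun (commute_mulZ_diffFun hij hij.symm f).eq (X i ^ M)
  simp only [Module.End.mul_apply, mulZ, LinearMap.sub_apply, LinearMap.mulLeft_apply,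
    map_sub] at h1 h3
  rw [h2, LinearMap.sub_apply, pow_succ']
  linear_combination -h3 - h1

theorem gammaRatio_shift (a b : ℂ) (n : ℕ) (hb : ∀ n : ℕ, b ≠ -(n : ℂ)) :
    gammaRatio a b (n + 1) = a / b * gammaRatio (a + 1) (b + 1) n := by
  have h0 : b ≠ 0 := by simpa using hb 0
  have h1 := gammaRatio_add_one_left a (b + 1) n
  have h2 := gammaRatio_add_one_right a hb n
  have h3 := add_natCast_ne_zero hb n
  rw [gammaRatio_succ]
  field_simp
  linear_combination (-(a + n)) * h2 + (b + n) * h1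

theorem gammaRatio_sub_shift (a b : ℂ) (n : ℕ) (hb : ∀ n : ℕ, b ≠ -(n : ℂ)) :
    gammaRatio a b n - gammaRatio a b (n + 1) = (b - a) / b * gammaRatio a (b + 1) n := by
  have h0 : b ≠ 0 := by simpa using hb 0
  have h2 := gammaRatio_add_one_right a hb n
  have h3 := add_natCast_ne_zero hb n
  rw [gammaRatio_succ]
  field_simp
  linear_combination (a - b) * h2

/-- Splitting one factor as `z_i = (z_i - z_j) + z_j` gives a term `z_i` with parameters `(a+1,
b+1)` and a term `z_j` with `(a, b+1)`; Pascal's rule then matches the coefficients. -/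
theorem diffFun_gammaRatio_X_pow {i j : σ} (hij : i ≠ j) (a : ℂ) {b : ℂ}
    (hb : ∀ n : ℕ, b ≠ -(n : ℂ)) (M : ℕ) :
    diffFun i j (gammaRatio a b) (X i ^ M) =
      ∑ p ∈ Finset.HasAntidiagonal.antidiagonal M, weight a b p.1 p.2 • (X i ^ p.1 * X j ^ p.2) := by
  have key : diffFun i j (gammaRatio a b) (X i ^ M) =
      ∑ p ∈ Finset.HasAntidiagonal.antidiagonal M, M.choose p.1 •
        (((ascPochhammer ℂ p.1).eval a * (ascPochhammer ℂ p.2).eval (b - a) /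
          (ascPochhammer ℂ M).eval b) • (X i ^ p.1 * X j ^ p.2 : MvPolynomial σ ℂ)) := by
    induction M generalizing a b with
    | zero =>
      have := diffFun_apply hij (gammaRatio a b) 0 (g := 1) (by simp)
      simpa [gammaRatio_zero] using this
    | succ M ih =>
      have hb1 : ∀ n : ℕ, b + 1 ≠ -(n : ℂ) := fun n h =>
        hb (n + 1) (by push_cast; linear_combination h)
      have h0 : b ≠ 0 := by simpa using hb 0
      have e1 : (fun n => gammaRatio a b (n + 1)) = (a / b) • gammaRatio (a + 1) (b + 1) :=
        funext fun n => gammaRatio_shift a b n hb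
      have e2 : (fun n => gammaRatio a b n - gammaRatio a b (n + 1)) =
          ((b - a) / b) • gammaRatio a (b + 1) :=
        funext fun n => gammaRatio_sub_shift a b n hb
      rw [diffFun_X_pow_succ hij, e1, e2, diffFun_smul hij, diffFun_smul hij,
        LinearMap.smul_apply, LinearMap.smul_apply, ih _ hb1, ih _ hb1]
      rw [Finset.sum_antidiagonal_choose_succ_nsmul (fun r n =>
        ((ascPochhammer ℂ r).eval a * (ascPochhammer ℂ n).eval (b - a) /
          (ascPochhammer ℂ (M + 1)).eval b) • (X i ^ r * X j ^ n : MvPolynomial σ ℂ)) M, add_comm]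
      have hP : (ascPochhammer ℂ (M + 1)).eval b = b * (ascPochhammer ℂ M).eval (b + 1) := by
        have := ascPochhammer_eval_add b 1 M
        rw [add_comm 1 M] at this
        simpa using this
      congr 1
      · rw [Finset.smul_sum, Finset.mul_sum]
        refine Finset.sum_congr rfl fun p _ => ?_
        have e3 : (ascPochhammer ℂ (p.2 + 1)).eval (b - a) =
            (b - a) * (ascPochhammer ℂ p.2).eval (b + 1 - a) := by
          have := ascPochhammer_eval_add (b - a) 1 p.2
          rw [add_comm 1 p.2] at this
          rw [this]
          simp [sub_add_eq_add_sub]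
        rw [e3, hP, smul_comm _ (M.choose p.1), mul_smul_comm (M.choose p.1), smul_smul,
          mul_smul_comm]
        congr 2
        · rw [div_mul_div_comm]
          congr 1
          ring
        · ring
      · rw [Finset.smul_sum, Finset.mul_sum]
        refine Finset.sum_congr rfl fun p hp => ?_
        have e3 : (ascPochhammer ℂ (p.1 + 1)).eval a =
            a * (ascPochhammer ℂ p.1).eval (a + 1) := by
          have := ascPochhammer_eval_add a 1 p.1
          rw [add_comm 1 p.1] at this
          rw [this]
          simp
        have e4 : M.choose p.2 = M.choose p.1 :=
          (Nat.choose_symm_of_eq_add (Finset.HasAntidiagonal.mem_antidiagonal.1 hp).symm).symm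
        rw [e3, e4, hP, smul_comm _ (M.choose p.1), mul_smul_comm (M.choose p.1), smul_smul,
          mul_smul_comm]
        congr 2
        · rw [div_mul_div_comm, add_sub_add_right_eq_sub]
          congr 1
          ring
        · ring
  rw [key]
  refine Finset.sum_congr rfl fun p hp => ?_
  rw [weight, Finset.HasAntidiagonal.mem_antidiagonal.1 hp, ← smul_assoc, nsmul_eq_mul,
    mul_comm (Nat.cast _)]

end Expansion

/-! ### Matrix elements of the R-matrix of one site -/

section SiteExpansion

set_option linter.unusedSectionVars false

variable {σ : Type} [DecidableEq σ]

theorem pderiv_X_pow_mul_eq_zero {i j : σ} (hij : i ≠ j) (n : ℕ) {g : MvPolynomial σ ℂ}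
    (hg : pderiv i g = 0) : pderiv i (X j ^ n * g) = 0 := by
  rw [pderiv_mul, hg, pderiv_pow, pderiv_X_of_ne hij.symm]
  simp

/-- The index `p` records how the right factor splits `z_i^s`, and `r` how the middle factor then
splits `z_j^(m + p.2)`, before the two variables are exchanged. -/
theorem siteOp_X_pow_mul {i j : σ} (hij : i ≠ j) (a c : ℂ) {b d : ℂ} (hb : ∀ n : ℕ, b ≠ -(n : ℂ))
    (hd : ∀ n : ℕ, d ≠ -(n : ℂ)) (s m : ℕ) {g : MvPolynomial σ ℂ} (hi : pderiv i g = 0)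
    (hj : pderiv j g = 0) (hg : rename (Equiv.swap i j) g = g) :
    siteOp i j (gammaRatio a b) (gammaRatio c d) (X i ^ s * (X j ^ m * g)) =
      ∑ p ∈ Finset.HasAntidiagonal.antidiagonal s,
        ∑ r ∈ Finset.HasAntidiagonal.antidiagonal (m + p.2),
          (weight c d p.1 p.2 * weight a b r.1 r.2) • (X i ^ r.1 * (X j ^ (r.2 + p.1) * g)) := by
  have h1 := pderiv_X_pow_mul_eq_zero hij m hi
  rw [siteOp, Module.End.mul_apply, Module.End.mul_apply, mul_comm (X i ^ s),
    diffFun_mul_of_pderiv_eq_zero hij _ h1, diffFun_gammaRatio_X_pow hij _ hd, Finset.mul_sum,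
    map_sum, map_sum]
  refine Finset.sum_congr rfl fun p _ => ?_
  have h2 := pderiv_X_pow_mul_eq_zero hij.symm p.1 hj
  have e : X j ^ m * g * weight c d p.1 p.2 • (X i ^ p.1 * X j ^ p.2) =
      weight c d p.1 p.2 • ((X i ^ p.1 * g) * X j ^ (m + p.2)) := by
    rw [mul_smul_comm]
    congr 1
    ring
  rw [e, map_smul, map_smul, diffFun_mul_of_pderiv_eq_zero hij.symm _ h2,
    diffFun_gammaRatio_X_pow hij.symm _ hb, Finset.mul_sum, map_sum, Finset.smul_sum]
  refine Finset.sum_congr rfl fun r _ => ?_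
  rw [mul_smul_comm, map_smul, smul_smul]
  congr 1
  simp only [perm, AlgHom.toLinearMap_apply, map_mul, map_pow, rename_X, hg,
    Equiv.swap_apply_left, Equiv.swap_apply_right]
  ring

theorem rename_swap_monomial {i j : σ} {t : σ →₀ ℕ} (hi : t i = 0) (hj : t j = 0) :
    rename (Equiv.swap i j) (monomial t (1 : ℂ)) = monomial t 1 := by
  have : Finsupp.mapDomain (Equiv.swap i j) t = t := by
    ext k
    rw [Finsupp.mapDomain_equiv_apply, Equiv.symm_swap]
    by_cases h1 : k = i
    · rw [h1, Equiv.swap_apply_left, hi, hj]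
    by_cases h2 : k = j
    · rw [h2, Equiv.swap_apply_right, hi, hj]
    rw [Equiv.swap_apply_of_ne_of_ne h1 h2]
  rw [rename_monomial, this]

theorem coeff_siteOp_monomial {i j : σ} (hij : i ≠ j) (a c : ℂ) {b d : ℂ}
    (hb : ∀ n : ℕ, b ≠ -(n : ℂ)) (hd : ∀ n : ℕ, d ≠ -(n : ℂ)) (t t' : σ →₀ ℕ) :
    coeff t' (siteOp i j (gammaRatio a b) (gammaRatio c d) (monomial t 1)) =
      ∑ p ∈ Finset.HasAntidiagonal.antidiagonal (t i),
        ∑ r ∈ Finset.HasAntidiagonal.antidiagonal (t j + p.2),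
          weight c d p.1 p.2 * weight a b r.1 r.2 *
            if Finsupp.single i r.1 + (Finsupp.single j (r.2 + p.1) + (t.erase i).erase j) = t'
              then 1 else 0 := by
  have e : monomial t (1 : ℂ) = X i ^ t i * (X j ^ t j * monomial ((t.erase i).erase j) 1) := by
    have := monomial_eq_X_pow_mul j (t.erase i)
    rw [Finsupp.erase_ne hij.symm] at this
    rw [← this, ← monomial_eq_X_pow_mul]
  have hi : (t.erase i).erase j i = 0 := by rw [Finsupp.erase_ne hij, Finsupp.erase_same]
  have hj : (t.erase i).erase j j = 0 := Finsupp.erase_same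
  rw [e, siteOp_X_pow_mul hij a c hb hd _ _ (pderiv_monomial_eq_zero hi)
    (pderiv_monomial_eq_zero hj) (rename_swap_monomial hi hj), coeff_sum]
  refine Finset.sum_congr rfl fun p _ => ?_
  rw [coeff_sum]
  refine Finset.sum_congr rfl fun r _ => ?_
  rw [coeff_smul, smul_eq_mul, X_pow_eq_monomial, X_pow_eq_monomial, monomial_mul, monomial_mul,
    coeff_monomial, one_mul, one_mul]

theorem siteOp_coeff_ne_zero {i j k : σ} (hij : i ≠ j) (hi : k ≠ i) (hj : k ≠ j) (a c : ℂ)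
    {b d : ℂ} (hb : ∀ n : ℕ, b ≠ -(n : ℂ)) (hd : ∀ n : ℕ, d ≠ -(n : ℂ)) {t t' : σ →₀ ℕ}
    (h : coeff t' (siteOp i j (gammaRatio a b) (gammaRatio c d) (monomial t 1)) ≠ 0) :
    t' k = t k := by
  rw [coeff_siteOp_monomial hij a c hb hd] at h
  obtain ⟨p, _, h⟩ := Finset.exists_ne_zero_of_sum_ne_zero h
  obtain ⟨r, _, h⟩ := Finset.exists_ne_zero_of_sum_ne_zero h
  have h2 := right_ne_zero_of_mul h
  split_ifs at h2 with h3
  · rw [← h3]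
    simp [Finsupp.erase_ne hi, Finsupp.erase_ne hj, Finsupp.single_eq_of_ne hi,
      Finsupp.single_eq_of_ne hj]
  · exact absurd rfl h2

theorem sum_antidiagonal_le {w : ℕ → ℕ → ℂ} {r : ℕ} {C q : ℝ} (hC : 0 ≤ C)
    (h : ∀ n : ℕ, ‖w r n‖ ≤ C * ((n : ℝ) + 1) ^ q) (M : ℕ) :
    ∑ p ∈ Finset.HasAntidiagonal.antidiagonal M, (if p.1 = r then ‖w p.1 p.2‖ else 0) ≤
      C * ((r : ℝ) + 1) ^ |q| * ((M : ℝ) + 1) ^ q := by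
  by_cases hr : r ≤ M
  · rw [Finset.sum_eq_single (r, M - r)]
    · rw [if_pos rfl, mul_assoc]
      refine (h _).trans (mul_le_mul_of_nonneg_left ?_ hC)
      have := rpow_natCast_le (m := M - r) (n := M) (d := r) (e := 0) (by omega) q
      simpa using this
    · rintro ⟨x, y⟩ hp hne
      rw [if_neg]
      rintro rfl
      apply hne
      have := Finset.HasAntidiagonal.mem_antidiagonal.1 hp
      simp only at this
      rw [← this]
      simp
    · intro hn
      exact absurd (Finset.HasAntidiagonal.mem_antidiagonal.2 (by simp; omega)) hn
  · rw [Finset.sum_eq_zero]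
    · positivity
    · intro p hp
      have := Finset.HasAntidiagonal.mem_antidiagonal.1 hp
      rw [if_neg (by omega)]

/-- The outgoing degree `s'` at the site fixes `r.1`. For each of the finitely many `p` at most one
term remains, with a weight whose index differs from the auxiliary degree by a bounded amount. -/
theorem siteOp_coeff_bound {i j : σ} (hij : i ≠ j) (a c : ℂ) {b d : ℂ}
    (hb : ∀ n : ℕ, b ≠ -(n : ℂ)) (hd : ∀ n : ℕ, d ≠ -(n : ℂ)) {q : ℝ}
    (hq : ∀ r, ∃ C, 0 ≤ C ∧ ∀ n : ℕ, ‖weight a b r n‖ ≤ C * ((n : ℝ) + 1) ^ q) (s s' : ℕ) :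
    ∃ C, 0 ≤ C ∧ ∀ t t' : σ →₀ ℕ, t i = s → t' i = s' →
      ‖coeff t' (siteOp i j (gammaRatio a b) (gammaRatio c d) (monomial t 1))‖ ≤
        C * ((t j : ℝ) + 1) ^ q := by
  obtain ⟨C, hC, hw⟩ := hq s'
  refine ⟨∑ p ∈ Finset.HasAntidiagonal.antidiagonal s, ‖weight c d p.1 p.2‖ *
    (C * ((s' : ℝ) + 1) ^ |q| * ((p.2 : ℝ) + 1) ^ |q|), by positivity, fun t t' ht ht' => ?_⟩
  rw [coeff_siteOp_monomial hij a c hb hd, ht, Finset.sum_mul]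
  refine (norm_sum_le _ _).trans (Finset.sum_le_sum fun p _ => ?_)
  have h1 := rpow_natCast_le (m := t j + p.2) (n := t j) (d := 0) (e := p.2) (by omega) q
  have h2 := sum_antidiagonal_le hC hw (t j + p.2)
  have h3 : ∑ r ∈ Finset.HasAntidiagonal.antidiagonal (t j + p.2),
      ‖weight c d p.1 p.2 * weight a b r.1 r.2 *
        if Finsupp.single i r.1 + (Finsupp.single j (r.2 + p.1) + (t.erase i).erase j) = t'
          then 1 else 0‖ ≤
      ‖weight c d p.1 p.2‖ * ∑ r ∈ Finset.HasAntidiagonal.antidiagonal (t j + p.2),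
        (if r.1 = s' then ‖weight a b r.1 r.2‖ else 0) := by
    rw [Finset.mul_sum]
    refine Finset.sum_le_sum fun r _ => ?_
    rw [norm_mul, norm_mul, mul_assoc]
    refine mul_le_mul_of_nonneg_left ?_ (norm_nonneg _)
    by_cases he : Finsupp.single i r.1 +
        (Finsupp.single j (r.2 + p.1) + (t.erase i).erase j) = t'
    · have : r.1 = s' := by
        rw [← ht', ← he]
        simp [Finsupp.erase_ne hij, Finsupp.single_eq_of_ne hij]
      rw [if_pos he, if_pos this]
      simp
    · rw [if_neg he]
      simp only [norm_zero, mul_zero]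
      split_ifs <;> positivity
  refine (norm_sum_le _ _).trans (h3.trans ?_)
  rw [mul_assoc]
  refine mul_le_mul_of_nonneg_left (h2.trans ?_) (norm_nonneg _)
  rw [mul_assoc (C * ((s' : ℝ) + 1) ^ |q|)]
  refine mul_le_mul_of_nonneg_left ?_ (by positivity)
  simpa using h1

end SiteExpansion

/-! ### Decay of the monodromy and existence of the trace -/

section Decay

variable {N : ℕ}

/-- The matrix elements of `A`, which acts on the auxiliary space and on the sites in `K`, decay
at least as fast as `m ^ q`, where `m` is the degree in the auxiliary variable. -/
structure Decays (A : Module.End ℂ (Extended N)) (K : List (Fin N)) (q : ℝ) : Prop where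
  homogeneous : ∀ n p, p.IsHomogeneous n → (A p).IsHomogeneous n
  apply_eq : ∀ t t' : Fin (N + 1) →₀ ℕ, coeff t' (A (monomial t 1)) ≠ 0 →
    ∀ j ∉ K, t' j.succ = t j.succ
  bound : ∀ s s' : Fin N →₀ ℕ, ∃ C, 0 ≤ C ∧ ∀ m m' : ℕ,
    ‖coeff (Finsupp.cons m' s') (A (monomial (Finsupp.cons m s) 1))‖ ≤ C * ((m : ℝ) + 1) ^ q

theorem decays_one : Decays (1 : Module.End ℂ (Extended N)) [] 0 where
  homogeneous := fun _ _ h => h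
  apply_eq := fun t t' h j _ => by
    classical
    rw [Module.End.one_apply, coeff_monomial] at h
    split_ifs at h with h1
    · rw [h1]
    · exact absurd rfl h
  bound := fun s s' => ⟨1, zero_le_one, fun m m' => by
    classical
    rw [Module.End.one_apply, coeff_monomial]
    split_ifs <;> simp⟩

theorem decays_site {ℓ δ : Fin N → ℂ} (hℓ : GenericSpins ℓ) {u₁ : ℂ} (hu : PoleFree ℓ δ u₁)
    (u₂ : ℂ) (k : Fin N) {q : ℝ} (hq : ∀ r, ∃ C, 0 ≤ C ∧ ∀ n : ℕ,
      ‖weight (2 * ℓ k) (ℓ k + 1 - u₁ - δ k) r n‖ ≤ C * ((n : ℝ) + 1) ^ q) :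
    Decays (site ℓ δ u₁ u₂ k) [k] q where
  homogeneous := fun _ _ => siteOp_isHomogeneous _ _ _ _
  apply_eq := fun t t' h j hj => by
    have hj' : j ≠ k := by simpa using hj
    exact siteOp_coeff_ne_zero (Fin.succ_ne_zero k) (fun h => hj' (Fin.succ_injective _ h))
      (Fin.succ_ne_zero j) _ _ (hu k) (hℓ k) h
  bound := fun s s' => by
    obtain ⟨C, hC, h⟩ := siteOp_coeff_bound (Fin.succ_ne_zero k) (2 * ℓ k) (u₂ + δ k + ℓ k)
      (hu k) (hℓ k) hq (s k) (s' k)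
    refine ⟨C, hC, fun m m' => ?_⟩
    have := h (Finsupp.cons m s) (Finsupp.cons m' s') (Finsupp.cons_succ _ _ _)
      (Finsupp.cons_succ _ _ _)
    rwa [Finsupp.cons_zero] at this

theorem norm_sum_le_of_eq_zero {ι : Type*} (S : Finset ι) (f : ι → ℂ) (x : ι)
    (h : ∀ t ∈ S, t ≠ x → f t = 0) : ‖∑ t ∈ S, f t‖ ≤ ‖f x‖ := by
  by_cases hx : x ∈ S
  · rw [Finset.sum_eq_single x h fun hn => absurd hx hn]
  · rw [Finset.sum_eq_zero fun t ht => h t ht fun e => hx (e ▸ ht), norm_zero]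
    exact norm_nonneg _

theorem coeff_mul_apply (A B : Module.End ℂ (Extended N)) (t t' : Fin (N + 1) →₀ ℕ) :
    coeff t' ((A * B) (monomial t 1)) = ∑ x ∈ (B (monomial t 1)).support,
      coeff x (B (monomial t 1)) * coeff t' (A (monomial x 1)) := by
  obtain ⟨p, hp⟩ : ∃ p, p = B (monomial t 1) := ⟨_, rfl⟩
  rw [Module.End.mul_apply, ← hp]
  conv_lhs => rw [← support_sum_monomial_coeff p]
  rw [map_sum, coeff_sum]
  refine Finset.sum_congr rfl fun x _ => ?_
  have : monomial x (coeff x p) = coeff x p • monomial x (1 : ℂ) := by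
    rw [smul_monomial, smul_eq_mul, mul_one]
  rw [this, map_smul, coeff_smul, smul_eq_mul]

theorem Decays.coeff_eq_zero {A : Module.End ℂ (Extended N)} {K : List (Fin N)} {q : ℝ}
    (h : Decays A K q) {t t' : Fin (N + 1) →₀ ℕ} (hne : t'.degree ≠ t.degree) :
    coeff t' (A (monomial t 1)) = 0 :=
  (h.homogeneous _ _ (isHomogeneous_monomial (1 : ℂ) rfl)).coeff_eq_zero hne

/-- Only one intermediate monomial contributes: `B` does not touch site `k`, `A` touches no other
site, and the auxiliary degree is then fixed by the total degree. Hence bounds multiply and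
exponents add. -/
theorem Decays.mul {A B : Module.End ℂ (Extended N)} {k : Fin N} {K : List (Fin N)} {q q' : ℝ}
    (hA : Decays A [k] q) (hB : Decays B K q') (hk : k ∉ K) : Decays (A * B) (k :: K) (q + q') where
  homogeneous := fun n p hp => hA.homogeneous n _ (hB.homogeneous n p hp)
  apply_eq := fun t t' h j hj => by
    rw [coeff_mul_apply] at h
    obtain ⟨x, _, hx⟩ := Finset.exists_ne_zero_of_sum_ne_zero h
    rw [List.mem_cons, not_or] at hj
    rw [hA.apply_eq x t' (right_ne_zero_of_mul hx) j (by simpa using hj.1),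
      hB.apply_eq t x (left_ne_zero_of_mul hx) j hj.2]
  bound := fun s s' => by
    -- The quantum part of the intermediate monomial: initial at site `k`, already final elsewhere.
    obtain ⟨y, hy⟩ : ∃ y : Fin N →₀ ℕ, y = s'.update k (s k) := ⟨_, rfl⟩
    obtain ⟨CA, hCA, bA⟩ := hA.bound y s'
    obtain ⟨CB, hCB, bB⟩ := hB.bound s y
    refine ⟨CB * (CA * ((y.degree : ℝ) + s.degree + 1) ^ |q|), by positivity, fun m m' => ?_⟩
    rw [coeff_mul_apply]
    refine (norm_sum_le_of_eq_zero _ _ (Finsupp.cons (m + s.degree - y.degree) y) ?_).trans ?_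
    · intro x _ hx
      by_contra hne
      have h1 := hA.apply_eq x _ (right_ne_zero_of_mul hne)
      have h2 := hB.apply_eq _ x (left_ne_zero_of_mul hne) k hk
      have h3 : x.degree = (Finsupp.cons m s).degree := by
        by_contra hd
        exact left_ne_zero_of_mul hne (hB.coeff_eq_zero hd)
      have h4 : Finsupp.tail x = y := by
        ext j
        rw [hy, Finsupp.tail_apply]
        by_cases hj : j = k
        · rw [hj, h2, Finsupp.cons_succ]
          simp
        · rw [← h1 j (by simpa using hj), Finsupp.cons_succ]
          simp [hj]
      rw [← Finsupp.cons_tail x, degree_cons, degree_cons, h4] at h3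
      apply hx
      rw [← Finsupp.cons_tail x, h4, ← h3]
      simp
    -- If the subtraction in the auxiliary degree truncates, degree conservation makes the matrix
    -- element of `B` zero.
    · by_cases hd : y.degree ≤ m + s.degree
      · rw [norm_mul]
        have h1 := bB m (m + s.degree - y.degree)
        have h2 := bA (m + s.degree - y.degree) m'
        have h3 := rpow_natCast_le (m := m + s.degree - y.degree) (n := m) (d := y.degree)
          (e := s.degree) (by omega) q
        refine (mul_le_mul h1 (h2.trans (mul_le_mul_of_nonneg_left h3 hCA)) (norm_nonneg _)
          (by positivity)).trans (le_of_eq ?_)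
        rw [Real.rpow_add (by positivity)]
        ring
      · rw [hB.coeff_eq_zero, zero_mul, norm_zero]
        · positivity
        · rw [degree_cons, degree_cons]
          omega

theorem decays_prod {S : Fin N → Module.End ℂ (Extended N)} {q : Fin N → ℝ}
    (h : ∀ k, Decays (S k) [k] (q k)) :
    ∀ K : List (Fin N), K.Nodup → Decays (K.map S).prod K (K.map q).sum
  | [], _ => by simpa using decays_one
  | k :: K, hK => by
    rw [List.map_cons, List.prod_cons, List.map_cons, List.sum_cons]
    rw [List.nodup_cons] at hK
    exact (h k).mul (decays_prod h K hK.2) hK.1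

theorem decays_monodromy {ℓ δ : Fin N → ℂ} (hℓ : GenericSpins ℓ) {u₁ : ℂ}
    (hu : Admissible ℓ δ u₁) (u₂ : ℂ) :
    ∃ q < -1, Decays (monodromy₂ ℓ δ u₁ u₂) (List.finRange N) q := by
  have hp : PoleFree ℓ δ u₁ := hu.1
  have key : ∀ q : Fin N → ℝ, (∀ k r, ∃ C, 0 ≤ C ∧ ∀ n : ℕ,
      ‖weight (2 * ℓ k) (ℓ k + 1 - u₁ - δ k) r n‖ ≤ C * ((n : ℝ) + 1) ^ q k) → ∑ k, q k < -1 →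
      ∃ q < -1, Decays (monodromy₂ ℓ δ u₁ u₂) (List.finRange N) q := by
    intro q hq hs
    refine ⟨_, hs, ?_⟩
    have := decays_prod (fun k => decays_site hℓ hp u₂ k (hq k)) _ (List.nodup_finRange N)
    rwa [← monodromy₂_eq, ← List.ofFn_eq_map, List.sum_ofFn] at this
  have hgen : ∀ k r, ∃ C, 0 ≤ C ∧ ∀ n : ℕ,
      ‖weight (2 * ℓ k) (ℓ k + 1 - u₁ - δ k) r n‖ ≤ C * ((n : ℝ) + 1) ^ (-(2 * ℓ k).re) :=
    fun k r => exists_bound_of_isBigO (isBigO_weight _ (hp k) r)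
  rcases hu.2 with h | ⟨k, n, hk⟩
  · refine key _ hgen ?_
    rw [Finset.sum_neg_distrib, ← Complex.re_sum]
    linarith
  · obtain ⟨c, hc⟩ : ∃ c, c = ∑ j ∈ Finset.univ.erase k, -(2 * ℓ j).re := ⟨_, rfl⟩
    -- At a terminating site the exponent is free; this choice makes the total equal to `-2`.
    refine key (fun j => if j = k then -2 - c else -(2 * ℓ j).re) (fun j r => ?_) ?_
    · by_cases hj : j = k
      · subst hj
        simp only [if_true]
        exact exists_bound_of_isBigO (isBigO_weight_of_terminating (m := n) _
          (by linear_combination -hk) r _)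
      · simp only [if_neg hj]
        exact hgen j r
    · rw [← Finset.add_sum_erase _ _ (Finset.mem_univ k), if_pos rfl,
        Finset.sum_congr rfl fun j hj => if_neg (Finset.ne_of_mem_erase hj), ← hc]
      linarith

theorem block_bound {A : Module.End ℂ (Extended N)} {K : List (Fin N)} {q : ℝ}
    (h : Decays A K q) (s t : Fin N →₀ ℕ) : ∃ C, 0 ≤ C ∧ ∀ m m' : ℕ,
      ‖coeff s (block A m' m (monomial t 1))‖ ≤ C * ((m : ℝ) + 1) ^ q := by
  obtain ⟨C, hC, hb⟩ := h.bound t s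
  refine ⟨C, hC, fun m m' => ?_⟩
  rw [coeff_block, ← monomial_cons]
  exact hb m m'

theorem isAuxTrace_Q {ℓ δ : Fin N → ℂ} (hℓ : GenericSpins ℓ) {u₁ : ℂ}
    (hu : Admissible ℓ δ u₁) (u₂ : ℂ) : IsAuxTrace (monodromy₂ ℓ δ u₁ u₂) (Q ℓ δ u₁ u₂) := by
  obtain ⟨q, hq, h⟩ := decays_monodromy hℓ hu u₂
  refine isAuxTrace_auxTrace (exists_isAuxTrace h.homogeneous fun s t => ?_)
  obtain ⟨C, _, hb⟩ := block_bound h s t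
  exact summable_of_bound hq fun m => hb m m

theorem evalsTo_Q {ℓ δ : Fin N → ℂ} (hℓ : GenericSpins ℓ) {u₁ : ℂ}
    (hu : Admissible ℓ δ u₁) (u₂ : ℂ) : EvalsTo (qSeries ℓ δ u₁ u₂) (Q ℓ δ u₁ u₂) :=
  (isAuxTrace_iff_evalsTo _ _ _ _ _).1 (isAuxTrace_Q hℓ hu u₂)

end Decay

/-! ### Invariance under the total generators -/

section Invariance

open Filter Topology

variable {N : ℕ}

theorem op_ext {A B : Op N} (h : ∀ t, A (monomial t 1) = B (monomial t 1)) : A = B :=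
  (basisMonomials (Fin N) ℂ).ext fun t => by simpa using h t

theorem EvalsTo.coeff_eq_zero {F : PowerSeries (Op N)} {T : Op N} (h : EvalsTo F T)
    {Ψ : Quantum N} {s : Fin N →₀ ℕ} (h0 : ∀ m, coeff s (PowerSeries.coeff m F Ψ) = 0) :
    coeff s (T Ψ) = 0 := by
  refine (h Ψ s).unique ?_
  simp only [h0]
  exact hasSum_zero

/-- A substitute for cyclicity of the trace over `V_0`: the auxiliary part of the generator only
produces a flow `a` between neighbouring levels. The partial sums of the commutator equal `a n`,
which tends to zero. -/
theorem commute_of_telescope {F : PowerSeries (Op N)} {T D : Op N} (hF : EvalsTo F T)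
    (hR : FiniteRange F) (a : ℕ → Op N) (h0 : a 0 = 0)
    (h : ∀ m, PowerSeries.coeff m F * D + a m = D * PowerSeries.coeff m F + a (m + 1))
    (ha : ∀ s t, Tendsto (fun m => coeff s (a (m + 1) (monomial t 1))) atTop (𝓝 0)) :
    Commute T D := by
  refine op_ext fun t => ?_
  ext s
  have h1 := hF.mul (evalsTo_C D) (finiteRange_C D) (monomial t 1) s
  have h2 := (evalsTo_C D).mul hF hR (monomial t 1) s
  have h3 := (h1.sub h2).tendsto_sum_nat
  have h4 : ∀ n, ∑ m ∈ Finset.range n,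
      (coeff s (PowerSeries.coeff m (F * PowerSeries.C D) (monomial t 1)) -
        coeff s (PowerSeries.coeff m (PowerSeries.C D * F) (monomial t 1))) =
      coeff s (a n (monomial t 1)) := by
    intro n
    rw [← sub_zero (coeff s (a n (monomial t 1)))]
    have e0 : (0 : ℂ) = coeff s (a 0 (monomial t 1)) := by rw [h0]; simp
    rw [e0, ← Finset.sum_range_sub (fun m => coeff s (a m (monomial t 1)))]
    refine Finset.sum_congr rfl fun m _ => ?_
    have := congrArg (fun A : Op N => coeff s (A (monomial t 1))) (h m)
    simp only [LinearMap.add_apply, coeff_add] at this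
    rw [PowerSeries.coeff_mul_C, PowerSeries.coeff_C_mul]
    linear_combination this
  simp only [h4] at h3
  exact sub_eq_zero.1 (tendsto_nhds_unique h3 ((tendsto_add_atTop_iff_nat 1).1 (ha s t)))

/-- The factors from the auxiliary generators grow at most linearly in the level, so an exponent
below `-1` is enough. -/
theorem tendsto_zero_of_bound {b c : ℕ → ℂ} {q C K : ℝ} (hq : q < -1)
    (hb : ∀ n : ℕ, ‖b n‖ ≤ C * ((n : ℝ) + 1) ^ q) (hc : ∀ n : ℕ, ‖c n‖ ≤ K * ((n : ℝ) + 1)) :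
    Tendsto (fun n => c n * b n) atTop (𝓝 0) := by
  have h1 : Tendsto (fun n : ℕ => K * C * ((n : ℝ) + 1) ^ (-(-(q + 1)))) atTop (𝓝 (K * C * 0)) :=
    ((tendsto_rpow_neg_atTop (y := -(q + 1)) (by linarith)).comp
      (tendsto_atTop_add_const_right _ 1 tendsto_natCast_atTop_atTop)).const_mul _
  rw [mul_zero] at h1
  refine squeeze_zero_norm (fun n => ?_) h1
  rw [norm_mul, neg_neg, Real.rpow_add (by positivity), Real.rpow_one]
  refine (mul_le_mul (hc n) (hb n) (norm_nonneg _) ((norm_nonneg _).trans (hc n))).trans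
    (le_of_eq ?_)
  ring

theorem commute_total_prod {R : Type*} [Ring R] {D₀ : R} {D S : Fin N → R}
    (h : ∀ k, Commute (D k + D₀) (S k)) (h' : ∀ j k, j ≠ k → Commute (D j) (S k)) :
    Commute (D₀ + ∑ k, D k) ((List.finRange N).map S).prod := by
  refine Commute.list_prod_right _ _ fun x hx => ?_
  obtain ⟨k, _, rfl⟩ := List.mem_map.1 hx
  rw [← Finset.add_sum_erase _ _ (Finset.mem_univ k), ← add_assoc, add_comm D₀]
  exact (h k).add_left (Commute.sum_left _ _ _ fun j hj => h' j k (Finset.ne_of_mem_erase hj))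

theorem commute_del_monodromy (ℓ δ : Fin N → ℂ) (u₁ u₂ : ℂ) :
    Commute (del 0 + ∑ k : Fin N, del k.succ) (monodromy₂ ℓ δ u₁ u₂) := by
  rw [monodromy₂_eq]
  exact commute_total_prod (fun k => commute_del_add_siteOp (Fin.succ_ne_zero k) _ _)
    fun j k h => commute_del_siteOp (Fin.succ_ne_zero k)
      (fun e => h (Fin.succ_injective _ e)) (Fin.succ_ne_zero j) _ _

/-- The coefficient `u₂ - u₁ + 1` is twice the auxiliary spin `ℓ₀`. -/
theorem commute_raise_monodromy {ℓ δ : Fin N → ℂ} (hℓ : GenericSpins ℓ) {u₁ : ℂ}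
    (hu : PoleFree ℓ δ u₁) (u₂ : ℂ) :
    Commute ((mulZ 0 ^ 2 * del 0 + (u₂ - u₁ + 1) • mulZ 0) +
      ∑ k : Fin N, (mulZ k.succ ^ 2 * del k.succ + (2 * ℓ k) • mulZ k.succ))
      (monodromy₂ ℓ δ u₁ u₂) := by
  rw [monodromy₂_eq]
  refine commute_total_prod (fun k => ?_) fun j k h => ?_
  · exact commute_raise_siteOp (Fin.succ_ne_zero k) (hℓ k) (hu k) (by ring)
  · have h1 : Commute (mulZ j.succ) (site ℓ δ u₁ u₂ k) :=
      commute_mulZ_siteOp (Fin.succ_ne_zero k) (fun e => h (Fin.succ_injective _ e))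
        (Fin.succ_ne_zero j) _ _
    have h2 : Commute (del j.succ) (site ℓ δ u₁ u₂ k) :=
      commute_del_siteOp (Fin.succ_ne_zero k) (fun e => h (Fin.succ_injective _ e))
        (Fin.succ_ne_zero j) _ _
    exact ((h1.pow_left 2).mul_left h2).add_left (h1.smul_left _)

theorem block_mul_raise (A : Module.End ℂ (Extended N)) (c : ℂ) (m' m : ℕ) :
    block (A * (mulZ 0 ^ 2 * del 0 + c • mulZ 0)) m' m = ((m : ℂ) + c) • block A m' (m + 1) := by
  rw [mul_add, mul_smul_comm, block_add, block_smul, block_mul_mulZ, ← mul_assoc, block_mul_del,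
    sq, ← mul_assoc, block_mul_mulZ, block_mul_mulZ, add_smul]
  cases m with
  | zero => simp
  | succ m => rfl

theorem block_raise_mul_zero (A : Module.End ℂ (Extended N)) (c : ℂ) (m : ℕ) :
    block ((mulZ 0 ^ 2 * del 0 + c • mulZ 0) * A) 0 m = 0 := by
  rw [add_mul, smul_mul_assoc, block_add, block_smul, sq, mul_assoc, mul_assoc,
    block_mulZ_mul_zero, block_mulZ_mul_zero, smul_zero, add_zero]

theorem block_raise_mul_succ (A : Module.End ℂ (Extended N)) (c : ℂ) (m' m : ℕ) :
    block ((mulZ 0 ^ 2 * del 0 + c • mulZ 0) * A) (m' + 1) m =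
      ((m' : ℂ) + c) • block A m' m := by
  rw [add_mul, smul_mul_assoc, block_add, block_smul, sq, mul_assoc, mul_assoc,
    block_mulZ_mul_succ, block_mulZ_mul_succ, add_smul]
  congr 1
  cases m' with
  | zero => rw [block_mulZ_mul_zero, Nat.cast_zero, zero_smul]
  | succ m' => rw [block_mulZ_mul_succ, block_del_mul]; push_cast; rfl

variable {ℓ δ : Fin N → ℂ}

theorem commute_Q_totalSminus (hℓ : GenericSpins ℓ) {u₁ : ℂ} (hu : Admissible ℓ δ u₁) (u₂ : ℂ) :
    Commute (Q ℓ δ u₁ u₂) (totalSminus N) := by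
  have hneg : totalSminus N = -∑ k, del k := by rw [totalSminus, Finset.sum_neg_distrib]
  suffices h : Commute (Q ℓ δ u₁ u₂) (∑ k, del k) by rw [hneg]; exact h.neg_right
  have hc := (commute_del_monodromy ℓ δ u₁ u₂).eq
  obtain ⟨q, hq, hD⟩ := decays_monodromy hℓ hu u₂
  have hL : Lifts (∑ k : Fin N, del k.succ) (∑ k, del k) := Lifts.sum _ Lifts.del
  refine commute_of_telescope (evalsTo_Q hℓ hu u₂) (finiteRange_qSeries ℓ δ u₁ u₂)
    -- The diagonal blocks of `A ∂_0` give this sequence and those of `∂_0 A` give the same sequence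
    -- one step later.
    (fun m => (m : ℂ) • block (monodromy₂ ℓ δ u₁ u₂) m (m - 1)) (by simp) (fun m => ?_)
    fun s t => ?_
  · have h := congrArg (fun A => block A m m) hc
    simp only [add_mul, mul_add, block_add, block_del_mul, block_mul_del, hL.block_mul,
      hL.mul_block] at h
    rw [coeff_qSeries, add_comm, ← h, add_comm]
    push_cast
    rfl
  · obtain ⟨C, hC, hb⟩ := block_bound hD s t
    simp only [LinearMap.smul_apply, coeff_smul, smul_eq_mul, add_tsub_cancel_right]
    refine tendsto_zero_of_bound (K := 1) hq (fun n => hb n (n + 1)) fun n => ?_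
    rw [Complex.norm_natCast]
    push_cast
    linarith

theorem commute_Q_totalSplus (hℓ : GenericSpins ℓ) {u₁ : ℂ} (hu : Admissible ℓ δ u₁) (u₂ : ℂ) :
    Commute (Q ℓ δ u₁ u₂) (totalSplus ℓ) := by
  have hc := (commute_raise_monodromy hℓ hu.1 u₂).eq
  obtain ⟨q, hq, hD⟩ := decays_monodromy hℓ hu u₂
  have hL : Lifts (∑ k : Fin N, (mulZ k.succ ^ 2 * del k.succ + (2 * ℓ k) • mulZ k.succ))
      (totalSplus ℓ) := by
    refine Lifts.sum _ fun k => ?_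
    rw [sq, sq]
    exact (((Lifts.mulZ k).mul (Lifts.mulZ k)).mul (Lifts.del k)).add ((Lifts.mulZ k).smul _)
  obtain ⟨c, hcc⟩ : ∃ c, c = u₂ - u₁ + 1 := ⟨_, rfl⟩
  rw [← hcc] at hc
  obtain ⟨T, hT⟩ : ∃ T, T = monodromy₂ ℓ δ u₁ u₂ := ⟨_, rfl⟩
  rw [← hT] at hc hD
  refine commute_of_telescope (evalsTo_Q hℓ hu u₂) (finiteRange_qSeries ℓ δ u₁ u₂)
    -- The flow from level `m` to level `m + 1` sits at index `m + 1`; nothing enters below level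
    -- `0`, and the sign reflects that this generator raises the level.
    (fun m => Nat.casesOn m 0 fun m => -(((m : ℂ) + c) • block T m (m + 1))) rfl (fun m => ?_)
    fun s t => ?_
  · rw [add_mul, mul_add] at hc
    have h := congrArg (fun A => block A m m) hc
    simp only [block_add, block_mul_raise, hL.block_mul, hL.mul_block] at h
    rw [coeff_qSeries, ← hT]
    cases m with
    | zero =>
      rw [block_raise_mul_zero, zero_add] at h
      show _ + 0 = _ + -_
      rw [h]
      abel
    | succ m =>
      rw [block_raise_mul_succ] at h
      show _ + -_ = _ + -_
      rw [← sub_eq_add_neg, ← sub_eq_add_neg, sub_eq_sub_iff_add_eq_add, add_comm, ← h, add_comm]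
  · obtain ⟨C, hC, hb⟩ := block_bound hD s t
    simp only [LinearMap.neg_apply, LinearMap.smul_apply, coeff_neg, coeff_smul, smul_eq_mul]
    rw [← neg_zero]
    refine Tendsto.neg (tendsto_zero_of_bound (K := 1 + ‖c‖) (C := C) hq (fun n => ?_)
      fun n => ?_)
    · refine (hb (n + 1) n).trans (mul_le_mul_of_nonneg_left ?_ hC)
      refine Real.rpow_le_rpow_of_nonpos (by positivity) ?_ (by linarith)
      push_cast
      linarith
    · have h1 := norm_add_le (n : ℂ) c
      rw [Complex.norm_natCast] at h1
      have h2 : (0 : ℝ) ≤ n := n.cast_nonneg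
      nlinarith [mul_nonneg (norm_nonneg c) h2]

/-- By Euler's identity `S` is a scalar on homogeneous polynomials of given degree, and the trace
preserves the degree because every diagonal block does. -/
theorem commute_Q_totalS (hℓ : GenericSpins ℓ) {u₁ : ℂ} (hu : Admissible ℓ δ u₁) (u₂ : ℂ) :
    Commute (Q ℓ δ u₁ u₂) (totalS ℓ) := by
  have hE : ∀ {n : ℕ} {p : Quantum N}, p.IsHomogeneous n →
      totalS ℓ p = ((n : ℂ) + ∑ k, ℓ k) • p := by
    intro n p hp
    have h := hp.sum_X_mul_pderiv
    rw [totalS, Finset.sum_add_distrib, ← Finset.sum_smul, LinearMap.add_apply, add_smul,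
      LinearMap.smul_apply, Module.End.one_apply, LinearMap.sum_apply]
    congr 1
    rw [Nat.cast_smul_eq_nsmul]
    exact h
  refine op_ext fun t => ?_
  have h1 : (monomial t (1 : ℂ)).IsHomogeneous t.degree := isHomogeneous_monomial 1 rfl
  have h2 : (Q ℓ δ u₁ u₂ (monomial t 1)).IsHomogeneous t.degree := by
    rw [← mem_homogeneousSubmodule, homogeneousSubmodule_eq_finsupp_supported]
    intro s hs
    by_contra hne
    refine mem_support_iff.1 hs ((evalsTo_Q hℓ hu u₂).coeff_eq_zero fun m => ?_)
    by_contra h0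
    rw [coeff_qSeries] at h0
    have := block_coeff_degree (fun _ _ => monodromy_isHomogeneous ℓ δ u₁ u₂) h0
    exact hne (show s.degree = t.degree by omega)
  rw [Module.End.mul_apply, Module.End.mul_apply, hE h1, hE h2, map_smul]

theorem isSl2Invariant_Q (hℓ : GenericSpins ℓ) {u₁ : ℂ} (hu : Admissible ℓ δ u₁) (u₂ : ℂ) :
    IsSl2Invariant ℓ (Q ℓ δ u₁ u₂) :=
  ⟨commute_Q_totalS hℓ hu u₂, commute_Q_totalSplus hℓ hu u₂, commute_Q_totalSminus hℓ hu u₂⟩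

end Invariance

/-! ### Relations between the operators at twist one -/

section Relations

variable {N : ℕ} {ℓ δ : Fin N → ℂ}

theorem EvalsTo.X_mul {F : PowerSeries (Op N)} {T : Op N} (h : EvalsTo F T) (hF : FiniteRange F) :
    EvalsTo (PowerSeries.X * F) T := by
  have := evalsTo_X.mul h hF
  rwa [one_mul] at this

theorem commute_Q_Q (hℓ : GenericSpins ℓ) {u₁ v₁ : ℂ} (hu : Admissible ℓ δ u₁)
    (hv : Admissible ℓ δ v₁) (u₂ v₂ : ℂ) : Commute (Q ℓ δ u₁ u₂) (Q ℓ δ v₁ v₂) := by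
  have h1 := (evalsTo_Q hℓ hu u₂).mul (evalsTo_Q hℓ hv v₂) (finiteRange_qSeries ℓ δ v₁ v₂)
  have h2 := (evalsTo_Q hℓ hv v₂).mul (evalsTo_Q hℓ hu u₂) (finiteRange_qSeries ℓ δ u₁ u₂)
  rw [(commute_qSeries_qSeries hℓ hu.1 hv.1 u₂ v₂).eq] at h1
  exact h1.unique h2

theorem commute_Q_transfer (hℓ : GenericSpins ℓ) {u₁ : ℂ} (hu : Admissible ℓ δ u₁) (u₂ v : ℂ) :
    Commute (Q ℓ δ u₁ u₂) (transfer ℓ δ v) := by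
  have h1 := (evalsTo_Q hℓ hu u₂).mul (evalsTo_tSeries ℓ δ v) (finiteRange_tSeries ℓ δ v)
  have h2 := (evalsTo_tSeries ℓ δ v).mul (evalsTo_Q hℓ hu u₂) (finiteRange_qSeries ℓ δ u₁ u₂)
  rw [(commute_tSeries_qSeries hℓ hu.1 v u₂).eq] at h2
  exact h1.unique h2

theorem Q_mul_transfer (hℓ : GenericSpins ℓ) {u₁ : ℂ} (hu : Admissible ℓ δ u₁) (u : ℂ) :
    Q ℓ δ u₁ u * transfer ℓ δ u =
      DeltaPlus ℓ δ u • Q ℓ δ u₁ (u + 1) + DeltaMinus ℓ δ u • Q ℓ δ u₁ (u - 1) := by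
  have h1 := (evalsTo_Q hℓ hu u).mul (evalsTo_tSeries ℓ δ u) (finiteRange_tSeries ℓ δ u)
  rw [isBaxter_qSeries hℓ δ u₁ u, add_comm] at h1
  exact h1.unique ((((evalsTo_Q hℓ hu (u + 1)).X_mul (finiteRange_qSeries ℓ δ u₁ _)).smul _).add
    ((evalsTo_Q hℓ hu (u - 1)).smul _))

theorem transfer_mul_Q (hℓ : GenericSpins ℓ) {u : ℂ} (h₀ : Admissible ℓ δ (u - 1))
    (h₁ : Admissible ℓ δ u) (h₂ : Admissible ℓ δ (u + 1)) (u₂ : ℂ) :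
    transfer ℓ δ u * Q ℓ δ u u₂ =
      (DeltaPlus ℓ δ (u - 1) * DeltaMinus ℓ δ u / DeltaMinus ℓ δ (u - 1)) • Q ℓ δ (u - 1) u₂ +
        DeltaMinus ℓ δ u • Q ℓ δ (u + 1) u₂ := by
  have h := (evalsTo_tSeries ℓ δ u).mul (evalsTo_Q hℓ h₁ u₂) (finiteRange_qSeries ℓ δ u u₂)
  rw [tSeries_mul_qSeries hℓ h₂.1 u₂] at h
  exact h.unique ((((evalsTo_Q hℓ h₀ u₂).X_mul (finiteRange_qSeries ℓ δ _ _)).smul _).add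
    ((evalsTo_Q hℓ h₂ u₂).smul _))

end Relations

/-! ### The homogeneous chain -/

section Homogeneous

variable {N : ℕ}

theorem gammaRatio_self {a : ℂ} (ha : ∀ n : ℕ, a ≠ -(n : ℂ)) : gammaRatio a a = 1 :=
  funext fun n => div_self (ascPochhammer_eval_ne_zero ha n)

/-- At this point absence of poles is the genericity of the spin, and the series terminates at any
site, with `n = 0`; this is where a nonempty chain is needed. -/
theorem admissible_one_sub (hN : 0 < N) {ℓ : ℂ} (hℓ : GenericSpins fun _ : Fin N => ℓ) :
    Admissible (fun _ : Fin N => ℓ) (fun _ => 0) (1 - ℓ) :=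
  ⟨fun k n h => hℓ k n (by linear_combination h), Or.inr ⟨⟨0, hN⟩, 0, by simp⟩⟩

/-- At `u₁ = 1 - ℓ` the two parameters of the Gamma ratio in `𝓡⁺` coincide, so that factor is the
identity. -/
theorem monodromyMinus_eq {ℓ : ℂ} (hℓ : GenericSpins fun _ : Fin N => ℓ) (u : ℂ) :
    monodromyMinus N ℓ u = monodromy₂ (fun _ => ℓ) (fun _ => 0) (1 - ℓ) u := by
  rw [monodromyMinus, monodromy₂, monodromy]
  refine congrArg (fun f => (List.ofFn f).prod) (funext fun k => ?_)
  have e : Rplus k.succ 0 ((1 - ℓ + u - 1) / 2 + 0 + ℓ) ((u - (1 - ℓ) + 1) / 2)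
      ((1 - ℓ + u - 1) / 2 + 0 - ℓ) = (1 : Module.End ℂ (Extended N)) := by
    have h1 : (1 - ℓ + u - 1) / 2 + 0 + ℓ - ((1 - ℓ + u - 1) / 2 + 0 - ℓ) = 2 * ℓ := by ring
    have h2 : (u - (1 - ℓ) + 1) / 2 - ((1 - ℓ + u - 1) / 2 + 0 - ℓ) = 2 * ℓ := by ring
    rw [Rplus, h1, h2, gammaRatio_self (hℓ k), diffFun_one (Fin.succ_ne_zero k).symm]
  have h3 : (1 - ℓ + u - 1) / 2 + 0 + ℓ - -((u - (1 - ℓ) + 1) / 2) = u + ℓ - 0 := by ring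
  have h4 : (1 - ℓ + u - 1) / 2 + 0 + ℓ - ((1 - ℓ + u - 1) / 2 + 0 - ℓ) = u + ℓ - (u - ℓ) := by
    ring
  rw [Rmatrix, e, mul_one, Rminus, Rminus, h3, h4]

/-- At `u₂ = ℓ` the two parameters of the Gamma ratio in `𝓡⁻` coincide, so that factor is the
identity. -/
theorem monodromyPlus_eq {ℓ : ℂ} (hℓ : GenericSpins fun _ : Fin N => ℓ) (u : ℂ) :
    monodromyPlus N ℓ u = monodromy₂ (fun _ => ℓ) (fun _ => 0) u ℓ := by
  rw [monodromyPlus, monodromy₂, monodromy]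
  refine congrArg (fun f => (List.ofFn f).prod) (funext fun k => ?_)
  have e : Rminus k.succ 0 ((u + ℓ - 1) / 2 + 0 + ℓ) ((u + ℓ - 1) / 2 + 0 - ℓ)
      (-((ℓ - u + 1) / 2)) = (1 : Module.End ℂ (Extended N)) := by
    have h1 : (u + ℓ - 1) / 2 + 0 + ℓ - -((ℓ - u + 1) / 2) = 2 * ℓ := by ring
    have h2 : (u + ℓ - 1) / 2 + 0 + ℓ - ((u + ℓ - 1) / 2 + 0 - ℓ) = 2 * ℓ := by ring
    rw [Rminus, h1, h2, gammaRatio_self (hℓ k), diffFun_one (Fin.succ_ne_zero k)]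
  have h3 : (u + ℓ - 1) / 2 + 0 + ℓ - ((u + ℓ - 1) / 2 + 0 - ℓ) = u + ℓ - (u - ℓ) := by ring
  have h4 : (ℓ - u + 1) / 2 - ((u + ℓ - 1) / 2 + 0 - ℓ) = 1 - (u - ℓ) := by ring
  rw [Rmatrix, e, mul_one, Rplus, Rplus, h3, h4]

theorem deltaPlus_const (ℓ u : ℂ) :
    DeltaPlus (fun _ : Fin N => ℓ) (fun _ => 0) u = (u + ℓ) ^ N := by
  simp [DeltaPlus]

theorem deltaMinus_const (ℓ u : ℂ) :
    DeltaMinus (fun _ : Fin N => ℓ) (fun _ => 0) u = (u - ℓ) ^ N := by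
  simp [DeltaMinus]

end Homogeneous

end XXX

end

/-! ### The main theorem -/

theorem mainTheorem12 (N : ℕ) (hN : 0 < N) :
    (∀ ℓ δ : Fin N → ℂ, XXX.GenericSpins ℓ →
      (∀ u₁ u₂ : ℂ, XXX.Admissible ℓ δ u₁ →
        XXX.IsAuxTrace (XXX.monodromy₂ ℓ δ u₁ u₂) (XXX.Q ℓ δ u₁ u₂) ∧
        XXX.IsSl2Invariant ℓ (XXX.Q ℓ δ u₁ u₂)) ∧
      (∀ u₁ u₂ v₁ v₂ : ℂ, XXX.Admissible ℓ δ u₁ → XXX.Admissible ℓ δ v₁ →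
        Commute (XXX.Q ℓ δ u₁ u₂) (XXX.Q ℓ δ v₁ v₂)) ∧
      (∀ u₁ u₂ v : ℂ, XXX.Admissible ℓ δ u₁ →
        Commute (XXX.Q ℓ δ u₁ u₂) (XXX.transfer ℓ δ v)) ∧
      (∀ u₁ u : ℂ, XXX.Admissible ℓ δ u₁ →
        XXX.Q ℓ δ u₁ u * XXX.transfer ℓ δ u =
          XXX.DeltaPlus ℓ δ u • XXX.Q ℓ δ u₁ (u + 1) +
          XXX.DeltaMinus ℓ δ u • XXX.Q ℓ δ u₁ (u - 1)) ∧
      (∀ u u₂ : ℂ, XXX.Admissible ℓ δ (u - 1) → XXX.Admissible ℓ δ u →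
        XXX.Admissible ℓ δ (u + 1) →
        XXX.transfer ℓ δ u * XXX.Q ℓ δ u u₂ =
          (XXX.DeltaPlus ℓ δ (u - 1) * XXX.DeltaMinus ℓ δ u / XXX.DeltaMinus ℓ δ (u - 1)) •
            XXX.Q ℓ δ (u - 1) u₂ +
          XXX.DeltaMinus ℓ δ u • XXX.Q ℓ δ (u + 1) u₂)) ∧
    (∀ (ℓ : ℂ) (hl hd : Fin N → ℂ), hl = (fun _ => ℓ) → hd = (fun _ => 0) →
      XXX.GenericSpins hl →
      (∀ u : ℂ,
        XXX.IsAuxTrace (XXX.monodromyMinus N ℓ u) (XXX.Qminus N ℓ u) ∧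
        XXX.Qminus N ℓ u = XXX.Q hl hd (1 - ℓ) u ∧
        XXX.IsSl2Invariant hl (XXX.Qminus N ℓ u)) ∧
      (∀ u : ℂ, XXX.Admissible hl hd u →
        XXX.IsAuxTrace (XXX.monodromyPlus N ℓ u) (XXX.Qplus N ℓ u) ∧
        XXX.Qplus N ℓ u = XXX.Q hl hd u ℓ ∧
        XXX.IsSl2Invariant hl (XXX.Qplus N ℓ u)) ∧
      (∀ u v : ℂ, Commute (XXX.Qminus N ℓ u) (XXX.Qminus N ℓ v)) ∧
      (∀ u v : ℂ, XXX.Admissible hl hd u → XXX.Admissible hl hd v →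
        Commute (XXX.Qplus N ℓ u) (XXX.Qplus N ℓ v)) ∧
      (∀ u v : ℂ, XXX.Admissible hl hd u →
        Commute (XXX.Qplus N ℓ u) (XXX.Qminus N ℓ v)) ∧
      (∀ u v : ℂ, Commute (XXX.Qminus N ℓ u) (XXX.transfer hl hd v)) ∧
      (∀ u v : ℂ, XXX.Admissible hl hd u →
        Commute (XXX.Qplus N ℓ u) (XXX.transfer hl hd v)) ∧
      (∀ u : ℂ,
        XXX.Qminus N ℓ u * XXX.transfer hl hd u =
          ((u + ℓ) ^ N) • XXX.Qminus N ℓ (u + 1) + ((u - ℓ) ^ N) • XXX.Qminus N ℓ (u - 1)) ∧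
      (∀ u : ℂ, XXX.Admissible hl hd (u - 1) → XXX.Admissible hl hd u →
        XXX.Admissible hl hd (u + 1) →
        XXX.transfer hl hd u * XXX.Qplus N ℓ u =
          ((u - 1 + ℓ) ^ N * (u - ℓ) ^ N / (u - 1 - ℓ) ^ N) • XXX.Qplus N ℓ (u - 1) +
          ((u - ℓ) ^ N) • XXX.Qplus N ℓ (u + 1))) := by
  refine ⟨fun ℓ δ hℓ => ⟨fun u₁ u₂ hu => ⟨XXX.isAuxTrace_Q hℓ hu u₂, XXX.isSl2Invariant_Q hℓ hu u₂⟩,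
    fun u₁ u₂ v₁ v₂ hu hv => XXX.commute_Q_Q hℓ hu hv u₂ v₂,
    fun u₁ u₂ v hu => XXX.commute_Q_transfer hℓ hu u₂ v,
    fun u₁ u hu => XXX.Q_mul_transfer hℓ hu u,
    fun u u₂ h₀ h₁ h₂ => XXX.transfer_mul_Q hℓ h₀ h₁ h₂ u₂⟩, ?_⟩
  rintro ℓ _ _ rfl rfl hℓ
  have hm := XXX.admissible_one_sub hN hℓ
  have em : ∀ u, XXX.Qminus N ℓ u = XXX.Q (fun _ => ℓ) (fun _ => 0) (1 - ℓ) u := fun u => by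
    rw [XXX.Qminus, XXX.monodromyMinus_eq hℓ, XXX.Q]
  have ep : ∀ u, XXX.Qplus N ℓ u = XXX.Q (fun _ => ℓ) (fun _ => 0) u ℓ := fun u => by
    rw [XXX.Qplus, XXX.monodromyPlus_eq hℓ, XXX.Q]
  simp only [em, ep, XXX.monodromyMinus_eq hℓ, XXX.monodromyPlus_eq hℓ]
  refine ⟨fun u => ⟨XXX.isAuxTrace_Q hℓ hm u, trivial, XXX.isSl2Invariant_Q hℓ hm u⟩,
    fun u hu => ⟨XXX.isAuxTrace_Q hℓ hu ℓ, trivial, XXX.isSl2Invariant_Q hℓ hu ℓ⟩,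
    fun u v => XXX.commute_Q_Q hℓ hm hm u v,
    fun u v hu hv => XXX.commute_Q_Q hℓ hu hv ℓ ℓ,
    fun u v hu => XXX.commute_Q_Q hℓ hu hm ℓ v,
    fun u v => XXX.commute_Q_transfer hℓ hm u v,
    fun u v hu => XXX.commute_Q_transfer hℓ hu ℓ v, fun u => ?_, fun u h₀ h₁ h₂ => ?_⟩
  · have h := XXX.Q_mul_transfer hℓ hm u
    rwa [XXX.deltaPlus_const, XXX.deltaMinus_const] at h
  · have h := XXX.transfer_mul_Q hℓ h₀ h₁ h₂ ℓ
    rwa [XXX.deltaPlus_const, XXX.deltaMinus_const, XXX.deltaMinus_const] at h
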